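/- Let $\mathbb{D}=\{z\in\mathbb{C}:|z|<1\}$. Let $\mathcal{C}_3$ be the class of analytic functions $f(z)=z+\sum_{n=2}^{\infty}a_nz^n$ on $\mathbb{D}$ for which there is a convex function $g$ (that is, $g$ is analytic and univalent on $\mathbb{D}$ and $g(\mathbb{D})$ is convex) of the form $g(z)=b_1z+\cdots$, $\operatorname{Re} b_1>0$, with $$\operatorname{Re}\left(\frac{\bigl(z(zf'(z))'\bigr)'}{(zg'(z))'}\right)>0\qquad(z\in\mathbb{D}).$$ The equation $$\frac{2(2-r^2)r}{3(1-r)^2}-\frac13\int_0^r\frac{\log(1-t)}{t}\,dt-\frac13\log(1-r)+\sum_{n=2}^{\infty}\frac{r^n}{3n^2}-\left(\frac13+\frac{\pi^2}{36}\right)=0$$ has exactly one solution $r_{31}$ in $(0,1)$, and for every $f(z)=z+\sum_{n=2}^{\infty}a_nz^n\in\mathcal{C}_3$, $$|f(z)|+|f'(z)||z|+\sum_{n=2}^{\infty}|a_nz^n|\le d\bigl(f(0),\partial f(\mathbb{D})\bigr)\qquad\text{for } |z|\le r_{31},$$ where $d$ is the Euclidean distance and $\partial f(\mathbb{D})$ is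 the boundary of $f(\mathbb{D})$. The radius $r_{31}$ is sharp: there is an $f\in\mathcal{C}_3$ for which equality holds at $z=r_{31}$ and for which the inequality fails at $z=r$ for every $r\in(r_{31},1)$. -/

import Mathlib

open Set Metric

noncomputable section

/-- Convex functions `g(z) = b₁ z + ⋯` with `Re b₁ > 0`: analytic and univalent in the open unit
disc, with convex image. -/
structure IsConvexFunction (g : ℂ → ℂ) : Prop where
  differentiableOn : DifferentiableOn ℂ g (ball 0 1)
  injOn : InjOn g (ball 0 1)
  convex_image : Convex ℝ (g '' ball 0 1)
  map_zero : g 0 = 0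
  re_deriv_pos : 0 < (deriv g 0).re

/-- The operator `f ↦ z f'`. -/
def zDeriv (f : ℂ → ℂ) : ℂ → ℂ := fun z => z * deriv f z

/-- The class `𝒞₃` of normalized analytic functions `f(z) = z + a₂ z² + ⋯` in the open unit disc
such that, for some convex function `g`, `Re ((z (z f')')' / (z g')') > 0` in the disc.
(A zero of the denominator would give the value `0`, so the condition excludes it.) -/
structure MemC3 (f : ℂ → ℂ) : Prop where
  differentiableOn : DifferentiableOn ℂ f (ball 0 1)
  map_zero : f 0 = 0
  deriv_zero : deriv f 0 = 1
  exists_convex : ∃ g : ℂ → ℂ, IsConvexFunction g ∧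
    ∀ z ∈ ball (0 : ℂ) 1, 0 < (deriv (zDeriv (zDeriv f)) z / deriv (zDeriv g) z).re

/-- The Taylor coefficient `aₙ` of `f` at the origin. -/
def taylorCoeff (f : ℂ → ℂ) (n : ℕ) : ℂ := iteratedDeriv n f 0 / (n.factorial : ℂ)

/-- `|f(z)| + |f'(z)| |z| + ∑_{n ≥ 2} |aₙ zⁿ|`. -/
def bohrSum (f : ℂ → ℂ) (z : ℂ) : ℝ :=
  ‖f z‖ + ‖deriv f z‖ * ‖z‖ + ∑' n : ℕ, ‖taylorCoeff f (n + 2) * z ^ (n + 2)‖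

/-- `d(f(0), ∂f(𝔻))`. -/
def boundaryDist (f : ℂ → ℂ) : ℝ := infDist (f 0) (frontier (f '' ball 0 1))

/-- The left-hand side of the equation that determines the radius. -/
def radiusFun (r : ℝ) : ℝ :=
  2 * (2 - r ^ 2) * r / (3 * (1 - r) ^ 2)
    - 1 / 3 * (∫ t in (0 : ℝ)..r, Real.log (1 - t) / t)
    - 1 / 3 * Real.log (1 - r)
    + ∑' n : ℕ, r ^ (n + 2) / (3 * ((n : ℝ) + 2) ^ 2)
    - (1 / 3 + Real.pi ^ 2 / 36)

end

open Filter Topology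

/-! Scale the convex `g` so that |g'(0)| = 1, put D = 1/3 + π²/36, and let p be the quotient in the
definition of the class: Re p > 0 and |p(0)| = 1. The function F(z) = ∑ (2/3 + 1/(3n²)) zⁿ is
extremal both for the size of the coefficients and for the distance to the boundary.

Upper side. Comparing coefficients gives n³aₙ = ∑ k² bₖ pₙ₋ₖ with |bₖ| ≤ 1, |p₀| = 1 and |pⱼ| ≤ 2
otherwise; both bounds are instances of Rogosinski's theorem
(`norm_taylorCoeff_le_of_subordinate_convex`). Hence |aₙ| ≤ 2/3 + 1/(3n²)
(`MemC3.norm_taylorCoeff_le`), and summing three series bounds the Bohr sum by `radiusFun` + D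
(`MemC3.bohrSum_le`).

Lower side. The distance is at least D (`MemC3.le_boundaryDist`), because f is univalent and |f(z)|
≥ `growthBound` |z|, which tends to D. For the growth estimate let G = zg' and q = (zf')'/g'; then q
+ q'G/G' = p. A minimum principle (`le_re_mul_norm_zDeriv_of_le`) transfers a lower bound for
Re(mp), |m| = 1, to one for Re(mq)·|G| ≤ |z(zf')'|. Since p(0) is only unimodular, m has to be
adapted to arg p(0) and to |z|. The outcome (`exists_norm_zDeriv_zDeriv_ge`) is the bound expected
for p(0) = 1 plus a multiple κ of a term that may be negative; two radial integrations
(`le_norm_of_le_norm_deriv`) turn that term into κ(ρ² - ρ⁴)/18 ≥ 0. They require univalence of zf'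
and of f, which are close-to-convex (`MemC3.injOn_zDeriv`, `MemC3.injOn`).

Finally `radiusFun` increases strictly from negative to positive values, so its zero is unique and
is the radius. F has positive coefficients, so its Bohr sum at z = r is exactly `radiusFun` r + D,
while F(-r) → -D shows that its distance is exactly D. -/

/-! ### Injective holomorphic functions, their inverses, and subordination. -/

theorem nhds_le_map_nhds_of_injOn {U : Set ℂ} (hU : IsOpen U) {g : ℂ → ℂ}
    (hg : DifferentiableOn ℂ g U) (hinj : InjOn g U) {z : ℂ} (hz : z ∈ U) :
    𝓝 (g z) ≤ map g (𝓝 z) := by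
  have han : AnalyticAt ℂ g z := hg.analyticAt (hU.mem_nhds hz)
  refine han.eventually_constant_or_nhds_le_map_nhds.resolve_left fun hc => ?_
  have h2 : ∀ᶠ w in 𝓝[≠] z, False := by
    filter_upwards [hc.filter_mono nhdsWithin_le_nhds,
      mem_nhdsWithin_of_mem_nhds (hU.mem_nhds hz), self_mem_nhdsWithin] with w h1 h2 h3
    exact h3 (hinj h2 hz h1)
  simpa using h2.exists

theorem tendsto_invFunOn_of_injOn {U : Set ℂ} (hU : IsOpen U) {g : ℂ → ℂ}
    (hg : DifferentiableOn ℂ g U) (hinj : InjOn g U) {z : ℂ} (hz : z ∈ U) :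
    Tendsto (Function.invFunOn g U) (𝓝 (g z)) (𝓝 z) := by
  refine (tendsto_map' ?_).mono_left (nhds_le_map_nhds_of_injOn hU hg hinj hz)
  refine tendsto_id.congr' ?_
  filter_upwards [hU.mem_nhds hz] with w hw
  exact (hinj.leftInvOn_invFunOn hw).symm

theorem hasDerivAt_invFunOn_aux {U : Set ℂ} (hU : IsOpen U) {g : ℂ → ℂ}
    (hg : DifferentiableOn ℂ g U) (hinj : InjOn g U) {z : ℂ} (hz : z ∈ U)
    (h0 : deriv g z ≠ 0) : HasDerivAt (Function.invFunOn g U) (deriv g z)⁻¹ (g z) := by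
  have hl : Function.invFunOn g U (g z) = z := hinj.leftInvOn_invFunOn hz
  refine HasDerivAt.of_local_left_inverse (f := g) ?_ ?_ h0 ?_
  · rw [ContinuousAt, hl]; exact tendsto_invFunOn_of_injOn hU hg hinj hz
  · rw [hl]; exact (hg.differentiableAt (hU.mem_nhds hz)).hasDerivAt
  · refine (nhds_le_map_nhds_of_injOn hU hg hinj hz) ?_
    rw [mem_map]
    filter_upwards [hU.mem_nhds hz] with w hw
    show g (Function.invFunOn g U (g w)) = g w
    rw [hinj.leftInvOn_invFunOn hw]

/-- Zeros of g' are isolated, so the continuous inverse is holomorphic on a punctured neighbourhood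
of g(z). The singularity is removable, and the chain rule applied to the identity excludes g'(z) =
0. -/
theorem deriv_ne_zero_of_injOn {U : Set ℂ} (hU : IsOpen U) {g : ℂ → ℂ}
    (hg : DifferentiableOn ℂ g U) (hinj : InjOn g U) {z : ℂ} (hz : z ∈ U) :
    deriv g z ≠ 0 := by
  have hle := nhds_le_map_nhds_of_injOn hU hg hinj hz
  have hd : AnalyticAt ℂ (deriv g) z := (hg.analyticAt (hU.mem_nhds hz)).deriv
  have hne : ∀ᶠ w in 𝓝[≠] z, deriv g w ≠ 0 := by
    refine hd.eventually_eq_zero_or_eventually_ne_zero.resolve_left fun h0 => ?_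
    obtain ⟨r, hr, hball⟩ := Metric.eventually_nhds_iff_ball.1 (h0.and (hU.mem_nhds hz))
    have hconst : ∀ w ∈ ball z r, g w = g z := fun w hw =>
      IsOpen.is_const_of_deriv_eq_zero isOpen_ball (convex_ball z r).isPreconnected
        (hg.mono fun y hy => (hball y hy).2) (fun y hy => (hball y hy).1) hw (mem_ball_self hr)
    have h2 : z + (r / 2 : ℝ) ∈ ball z r := by
      rw [mem_ball_iff_norm, add_sub_cancel_left, Complex.norm_real, Real.norm_eq_abs,
        abs_of_pos (by positivity)]
      linarith
    have h3 := hinj (hball _ h2).2 hz (hconst _ h2)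
    have : ((r / 2 : ℝ) : ℂ) = 0 := by simpa using h3
    have : r / 2 = 0 := by exact_mod_cast this
    linarith
  have hφ : AnalyticAt ℂ (Function.invFunOn g U) (g z) := by
    refine Complex.analyticAt_of_differentiable_on_punctured_nhds_of_continuousAt ?_ ?_
    · rw [eventually_nhdsWithin_iff]
      apply hle
      rw [mem_map]
      filter_upwards [hU.mem_nhds hz, eventually_nhdsWithin_iff.1 hne] with w hw h1 h2
      exact (hasDerivAt_invFunOn_aux hU hg hinj hw (h1 fun h => h2 (by rw [h]; rfl))).differentiableAt
    · rw [ContinuousAt, hinj.leftInvOn_invFunOn hz]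
      exact tendsto_invFunOn_of_injOn hU hg hinj hz
  have hcomp := hφ.differentiableAt.hasDerivAt.comp z (hg.differentiableAt (hU.mem_nhds hz)).hasDerivAt
  have hid : HasDerivAt (Function.invFunOn g U ∘ g) 1 z := by
    refine (hasDerivAt_id z).congr_of_eventuallyEq ?_
    filter_upwards [hU.mem_nhds hz] with w hw
    exact hinj.leftInvOn_invFunOn hw
  intro h
  have := hid.unique hcomp
  rw [h, mul_zero] at this
  exact one_ne_zero this

theorem hasDerivAt_invFunOn {U : Set ℂ} (hU : IsOpen U) {g : ℂ → ℂ}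
    (hg : DifferentiableOn ℂ g U) (hinj : InjOn g U) {z : ℂ} (hz : z ∈ U) :
    HasDerivAt (Function.invFunOn g U) (deriv g z)⁻¹ (g z) :=
  hasDerivAt_invFunOn_aux hU hg hinj hz (deriv_ne_zero_of_injOn hU hg hinj hz)

theorem isOpen_image_of_injOn {U : Set ℂ} (hU : IsOpen U) {g : ℂ → ℂ}
    (hg : DifferentiableOn ℂ g U) (hinj : InjOn g U) : IsOpen (g '' U) := by
  rw [isOpen_iff_mem_nhds]
  rintro _ ⟨z, hz, rfl⟩
  exact nhds_le_map_nhds_of_injOn hU hg hinj hz (mem_map.2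
    (mem_of_superset (hU.mem_nhds hz) (subset_preimage_image g U)))

/-- A holomorphic injective function on the disc whose values include those of `h` subordinates
`h`: there is a Schwarz function `ω` with `h = g ∘ ω`. -/
theorem exists_schwarz_of_mapsTo_image {g h : ℂ → ℂ}
    (hg : DifferentiableOn ℂ g (ball 0 1)) (hinj : InjOn g (ball 0 1))
    (hh : DifferentiableOn ℂ h (ball 0 1)) (hmaps : MapsTo h (ball 0 1) (g '' ball 0 1))
    (h0 : h 0 = g 0) :
    ∃ ω : ℂ → ℂ, DifferentiableOn ℂ ω (ball 0 1) ∧ MapsTo ω (ball 0 1) (ball 0 1) ∧ ω 0 = 0 ∧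
      (∀ z ∈ ball (0 : ℂ) 1, g (ω z) = h z) ∧ ∀ z ∈ ball (0 : ℂ) 1, ‖ω z‖ ≤ ‖z‖ := by
  have hm : MapsTo (fun z => Function.invFunOn g (ball 0 1) (h z)) (ball 0 1) (ball 0 1) :=
    fun z hz => Function.invFunOn_mem (hmaps hz)
  have hd : DifferentiableOn ℂ (fun z => Function.invFunOn g (ball 0 1) (h z)) (ball 0 1) := by
    intro z hz
    obtain ⟨w, hw, hwz⟩ := hmaps hz
    have h1 := hasDerivAt_invFunOn isOpen_ball hg hinj hw
    rw [hwz] at h1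
    exact (h1.differentiableAt.comp z (hh.differentiableAt
      (isOpen_ball.mem_nhds hz))).differentiableWithinAt
  have hz0 : Function.invFunOn g (ball 0 1) (h 0) = 0 := by
    rw [h0]; exact hinj.leftInvOn_invFunOn (mem_ball_self one_pos)
  refine ⟨_, hd, hm, hz0, fun z hz => Function.invFunOn_eq (hmaps hz), fun z hz => ?_⟩
  exact Complex.norm_le_norm_of_mapsTo_ball hd (hm.mono_right ball_subset_closedBall) hz0
    (by simpa using hz)

/-! ### Functions with positive real part and the geometry of their value discs. -/

/-- Schwarz's lemma for functions with nonnegative real part. -/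
theorem norm_sub_le_of_re_nonneg {p : ℂ → ℂ} (hp : DifferentiableOn ℂ p (ball 0 1))
    (hre : ∀ z ∈ ball (0 : ℂ) 1, 0 ≤ (p z).re) (h0 : 0 < (p 0).re) {z : ℂ}
    (hz : z ∈ ball (0 : ℂ) 1) :
    ‖p z - p 0‖ ≤ ‖z‖ * ‖p z + (starRingEnd ℂ) (p 0)‖ := by
  have hne : ∀ w ∈ ball (0 : ℂ) 1, p w + (starRingEnd ℂ) (p 0) ≠ 0 := fun w hw h => by
    have := congrArg Complex.re h
    simp at this
    linarith [hre w hw]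
  have hd : DifferentiableOn ℂ (fun w => (p w - p 0) / (p w + (starRingEnd ℂ) (p 0)))
      (ball 0 1) := (hp.sub_const _).div (hp.add_const _) hne
  have hm : MapsTo (fun w => (p w - p 0) / (p w + (starRingEnd ℂ) (p 0))) (ball 0 1)
      (closedBall 0 1) := by
    intro w hw
    rw [mem_closedBall_zero_iff, norm_div, div_le_one (norm_pos_iff.2 (hne w hw))]
    rw [← sq_le_sq₀ (norm_nonneg _) (norm_nonneg _), Complex.sq_norm, Complex.sq_norm,
      Complex.normSq_apply, Complex.normSq_apply]
    simp
    nlinarith [mul_nonneg (hre w hw) h0.le]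
  have := Complex.norm_le_norm_of_mapsTo_ball hd hm (by simp) (by simpa using hz)
  rwa [norm_div, div_le_iff₀ (norm_pos_iff.2 (hne z hz))] at this

theorem re_bounds_of_norm_sub_one_le {q : ℂ} {ρ : ℝ} (h0 : 0 ≤ ρ) (h1 : ρ < 1)
    (h : ‖q - 1‖ ≤ ρ * ‖q + 1‖) :
    (1 - ρ) / (1 + ρ) ≤ q.re ∧ q.re ≤ (1 + ρ) / (1 - ρ) := by
  have h2 : ‖q - 1‖ ^ 2 ≤ (ρ * ‖q + 1‖) ^ 2 := by gcongr
  rw [mul_pow, Complex.sq_norm, Complex.sq_norm, Complex.normSq_apply, Complex.normSq_apply] at h2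
  simp at h2
  -- The squared hypothesis reads (1 - ρ²)(|q|² + 1) ≤ 2(1 + ρ²) Re q. Dropping (Im q)² leaves a
  -- quadratic in Re q with the two bounds as roots.
  have h3 : ((1 + ρ) * q.re - (1 - ρ)) * ((1 - ρ) * q.re - (1 + ρ)) ≤ 0 := by
    nlinarith [mul_nonneg (mul_self_nonneg q.im) (by nlinarith : (0 : ℝ) ≤ 1 - ρ ^ 2)]
  rw [div_le_iff₀ (by linarith), le_div_iff₀ (by linarith)]
  constructor
  · by_contra hc
    push Not at hc
    have : 0 < ((1 + ρ) * q.re - (1 - ρ)) * ((1 - ρ) * q.re - (1 + ρ)) :=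
      mul_pos_of_neg_of_neg (by linarith) (by nlinarith)
    linarith
  · by_contra hc
    push Not at hc
    have : 0 < ((1 + ρ) * q.re - (1 - ρ)) * ((1 - ρ) * q.re - (1 + ρ)) :=
      mul_pos (by nlinarith) (by linarith)
    linarith

theorem re_pos_of_norm_sub_one_le {q : ℂ} {ρ : ℝ} (h0 : 0 ≤ ρ) (h1 : ρ < 1)
    (h : ‖q - 1‖ ≤ ρ * ‖q + 1‖) : 0 < q.re :=
  lt_of_lt_of_le (div_pos (by linarith) (by linarith)) (re_bounds_of_norm_sub_one_le h0 h1 h).1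

theorem norm_inv_sub_one_le {q : ℂ} {ρ : ℝ} (hq : q ≠ 0)
    (h : ‖q - 1‖ ≤ ρ * ‖q + 1‖) : ‖q⁻¹ - 1‖ ≤ ρ * ‖q⁻¹ + 1‖ := by
  have e1 : q⁻¹ - 1 = -(q - 1) * q⁻¹ := by field_simp; ring
  have e2 : q⁻¹ + 1 = (q + 1) * q⁻¹ := by field_simp; ring
  rw [e1, e2, norm_mul, norm_mul, norm_neg, ← mul_assoc]
  gcongr

/-- A point of a disc lies in the half-plane that supports the disc in a given direction. -/
theorem le_linear_of_mem_disc {X Y C S R a b : ℝ} (hR : 0 ≤ R) (hab : a ^ 2 + b ^ 2 = 1)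
    (h : (X - C) ^ 2 + (Y - S) ^ 2 ≤ R ^ 2) : a * C + b * S - R ≤ a * X + b * Y := by
  have h1 : (a * (X - C) + b * (Y - S)) ^ 2 ≤ R ^ 2 := by
    nlinarith [sq_nonneg (a * (Y - S) - b * (X - C))]
  have := abs_le.1 (abs_le_of_sq_le_sq h1 hR)
  linarith [this.1]

/-- Lower bound for the real part of a rotated Carathéodory function whose value at the origin is
`(1 + i k) / (1 - i k)`; here `u = (1 - ρ) / (1 + ρ)`. -/
theorem re_rotated_lower_bound {p : ℂ} {k t u : ℝ} (hk : k ^ 2 < 1) (hu : 0 < u) (hu1 : u ≤ 1)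
    (h : ‖p - (1 + Complex.I * k) / (1 - Complex.I * k)‖ ≤
      (1 - u) / (1 + u) *
        ‖p + (starRingEnd ℂ) ((1 + Complex.I * k) / (1 - Complex.I * k))‖) :
    ((1 - k ^ 2) * (u ^ 2 - t ^ 2) + 4 * k * u * t) / ((1 + k ^ 2) * (1 + t ^ 2) * u) ≤
      (1 - t ^ 2) / (1 + t ^ 2) * p.re + 2 * t / (1 + t ^ 2) * p.im := by
  have hp0 : (1 + Complex.I * k) / (1 - Complex.I * k) =
      (((1 - k ^ 2) / (1 + k ^ 2) : ℝ) : ℂ) + ((2 * k / (1 + k ^ 2) : ℝ) : ℂ) * Complex.I := by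
    have h1 : (1 - Complex.I * k : ℂ) ≠ 0 := fun h => by
      have := congrArg Complex.re h; simp at this
    have h2 : (1 + (k : ℂ) ^ 2) ≠ 0 := by
      have : (1 + k ^ 2 : ℝ) ≠ 0 := by positivity
      exact_mod_cast this
    push_cast
    field_simp
    ring_nf
    simp [Complex.I_sq]
    ring
  rw [hp0] at h
  set c : ℝ := (1 - k ^ 2) / (1 + k ^ 2) with hc
  set s : ℝ := 2 * k / (1 + k ^ 2) with hs
  have hcpos : 0 < c := div_pos (by linarith) (by positivity)
  have h2 : (1 + u) ^ 2 * ‖p - ((c : ℂ) + s * Complex.I)‖ ^ 2 ≤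
      (1 - u) ^ 2 * ‖p + (starRingEnd ℂ) ((c : ℂ) + s * Complex.I)‖ ^ 2 := by
    have : (1 + u) * ‖p - ((c : ℂ) + s * Complex.I)‖ ≤
      (1 - u) * ‖p + (starRingEnd ℂ) ((c : ℂ) + s * Complex.I)‖ := by
      rw [div_mul_eq_mul_div, le_div_iff₀ (by linarith)] at h
      linarith
    rw [← mul_pow, ← mul_pow]
    gcongr
  rw [Complex.sq_norm, Complex.sq_norm, Complex.normSq_apply, Complex.normSq_apply] at h2
  simp at h2
  -- The value disc in Euclidean form, with c + is the value at the origin. The direction used below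
  -- has angle ψ with t = tan(ψ/2), and the support line of the disc gives the bound.
  have hdisc : (p.re - c * (u + 1 / u) / 2) ^ 2 + (p.im - s) ^ 2 ≤ (c * (1 / u - u) / 2) ^ 2 := by
    have e : (p.re - c * (u + 1 / u) / 2) ^ 2 + (p.im - s) ^ 2 - (c * (1 / u - u) / 2) ^ 2 =
        (u * (p.re ^ 2 + c ^ 2 + (p.im - s) ^ 2) - p.re * c * (u ^ 2 + 1)) / u := by
      field_simp; ring
    have : (u * (p.re ^ 2 + c ^ 2 + (p.im - s) ^ 2) - p.re * c * (u ^ 2 + 1)) / u ≤ 0 := by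
      apply div_nonpos_of_nonpos_of_nonneg _ hu.le
      nlinarith
    linarith
  have hR : 0 ≤ c * (1 / u - u) / 2 := by
    have : u ≤ 1 / u := by rw [le_div_iff₀ hu]; nlinarith
    have := mul_nonneg hcpos.le (sub_nonneg.2 this)
    linarith
  have hab : ((1 - t ^ 2) / (1 + t ^ 2)) ^ 2 + (2 * t / (1 + t ^ 2)) ^ 2 = 1 := by
    field_simp; ring
  refine le_trans (le_of_eq ?_) (le_linear_of_mem_disc hR hab hdisc)
  rw [hc, hs]
  field_simp
  ring

/-! ### Rogosinski's coefficient bound. -/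

theorem taylorCoeff_isBigO {f : ℂ → ℂ} (hf : AnalyticAt ℂ f 0) (n : ℕ) :
    (fun y : ℂ => f y - ∑ m ∈ Finset.range n, taylorCoeff f m * y ^ m) =O[𝓝 0]
      fun y => ‖y‖ ^ n := by
  have := hf.hasFPowerSeriesAt.isBigO_sub_partialSum_pow n
  simpa [FormalMultilinearSeries.partialSum, FormalMultilinearSeries.ofScalars_apply_eq,
    taylorCoeff, mul_comm] using this

theorem sum_rootsOfUnity_pow {n : ℕ} {ζ : ℂ} (hζ : IsPrimitiveRoot ζ n) (m : ℕ) :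
    ∑ j ∈ Finset.range n, (ζ ^ j) ^ m = if n ∣ m then (n : ℂ) else 0 := by
  have h1 : ∀ j, (ζ ^ j) ^ m = (ζ ^ m) ^ j := fun j => by rw [← pow_mul, ← pow_mul, mul_comm]
  simp_rw [h1]
  split_ifs with h
  · rw [(hζ.pow_eq_one_iff_dvd m).2 h]; simp
  · have hne : ζ ^ m ≠ 1 := fun e => h ((hζ.pow_eq_one_iff_dvd m).1 e)
    rw [geom_sum_eq hne, ← pow_mul, mul_comm, pow_mul, hζ.pow_eq_one]; simp

/-- Averaging over the n-th roots of unity kills every power whose exponent is not a multiple of n;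
among the degrees up to n only 0 and n survive. -/
theorem rootsOfUnity_average_isBigO {h : ℂ → ℂ} (hh : AnalyticAt ℂ h 0) {n : ℕ} (hn : 0 < n)
    {ζ : ℂ} (hζ : IsPrimitiveRoot ζ n) :
    (fun y : ℂ => (∑ j ∈ Finset.range n, (n : ℂ)⁻¹ * h (ζ ^ j * y)) - h 0
      - taylorCoeff h n * y ^ n) =O[𝓝 0] fun y => ‖y‖ ^ (n + 1) := by
  have hn0 : (n : ℂ) ≠ 0 := by exact_mod_cast hn.ne'
  have hnorm : ‖ζ‖ = 1 := hζ.norm'_eq_one hn.ne'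
  have hR := taylorCoeff_isBigO hh (n + 1)
  have hsum : (fun y : ℂ => ∑ j ∈ Finset.range n, (n : ℂ)⁻¹ * (h (ζ ^ j * y) -
      ∑ m ∈ Finset.range (n + 1), taylorCoeff h m * (ζ ^ j * y) ^ m)) =O[𝓝 0]
        fun y => ‖y‖ ^ (n + 1) := by
    refine Asymptotics.IsBigO.fun_sum fun j _ => ?_
    refine Asymptotics.IsBigO.const_mul_left (f := fun y : ℂ => h (ζ ^ j * y) -
      ∑ m ∈ Finset.range (n + 1), taylorCoeff h m * (ζ ^ j * y) ^ m) ?_ _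
    have ht : Tendsto (fun y : ℂ => ζ ^ j * y) (𝓝 0) (𝓝 0) := by
      have : Continuous fun y : ℂ => ζ ^ j * y := by fun_prop
      simpa using this.tendsto 0
    have := hR.comp_tendsto ht
    simpa [Function.comp_def, hnorm] using this
  refine hsum.congr_left fun y => ?_
  simp_rw [mul_sub, Finset.sum_sub_distrib]
  rw [sub_sub]
  congr 1
  simp_rw [Finset.mul_sum]
  rw [Finset.sum_comm]
  have h2 : ∀ m ∈ Finset.range (n + 1), ∑ j ∈ Finset.range n,
      (n : ℂ)⁻¹ * (taylorCoeff h m * (ζ ^ j * y) ^ m) =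
        taylorCoeff h m * y ^ m * if n ∣ m then 1 else 0 := by
    intro m _
    have : ∀ j, (n : ℂ)⁻¹ * (taylorCoeff h m * (ζ ^ j * y) ^ m) =
        ((n : ℂ)⁻¹ * taylorCoeff h m * y ^ m) * (ζ ^ j) ^ m := fun j => by rw [mul_pow]; ring
    simp_rw [this]
    rw [← Finset.mul_sum, sum_rootsOfUnity_pow hζ]
    split_ifs
    · field_simp
    · simp
  rw [Finset.sum_congr rfl h2, Finset.sum_range_succ, Finset.sum_eq_single 0]
  · simp [taylorCoeff]
  · intro m hm hm0
    rw [if_neg, mul_zero]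
    exact fun hd => absurd (Nat.le_of_dvd (Nat.pos_of_ne_zero hm0) hd)
      (not_le.2 (Finset.mem_range.1 hm))
  · intro h; exact absurd (Finset.mem_range.2 hn) h

/-- Rogosinski's coefficient bound for functions subordinate to a convex function. -/
theorem norm_taylorCoeff_le_of_subordinate_convex {g h : ℂ → ℂ}
    (hg : DifferentiableOn ℂ g (ball 0 1)) (hinj : InjOn g (ball 0 1))
    (hconv : Convex ℝ (g '' ball 0 1)) (hh : DifferentiableOn ℂ h (ball 0 1))
    (hmaps : MapsTo h (ball 0 1) (g '' ball 0 1)) (h0 : h 0 = g 0) {n : ℕ} (hn : 0 < n) :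
    ‖taylorCoeff h n‖ ≤ ‖deriv g 0‖ := by
  have hn0 : (n : ℂ) ≠ 0 := by exact_mod_cast hn.ne'
  have hζ := Complex.isPrimitiveRoot_exp n hn.ne'
  set ζ := Complex.exp (2 * Real.pi * Complex.I / n)
  have hnorm : ‖ζ‖ = 1 := hζ.norm'_eq_one hn.ne'
  have hmem0 : (ball (0 : ℂ) 1) ∈ 𝓝 0 := ball_mem_nhds 0 one_pos
  have hrot : ∀ j : ℕ, ∀ z ∈ ball (0 : ℂ) 1, ζ ^ j * z ∈ ball (0 : ℂ) 1 := fun j z hz => by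
    simpa [hnorm] using hz
  -- The average is a convex combination of values of h, so it is still subordinate to g, and its
  -- first nonconstant term is of order at least n.
  set H : ℂ → ℂ := fun y => ∑ j ∈ Finset.range n, (n : ℂ)⁻¹ * h (ζ ^ j * y) with hH
  have hHd : DifferentiableOn ℂ H (ball 0 1) := by
    refine DifferentiableOn.fun_sum fun j _ => DifferentiableOn.const_mul ?_ _
    exact hh.comp (by fun_prop) (hrot j)
  have hHm : MapsTo H (ball 0 1) (g '' ball 0 1) := by
    intro z hz
    have := hconv.sum_mem (t := Finset.range n) (w := fun _ => (n : ℝ)⁻¹)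
      (z := fun j => h (ζ ^ j * z)) (fun _ _ => by positivity)
      (by simp [hn.ne']) (fun j _ => hmaps (hrot j z hz))
    simpa [hH] using this
  have hH0 : H 0 = g 0 := by simp [hH, h0, hn.ne']
  obtain ⟨ω, hωd, hωm, hω0, hωeq, -⟩ := exists_schwarz_of_mapsTo_image hg hinj hHd hHm hH0
  have hbig := rootsOfUnity_average_isBigO (hh.analyticAt hmem0) hn hζ
  have hgd : HasDerivAt g (deriv g 0) 0 := (hg.differentiableAt hmem0).hasDerivAt
  have hg0 := deriv_ne_zero_of_injOn isOpen_ball hg hinj (mem_ball_self one_pos : (0:ℂ) ∈ ball 0 1)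
  have hωt : Tendsto ω (𝓝 0) (𝓝 0) := by
    have := (hωd.differentiableAt hmem0).continuousAt.tendsto
    rwa [hω0] at this
  have hHO : (fun y => H y - H 0) =O[𝓝 0] fun y => ‖y‖ ^ n := by
    have h1 : (fun y : ℂ => ‖y‖ ^ (n + 1)) =O[𝓝 0] fun y => ‖y‖ ^ n := by
      refine Asymptotics.IsBigO.of_bound 1 ?_
      filter_upwards [hmem0] with y hy
      have hy1 : ‖y‖ ≤ 1 := (mem_ball_zero_iff.1 hy).le
      simpa using pow_le_pow_of_le_one (norm_nonneg y) hy1 (Nat.le_succ n)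
    have h2 : (fun y : ℂ => taylorCoeff h n * y ^ n) =O[𝓝 0] fun y => ‖y‖ ^ n := by
      refine Asymptotics.IsBigO.const_mul_left (Asymptotics.IsBigO.of_bound 1 ?_) _
      simp
    refine ((hbig.trans h1).add h2).congr_left fun y => ?_
    rw [hH0, ← h0]; ring
  -- Since g'(0) ≠ 0, the Schwarz function vanishes at the origin to the same order as H - H(0). The
  -- higher-order Schwarz lemma then gives |ω(z)| ≤ |z|ⁿ.
  have hωO : ω =O[𝓝 0] fun y => ‖y‖ ^ n := by
    have h2 := (hgd.isTheta_sub hg0).isBigO_symm.comp_tendsto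
      (hωt.prodMk (tendsto_const_pure (b := (0 : ℂ))))
    refine Asymptotics.IsBigO.trans (g := fun y => H y - H 0) ?_ hHO
    refine h2.congr' (by simp [Function.comp_def]) ?_
    filter_upwards [hmem0] with y hy
    simp [hωeq y hy, hH0]
  have hωle : ∀ z ∈ ball (0 : ℂ) 1, ‖ω z‖ ≤ ‖z‖ ^ n := by
    intro z hz
    obtain ⟨m, rfl⟩ := Nat.exists_eq_succ_of_ne_zero hn.ne'
    have hm : MapsTo ω (ball 0 1) (closedBall (ω 0) 1) := by
      rw [hω0]
      exact hωm.mono_right ball_subset_closedBall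
    have := Complex.dist_le_mul_div_pow_of_mapsTo_ball_of_isLittleO (n := m) hωd hm ?_ hz
    · simpa [hω0] using this
    · simp only [hω0, sub_zero]
      refine hωO.trans_isLittleO ?_
      have : (fun y : ℂ => ‖y‖ ^ (m + 1)) = fun y => ‖y‖ ^ m * ‖y‖ := by ext; ring
      rw [Nat.succ_eq_add_one, this]
      have h3 : (fun y : ℂ => ‖y‖) =o[𝓝 0] fun _ => (1 : ℝ) := by
        rw [Asymptotics.isLittleO_one_iff]
        simpa using (continuous_norm (E := ℂ)).tendsto 0
      simpa using (Asymptotics.isBigO_refl (fun y : ℂ => ‖y‖ ^ m) (𝓝 0)).mul_isLittleO h3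
  refine le_of_forall_pos_le_add fun ε hε => ?_
  obtain ⟨C, hC⟩ := hbig.bound
  have hsm : ∀ᶠ y : ℂ in 𝓝 0, C * ‖y‖ < ε / 2 := by
    have : Tendsto (fun y : ℂ => C * ‖y‖) (𝓝 0) (𝓝 0) := by
      have : Continuous fun y : ℂ => C * ‖y‖ := by fun_prop
      simpa using this.tendsto 0
    exact this.eventually_lt_const (by linarith)
  have hlin := hωt.eventually (hgd.isLittleO.def (half_pos hε))
  -- Here H - H(0) is both aₙyⁿ + O(|y|ⁿ⁺¹) and g'(0)ω + o(|ω|); divide by |y|ⁿ.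
  have hev : ∀ᶠ y : ℂ in 𝓝[≠] 0, ‖taylorCoeff h n‖ ≤ ‖deriv g 0‖ + ε := by
    filter_upwards [nhdsWithin_le_nhds hC, nhdsWithin_le_nhds hsm, nhdsWithin_le_nhds hlin,
      nhdsWithin_le_nhds hmem0, self_mem_nhdsWithin] with y h1 h2 h3 h4 h5
    have hy : 0 < ‖y‖ := norm_pos_iff.2 h5
    have hyn : 0 < ‖y‖ ^ n := pow_pos hy n
    rw [hωeq y h4, sub_zero, ← hH0] at h3
    have hle := hωle y h4
    have hb1 : ‖H y - H 0‖ ≤ (‖deriv g 0‖ + ε / 2) * ‖y‖ ^ n := by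
      calc ‖H y - H 0‖ = ‖(H y - H 0 - ω y • deriv g 0) + ω y • deriv g 0‖ := by
            rw [sub_add_cancel]
        _ ≤ ε / 2 * ‖ω y‖ + ‖ω y‖ * ‖deriv g 0‖ := by
            refine (norm_add_le _ _).trans (add_le_add h3 (norm_smul_le _ _))
        _ = (‖deriv g 0‖ + ε / 2) * ‖ω y‖ := by ring
        _ ≤ _ := by gcongr
    have hb2 : ‖taylorCoeff h n * y ^ n‖ ≤ (‖deriv g 0‖ + ε) * ‖y‖ ^ n := by
      calc ‖taylorCoeff h n * y ^ n‖
          = ‖(H y - H 0) - (H y - h 0 - taylorCoeff h n * y ^ n)‖ := by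
            congr 1; rw [hH0, ← h0]; ring
        _ ≤ (‖deriv g 0‖ + ε / 2) * ‖y‖ ^ n + C * ‖y‖ * ‖y‖ ^ n := by
            refine (norm_sub_le _ _).trans (add_le_add hb1 (h1.trans (le_of_eq ?_)))
            rw [Real.norm_of_nonneg (by positivity)]; ring
        _ ≤ (‖deriv g 0‖ + ε / 2) * ‖y‖ ^ n + ε / 2 * ‖y‖ ^ n := by gcongr
        _ = _ := by ring
    rw [norm_mul, norm_pow] at hb2
    exact le_of_mul_le_mul_right hb2 hyn
  exact hev.exists.choose_spec

/-! ### Derivatives of moduli and the analytic properties of convex functions. -/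

theorem hasDerivAt_nonpos_of_eventually_le {F : ℝ → ℝ} {d x : ℝ} (h : HasDerivAt F d x)
    (hle : ∀ᶠ t in 𝓝[>] (0 : ℝ), F (x + t) ≤ F x) : d ≤ 0 := by
  refine le_of_tendsto h.tendsto_slope_zero_right ?_
  filter_upwards [hle, self_mem_nhdsWithin] with t ht ht0
  have : (0 : ℝ) < t := ht0
  rw [smul_eq_mul]
  exact mul_nonpos_of_nonneg_of_nonpos (by positivity) (by linarith)

theorem hasDerivAt_norm_sq_comp {c : ℝ → ℂ} {c' : ℂ} {t : ℝ} (h : HasDerivAt c c' t) :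
    HasDerivAt (fun s => ‖c s‖ ^ 2) (2 * ((starRingEnd ℂ) (c t) * c').re) t := by
  have := h.norm_sq
  rwa [Complex.inner, mul_comm c'] at this

theorem hasDerivAt_norm_comp {c : ℝ → ℂ} {c' : ℂ} {t : ℝ} (h : HasDerivAt c c' t)
    (h0 : c t ≠ 0) : HasDerivAt (fun s => ‖c s‖) (‖c t‖ * (c' / c t).re) t := by
  have hpos : 0 < ‖c t‖ := norm_pos_iff.2 h0
  have h1 := (hasDerivAt_norm_sq_comp h).sqrt (by positivity)
  have e : (fun s => Real.sqrt (‖c s‖ ^ 2)) = fun s => ‖c s‖ := by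
    ext s; exact Real.sqrt_sq (norm_nonneg _)
  rw [e, Real.sqrt_sq hpos.le] at h1
  convert h1 using 1
  have : c' / c t = ((‖c t‖ ^ 2)⁻¹ : ℝ) * ((starRingEnd ℂ) (c t) * c') := by
    rw [← Complex.normSq_eq_norm_sq, div_eq_mul_inv, Complex.inv_def]
    push_cast; ring
  rw [this, Complex.re_ofReal_mul]
  field_simp

theorem re_div_eq (a b : ℂ) : (a / b).re = ((starRingEnd ℂ) b * a).re / ‖b‖ ^ 2 := by
  have : a / b = ((‖b‖ ^ 2)⁻¹ : ℝ) * ((starRingEnd ℂ) b * a) := by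
    rw [← Complex.normSq_eq_norm_sq, div_eq_mul_inv, Complex.inv_def]
    push_cast; ring
  rw [this, Complex.re_ofReal_mul]
  ring

section ConvexUnivalent

variable {g : ℂ → ℂ} (hg : DifferentiableOn ℂ g (ball 0 1)) (hinj : InjOn g (ball 0 1))
  (hconv : Convex ℝ (g '' ball 0 1))

theorem hasDerivAt_zDeriv {f : ℂ → ℂ} (hf : DifferentiableOn ℂ f (ball 0 1)) {z : ℂ}
    (hz : z ∈ ball (0 : ℂ) 1) :
    HasDerivAt (zDeriv f) (deriv f z + z * deriv (deriv f) z) z := by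
  have h := (hasDerivAt_id' z).fun_mul
    ((hf.deriv isOpen_ball).differentiableAt (isOpen_ball.mem_nhds hz)).hasDerivAt
  exact h.congr_deriv (by simp)

theorem differentiableOn_zDeriv {f : ℂ → ℂ} (hf : DifferentiableOn ℂ f (ball 0 1)) :
    DifferentiableOn ℂ (zDeriv f) (ball 0 1) := fun _ hz =>
  (hasDerivAt_zDeriv hf hz).differentiableAt.differentiableWithinAt

include hg hinj hconv

/-- With x = w/z, the function y ↦ (1 - t)g(y) + t g(xy) is subordinate to g. Hence the preimage of
the point at parameter t on the segment from g(z) to g(w) has modulus at most |z|, and the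
derivative of its squared modulus at t = 0 is nonpositive. -/
theorem re_slope_nonneg_of_convex {z w : ℂ} (hz : z ∈ ball (0 : ℂ) 1)
    (hw : ‖w‖ ≤ ‖z‖) : 0 ≤ ((g z - g w) / (z * deriv g z)).re := by
  rcases eq_or_ne z 0 with rfl | hz0
  · simp
  have hzn : 0 < ‖z‖ := norm_pos_iff.2 hz0
  set x := w / z with hx
  have hx1 : ‖x‖ ≤ 1 := by rw [hx, norm_div, div_le_one hzn]; exact hw
  have hxz : x * z = w := div_mul_cancel₀ w hz0
  have hxm : ∀ y ∈ ball (0 : ℂ) 1, x * y ∈ ball (0 : ℂ) 1 := fun y hy => by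
    rw [mem_ball_zero_iff] at hy ⊢
    rw [norm_mul]
    nlinarith [norm_nonneg y]
  set φ := Function.invFunOn g (ball 0 1) with hφ
  have hle : ∀ t ∈ Icc (0 : ℝ) 1, ‖φ (g z + t * (g w - g z))‖ ≤ ‖z‖ := by
    intro t ht
    have hd : DifferentiableOn ℂ (fun y => g y + t * (g (x * y) - g y)) (ball 0 1) := by
      have h1 : DifferentiableOn ℂ (fun y => g (x * y)) (ball 0 1) :=
        hg.comp (by fun_prop) hxm
      exact hg.add ((h1.sub hg).const_mul _)
    have hm : MapsTo (fun y => g y + t * (g (x * y) - g y)) (ball 0 1) (g '' ball 0 1) := by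
      intro y hy
      have := hconv (mem_image_of_mem g hy) (mem_image_of_mem g (hxm y hy))
        (sub_nonneg.2 ht.2) ht.1 (by ring)
      convert this using 1
      simp only [Complex.real_smul]
      push_cast; ring
    obtain ⟨ω, -, hωm, -, hωe, hωn⟩ := exists_schwarz_of_mapsTo_image hg hinj hd hm (by simp)
    have h1 := hωe z hz
    rw [hxz] at h1
    rw [← h1, hφ, hinj.leftInvOn_invFunOn (hωm hz)]
    exact hωn z hz
  have hφz : φ (g z) = z := hinj.leftInvOn_invFunOn hz
  have hline : HasDerivAt (fun t : ℝ => g z + t * (g w - g z)) (g w - g z) 0 := by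
    have := ((Complex.ofRealCLM.hasDerivAt (x := 0)).mul_const (g w - g z)).const_add (g z)
    simpa using this
  have hd : HasDerivAt (fun t : ℝ => φ (g z + t * (g w - g z)))
      ((deriv g z)⁻¹ * (g w - g z)) 0 := by
    have h1 : HasDerivAt φ (deriv g z)⁻¹ (g z + ((0 : ℝ) : ℂ) * (g w - g z)) := by
      simpa using hasDerivAt_invFunOn isOpen_ball hg hinj hz
    exact h1.comp (0 : ℝ) hline
  have h2 := hasDerivAt_nonpos_of_eventually_le (hasDerivAt_norm_sq_comp hd) (by
    filter_upwards [Ioo_mem_nhdsGT (zero_lt_one' ℝ)] with t ht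
    have := hle t ⟨ht.1.le, ht.2.le⟩
    simp only [zero_add, Complex.ofReal_zero, zero_mul, add_zero, hφz]
    gcongr)
  simp only [Complex.ofReal_zero, zero_mul, add_zero, hφz] at h2
  have h3 : ((g z - g w) / (z * deriv g z)) = - (((deriv g z)⁻¹ * (g w - g z)) / z) := by
    rw [div_mul_eq_div_div_swap]; ring
  rw [h3, Complex.neg_re, re_div_eq]
  have : ((starRingEnd ℂ) z * ((deriv g z)⁻¹ * (g w - g z))).re / ‖z‖ ^ 2 ≤ 0 :=
    div_nonpos_of_nonpos_of_nonneg (by linarith) (by positivity)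
  linarith

/-- On the circle through z, the real part in `re_slope_nonneg_of_convex` is a nonnegative function
of the angle that vanishes at w = z. Its second derivative there is the quantity claimed to be
nonnegative. -/
theorem re_zDeriv_div_nonneg_of_convex {z : ℂ} (hz : z ∈ ball (0 : ℂ) 1) :
    0 ≤ (deriv (zDeriv g) z / deriv g z).re := by
  have hg'0 := deriv_ne_zero_of_injOn isOpen_ball hg hinj hz
  rcases eq_or_ne z 0 with rfl | hz0
  · rw [(hasDerivAt_zDeriv hg hz).deriv]
    simp [hg'0]
  set a := (z * deriv g z)⁻¹ with ha
  set e : ℝ → ℂ := fun θ => Complex.exp (θ * Complex.I) * z with he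
  have hemem : ∀ θ, e θ ∈ ball (0 : ℂ) 1 := fun θ => by
    simpa [he, Complex.norm_exp_ofReal_mul_I] using hz
  have hen : ∀ θ, ‖e θ‖ ≤ ‖z‖ := fun θ => by simp [he, Complex.norm_exp_ofReal_mul_I]
  have hed : ∀ θ, HasDerivAt e (Complex.I * e θ) θ := fun θ => by
    have h1 : HasDerivAt (fun θ : ℝ => (θ : ℂ) * Complex.I) Complex.I θ := by
      simpa using (Complex.ofRealCLM.hasDerivAt (x := θ)).mul_const Complex.I
    exact (h1.cexp.mul_const z).congr_deriv (by rw [he]; ring)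
  set k : ℝ → ℝ := fun θ => (a * (g z - g (e θ))).re with hk
  have hkd : ∀ θ, HasDerivAt k (a * (-(deriv g (e θ) * (Complex.I * e θ)))).re θ := fun θ => by
    have h1 := (hg.differentiableAt (isOpen_ball.mem_nhds (hemem θ))).hasDerivAt.comp θ (hed θ)
    have h2 := ((h1.const_sub (g z)).const_mul a)
    exact (Complex.reCLM.hasFDerivAt (x := a * (g z - g (e θ)))).comp_hasDerivAt θ h2
  have hk1 : deriv k = fun θ => (-(a * Complex.I) * zDeriv g (e θ)).re := by
    ext θ; rw [(hkd θ).deriv]; congr 1; simp only [zDeriv]; ring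
  have hk2 : deriv (deriv k) 0 = (deriv (zDeriv g) z / deriv g z).re := by
    rw [hk1]
    have h1 := ((differentiableOn_zDeriv hg).differentiableAt
      (isOpen_ball.mem_nhds (hemem 0))).hasDerivAt.comp (0 : ℝ) (hed 0)
    have h2 := h1.const_mul (-(a * Complex.I))
    have h3 := (Complex.reCLM.hasFDerivAt (x := -(a * Complex.I) * zDeriv g (e 0))).comp_hasDerivAt
      (0 : ℝ) h2
    refine (HasDerivAt.deriv h3).trans ?_
    have e0 : e 0 = z := by simp [he]
    rw [e0, Complex.reCLM_apply]
    congr 1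
    rw [ha]
    field_simp
    rw [Complex.I_sq]; ring
  have hk0 : k 0 = 0 := by simp [hk, he]
  have hknn : ∀ θ, 0 ≤ k θ := fun θ => by
    have := re_slope_nonneg_of_convex hg hinj hconv hz (hen θ)
    rwa [div_eq_mul_inv, mul_comm] at this
  by_contra hneg
  push Not at hneg
  rw [← hk2] at hneg
  have hmin : IsLocalMin k 0 := Filter.Eventually.of_forall fun θ => by rw [hk0]; exact hknn θ
  -- A negative second derivative would make the minimum a local maximum as well, so k would be
  -- locally constant with zero second derivative.
  have hmax := isLocalMax_of_deriv_deriv_neg hneg hmin.deriv_eq_zero (hkd 0).continuousAt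
  have hz' : k =ᶠ[𝓝 0] fun _ => 0 := by
    filter_upwards [hmax] with θ hθ
    exact le_antisymm (hk0 ▸ hθ) (hknn θ)
  have h2 := hz'.deriv.deriv_eq
  simp at h2
  linarith

theorem norm_zDeriv_div_sub_one_le_of_convex {z : ℂ} (hz : z ∈ ball (0 : ℂ) 1) :
    ‖deriv (zDeriv g) z / deriv g z - 1‖ ≤ ‖z‖ * ‖deriv (zDeriv g) z / deriv g z + 1‖ := by
  have hd : DifferentiableOn ℂ (fun z => deriv (zDeriv g) z / deriv g z) (ball 0 1) :=
    ((differentiableOn_zDeriv hg).deriv isOpen_ball).div (hg.deriv isOpen_ball)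
      fun w hw => deriv_ne_zero_of_injOn isOpen_ball hg hinj hw
  have h0 : deriv (zDeriv g) 0 / deriv g 0 = 1 := by
    rw [(hasDerivAt_zDeriv hg (mem_ball_self one_pos)).deriv, zero_mul, add_zero]
    exact div_self (deriv_ne_zero_of_injOn isOpen_ball hg hinj (mem_ball_self one_pos))
  have := norm_sub_le_of_re_nonneg hd
    (fun w hw => re_zDeriv_div_nonneg_of_convex hg hinj hconv hw) (by simp [h0]) hz
  simpa [h0] using this

/-- The bound Re(1 + zg''/g') ≥ (1 - ρ)/(1 + ρ) says that the logarithm of |g'|(1 + ρ)² has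
nonnegative radial derivative. -/
theorem norm_deriv_ge_of_convex {z : ℂ} (hz : z ∈ ball (0 : ℂ) 1) :
    ‖deriv g 0‖ ≤ ‖deriv g z‖ * (1 + ‖z‖) ^ 2 := by
  set ρ := ‖z‖ with hρ
  have hρ0 : 0 ≤ ρ := norm_nonneg z
  have hρ1 : ρ < 1 := mem_ball_zero_iff.1 hz
  have hmem : ∀ t ∈ Icc (0 : ℝ) 1, (t : ℂ) * z ∈ ball (0 : ℂ) 1 := fun t ht => by
    rw [mem_ball_zero_iff, norm_mul, Complex.norm_real, Real.norm_of_nonneg ht.1]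
    nlinarith [ht.2]
  have hdd := hg.deriv isOpen_ball
  have hnd : ∀ t ∈ Icc (0 : ℝ) 1, HasDerivAt (fun s : ℝ => ‖deriv g (s * z)‖ * (1 + s * ρ) ^ 2)
      (‖deriv g (t * z)‖ * (deriv (deriv g) (t * z) * z / deriv g (t * z)).re * (1 + t * ρ) ^ 2 +
        ‖deriv g (t * z)‖ * (2 * (1 + t * ρ) * ρ)) t := by
    intro t ht
    have h1 : HasDerivAt (fun s : ℝ => (s : ℂ) * z) z t := by
      simpa using (Complex.ofRealCLM.hasDerivAt (x := t)).mul_const z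
    have h2 := (hdd.differentiableAt (isOpen_ball.mem_nhds (hmem t ht))).hasDerivAt.comp t h1
    have h3 := hasDerivAt_norm_comp h2 (deriv_ne_zero_of_injOn isOpen_ball hg hinj (hmem t ht))
    have h4 : HasDerivAt (fun s : ℝ => (1 + s * ρ) ^ 2) (2 * (1 + t * ρ) * ρ) t := by
      have := (((hasDerivAt_id' t).mul_const ρ).const_add 1).fun_pow 2
      simpa using this
    exact h3.mul h4
  have hmono : MonotoneOn (fun s : ℝ => ‖deriv g (s * z)‖ * (1 + s * ρ) ^ 2) (Icc 0 1) := by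
    refine monotoneOn_of_deriv_nonneg (convex_Icc 0 1)
      (fun t ht => (hnd t ht).continuousAt.continuousWithinAt)
      (fun t ht => (hnd t (interior_subset ht)).differentiableAt.differentiableWithinAt) ?_
    intro t ht
    rw [interior_Icc] at ht
    have ht' : t ∈ Icc (0 : ℝ) 1 := ⟨ht.1.le, ht.2.le⟩
    rw [(hnd t ht').deriv]
    have hne := deriv_ne_zero_of_injOn isOpen_ball hg hinj (hmem t ht')
    have hnorm : ‖(t : ℂ) * z‖ = t * ρ := by
      rw [norm_mul, Complex.norm_real, Real.norm_of_nonneg ht.1.le]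
    have htρ : t * ρ < 1 := by nlinarith [ht.2]
    have htρ0 : 0 ≤ t * ρ := mul_nonneg ht.1.le hρ0
    have hb := (re_bounds_of_norm_sub_one_le (by rw [hnorm]; exact htρ0) (by rw [hnorm]; exact htρ)
      (norm_zDeriv_div_sub_one_le_of_convex hg hinj hconv (hmem t ht'))).1
    rw [hnorm, (hasDerivAt_zDeriv hg (hmem t ht')).deriv, add_div, div_self hne,
      Complex.add_re, Complex.one_re] at hb
    have e : ((t : ℂ) * z * deriv (deriv g) (t * z) / deriv g (t * z)) =
      (t : ℂ) * (deriv (deriv g) (t * z) * z / deriv g (t * z)) := by ring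
    rw [e, Complex.re_ofReal_mul] at hb
    set x := (deriv (deriv g) (t * z) * z / deriv g (t * z)).re
    have hx : 0 ≤ x * (1 + t * ρ) + 2 * ρ := by
      rw [div_le_iff₀ (by linarith)] at hb
      have : 0 ≤ t * (x * (1 + t * ρ) + 2 * ρ) := by nlinarith
      exact nonneg_of_mul_nonneg_right this ht.1
    have : ‖deriv g (t * z)‖ * x * (1 + t * ρ) ^ 2 + ‖deriv g (t * z)‖ * (2 * (1 + t * ρ) * ρ) =
        ‖deriv g (t * z)‖ * (1 + t * ρ) * (x * (1 + t * ρ) + 2 * ρ) := by ring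
    rw [this]
    have : 0 ≤ 1 + t * ρ := by linarith
    positivity
  have := hmono (left_mem_Icc.2 zero_le_one) (right_mem_Icc.2 zero_le_one) zero_le_one
  simpa using this

end ConvexUnivalent

theorem eventually_le_of_hasDerivAt_neg {F : ℝ → ℝ} {d x : ℝ} (h : HasDerivAt F d x) (hd : d < 0) :
    ∀ᶠ t in 𝓝[>] (0 : ℝ), F (x + t) < F x := by
  filter_upwards [h.tendsto_slope_zero_right.eventually_lt_const hd, self_mem_nhdsWithin]
    with t ht ht0
  have : (0 : ℝ) < t := ht0
  rw [smul_eq_mul] at ht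
  by_contra hc
  push Not at hc
  have : 0 ≤ t⁻¹ * (F (x + t) - F x) := mul_nonneg (by positivity) (by linarith)
  linarith

/-! ### The minimum principle. -/

/-- The starlike function `z g'` of a convex function `g` does not have a critical point. -/
theorem deriv_zDeriv_ne_zero_of_convex {g : ℂ → ℂ} (hg : DifferentiableOn ℂ g (ball 0 1))
    (hinj : InjOn g (ball 0 1)) (hconv : Convex ℝ (g '' ball 0 1)) {z : ℂ}
    (hz : z ∈ ball (0 : ℂ) 1) : deriv (zDeriv g) z ≠ 0 := fun h => by
  have := re_pos_of_norm_sub_one_le (norm_nonneg z) (mem_ball_zero_iff.1 hz)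
    (norm_zDeriv_div_sub_one_le_of_convex hg hinj hconv hz)
  simp [h] at this

/-- A minimum principle: a lower bound for `q + q' G / G'`, where `G = z g'` with `g` convex,
gives a lower bound for `q |G|`. -/
theorem le_re_mul_norm_zDeriv_of_le {g q : ℂ → ℂ} (hg : DifferentiableOn ℂ g (ball 0 1))
    (hinj : InjOn g (ball 0 1)) (hconv : Convex ℝ (g '' ball 0 1)) (hg1 : ‖deriv g 0‖ = 1)
    (hq : DifferentiableOn ℂ q (ball 0 1)) {m : ℂ} {R : ℝ} (hR1 : R < 1)
    {K h : ℝ → ℝ} (hKc : ContinuousOn K (Icc 0 R))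
    (hKd : ∀ ρ ∈ Ioc 0 R, HasDerivAt (fun s => s * K s) (h ρ * ((1 - ρ) / (1 + ρ) ^ 3)) ρ)
    (hh : ∀ ρ ∈ Ioc 0 R, 0 ≤ h ρ) (h0 : K 0 ≤ (m * q 0).re)
    (hle : ∀ z : ℂ, z ≠ 0 → ‖z‖ ≤ R →
      h ‖z‖ ≤ (m * (q z + deriv q z * (zDeriv g z / deriv (zDeriv g) z))).re)
    {z : ℂ} (hz : ‖z‖ ≤ R) : ‖z‖ * K ‖z‖ ≤ (m * q z).re * ‖zDeriv g z‖ := by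
  have hball : ∀ w : ℂ, ‖w‖ ≤ R → w ∈ ball (0 : ℂ) 1 := fun w hw => by
    rw [mem_ball_zero_iff]; linarith
  have hgne : ∀ w : ℂ, ‖w‖ ≤ R → deriv g w ≠ 0 := fun w hw =>
    deriv_ne_zero_of_injOn isOpen_ball hg hinj (hball w hw)
  -- Away from 0 the subtracted quotient is |w|K(|w|)/|G(w)|; this form stays continuous at 0. It
  -- suffices that the minimum of v on the closed disc is nonnegative.
  set v : ℂ → ℝ := fun w => (m * q w).re - K ‖w‖ / ‖deriv g w‖ with hv
  have hvc : ContinuousOn v (closedBall 0 R) := by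
    have hsub : closedBall (0 : ℂ) R ⊆ ball 0 1 := closedBall_subset_ball hR1
    have h1 : ContinuousOn (fun w => (m * q w).re) (closedBall 0 R) :=
      Complex.continuous_re.comp_continuousOn
        (continuousOn_const.mul (hq.continuousOn.mono hsub))
    have h2 : ContinuousOn (fun w : ℂ => K ‖w‖) (closedBall 0 R) :=
      hKc.comp continuous_norm.continuousOn
        fun w hw => ⟨norm_nonneg w, mem_closedBall_zero_iff.1 hw⟩
    have h3 : ContinuousOn (fun w : ℂ => ‖deriv g w‖) (closedBall 0 R) :=
      ((hg.deriv isOpen_ball).continuousOn.mono hsub).norm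
    exact h1.sub (h2.div h3 fun w hw => norm_ne_zero_iff.2
      (hgne w (mem_closedBall_zero_iff.1 hw)))
  have hR0 : 0 ≤ R := (norm_nonneg z).trans hz
  obtain ⟨z0, hz0m, hmin⟩ := (isCompact_closedBall (0 : ℂ) R).exists_isMinOn
    ⟨0, mem_closedBall_self hR0⟩ hvc
  have hz0R : ‖z0‖ ≤ R := mem_closedBall_zero_iff.1 hz0m
  have hmin' : ∀ w : ℂ, ‖w‖ ≤ R → v z0 ≤ v w := fun w hw =>
    hmin (mem_closedBall_zero_iff.2 hw)
  have key : 0 ≤ v z0 := by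
    rcases eq_or_ne z0 0 with rfl | hz0
    · simpa [hv, hg1] using h0
    have hzb := hball z0 hz0R
    have hg'0 := hgne z0 hz0R
    have hρ : 0 < ‖z0‖ := norm_pos_iff.2 hz0
    have hρ1 : ‖z0‖ < 1 := by linarith
    set G := zDeriv g with hG
    have hG' : deriv G z0 ≠ 0 := deriv_zDeriv_ne_zero_of_convex hg hinj hconv hzb
    have hG0 : G z0 ≠ 0 := mul_ne_zero hz0 hg'0
    set Q := deriv G z0 / deriv g z0 with hQ
    have hQ0 : Q ≠ 0 := div_ne_zero hG' hg'0
    have hQb := norm_zDeriv_div_sub_one_le_of_convex hg hinj hconv hzb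
    have hQi := re_bounds_of_norm_sub_one_le hρ.le hρ1 (norm_inv_sub_one_le hQ0 hQb)
    have hQp := re_pos_of_norm_sub_one_le hρ.le hρ1 (norm_inv_sub_one_le hQ0 hQb)
    set V := G z0 / deriv G z0 with hV
    have hVz : V = z0 * Q⁻¹ := by
      rw [hV, hQ, hG]; simp only [zDeriv]; field_simp
    -- Moving from the minimum in direction -G/G' decreases |G| at relative rate 1. It points inward
    -- because Re(V/z0) = Re(1/Q) > 0, so the path stays in the disc and v cannot decrease along it.
    set c : ℝ → ℂ := fun t => z0 - t * V with hc
    have hc0 : c 0 = z0 := by simp [hc]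
    have hcd : HasDerivAt c (-V) 0 := by
      simpa using ((Complex.ofRealCLM.hasDerivAt (x := 0)).mul_const V).const_sub z0
    have hcn : HasDerivAt (fun t => ‖c t‖) (-(‖z0‖ * (Q⁻¹).re)) 0 := by
      refine (hasDerivAt_norm_comp hcd (by rwa [hc0])).congr_deriv ?_
      rw [hc0, hVz, ← mul_neg, mul_div_cancel_left₀ _ hz0]; simp
    have hGd : HasDerivAt (fun t => ‖G (c t)‖) (-‖G z0‖) 0 := by
      have h1 : HasDerivAt G (deriv G z0) (c 0) := by
        rw [hc0]
        exact ((differentiableOn_zDeriv hg).differentiableAt (isOpen_ball.mem_nhds hzb)).hasDerivAt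
      refine (hasDerivAt_norm_comp (h1.comp (0 : ℝ) hcd) (by simpa [hc0] using hG0)).congr_deriv ?_
      simp only [Function.comp_apply, hc0]
      have : deriv G z0 * -V / G z0 = -1 := by rw [hV]; field_simp
      rw [this]; simp
    have hqd : HasDerivAt (fun t => (m * q (c t)).re) (-(m * (deriv q z0 * V)).re) 0 := by
      have h1 : HasDerivAt q (deriv q z0) (c 0) := by
        rw [hc0]; exact (hq.differentiableAt (isOpen_ball.mem_nhds hzb)).hasDerivAt
      have h2 := (h1.comp (0 : ℝ) hcd).const_mul m
      refine ((Complex.reCLM.hasFDerivAt).comp_hasDerivAt (0 : ℝ) h2).congr_deriv ?_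
      simp
    have hKd0 : HasDerivAt (fun t => ‖c t‖ * K ‖c t‖)
        (h ‖z0‖ * ((1 - ‖z0‖) / (1 + ‖z0‖) ^ 3) * -(‖z0‖ * (Q⁻¹).re)) 0 := by
      have h1 := hKd ‖z0‖ ⟨hρ, hz0R⟩
      rw [← hc0] at h1
      have h2 := HasDerivAt.comp (0 : ℝ) h1 hcn
      rw [hc0] at h2
      exact h2
    have hGn0 : ‖G (c 0)‖ ≠ 0 := by rw [hc0]; exact norm_ne_zero_iff.2 hG0
    have hwd := (hqd.sub (hKd0.div hGd hGn0)).neg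
    have hwle : ∀ᶠ t in 𝓝[>] (0 : ℝ),
        (-((fun t => (m * q (c t)).re) - (fun t => ‖c t‖ * K ‖c t‖) / fun t => ‖G (c t)‖)) (0 + t) ≤
        (-((fun t => (m * q (c t)).re) - (fun t => ‖c t‖ * K ‖c t‖) / fun t => ‖G (c t)‖)) 0 := by
      have hlt := eventually_le_of_hasDerivAt_neg hcn
        (by have := mul_pos hρ hQp; linarith)
      have hne : ∀ᶠ t in 𝓝[>] (0 : ℝ), c (0 + t) ≠ 0 := by
        have : ContinuousAt (fun t : ℝ => c (0 + t)) 0 := by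
          simp only [zero_add]; exact hcd.continuousAt
        exact (this.eventually_ne (by simpa [hc0] using hz0)).filter_mono nhdsWithin_le_nhds
      filter_upwards [hlt, hne] with t ht htn
      have hle' : ‖c (0 + t)‖ ≤ R := ht.le.trans (by rw [hc0]; exact hz0R)
      have e : ∀ w : ℂ, w ≠ 0 → (m * q w).re - ‖w‖ * K ‖w‖ / ‖G w‖ = v w := fun w hw => by
        simp only [hv, hG, zDeriv, norm_mul]
        rw [mul_div_mul_left _ _ (norm_ne_zero_iff.2 hw)]
      simp only [Pi.neg_apply, Pi.sub_apply, Pi.div_apply]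
      rw [e _ htn, e _ (by rwa [hc0]), hc0, neg_le_neg_iff]
      exact hmin' _ hle'
    have hfin := hasDerivAt_nonpos_of_eventually_le hwd hwle
    simp only [hc0] at hfin
    have hGn : 0 < ‖G z0‖ := norm_pos_iff.2 hG0
    have hlez := hle z0 hz0 hz0R
    rw [← hV, mul_add, Complex.add_re] at hlez
    have hvz : v z0 = (m * q z0).re - ‖z0‖ * K ‖z0‖ / ‖G z0‖ := by
      simp only [hv, hG, zDeriv, norm_mul]
      rw [mul_div_mul_left _ _ hρ.ne']
    have hgrow : ‖z0‖ ≤ ‖G z0‖ * (1 + ‖z0‖) ^ 2 := by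
      have := norm_deriv_ge_of_convex hg hinj hconv hzb
      rw [hg1] at this
      simp only [hG, zDeriv, norm_mul]
      nlinarith
    set ρ := ‖z0‖
    set N := ‖G z0‖
    have hhn := hh ρ ⟨hρ, hz0R⟩
    have e1 : (h ρ * ((1 - ρ) / (1 + ρ) ^ 3) * -(ρ * (Q⁻¹).re) * N - ρ * K ρ * -N) / N ^ 2 =
        (ρ * K ρ - h ρ * ((1 - ρ) / (1 + ρ) ^ 3) * (ρ * (Q⁻¹).re)) / N := by
      field_simp; ring
    rw [e1] at hfin
    -- The weight (1 - ρ)/(1 + ρ)³ is the derivative of ρ/(1 + ρ)², the lower bound for |G|;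
    -- together with Re(1/Q) ≤ (1 + ρ)/(1 - ρ) it is absorbed by N.
    have e2 : h ρ * ((1 - ρ) / (1 + ρ) ^ 3) * (ρ * (Q⁻¹).re) ≤ h ρ * N := by
      have s1 : (1 - ρ) * (Q⁻¹).re ≤ 1 + ρ := by
        have := hQi.2
        rw [le_div_iff₀ (by linarith)] at this
        linarith
      have s2 : ((1 - ρ) / (1 + ρ) ^ 3) * (ρ * (Q⁻¹).re) ≤ N := by
        rw [div_mul_eq_mul_div, div_le_iff₀ (by positivity)]
        calc (1 - ρ) * (ρ * (Q⁻¹).re) = ρ * ((1 - ρ) * (Q⁻¹).re) := by ring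
          _ ≤ ρ * (1 + ρ) := by gcongr
          _ ≤ (N * (1 + ρ) ^ 2) * (1 + ρ) := by gcongr
          _ = N * (1 + ρ) ^ 3 := by ring
      rw [mul_assoc]
      gcongr
    rw [hvz]
    rw [sub_div] at hfin
    have e3 : h ρ * ((1 - ρ) / (1 + ρ) ^ 3) * (ρ * (Q⁻¹).re) / N ≤ h ρ := by
      rw [div_le_iff₀ hGn]; exact e2
    linarith
  have hvz := key.trans (hmin' z hz)
  rcases eq_or_ne z 0 with rfl | hzne
  · simp [zDeriv]
  · have hn : 0 < ‖deriv g z‖ := norm_pos_iff.2 (hgne z hz)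
    simp only [hv, sub_nonneg] at hvz
    rw [div_le_iff₀ hn] at hvz
    simp only [zDeriv, norm_mul]
    nlinarith [norm_nonneg z]

/-! ### The lower bound for |z(zf')'|. -/

/-- For p = exp(iθ) take k = tan(θ/2). This parametrization keeps all later estimates rational. -/
theorem exists_half_angle {p : ℂ} (hp : ‖p‖ = 1) (hre : 0 < p.re) :
    ∃ k : ℝ, k ^ 2 < 1 ∧ p = (1 + Complex.I * k) / (1 - Complex.I * k) := by
  have hsq : p.re ^ 2 + p.im ^ 2 = 1 := by
    have := Complex.sq_norm p
    rw [hp, Complex.normSq_apply] at this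
    nlinarith
  obtain ⟨k, hk⟩ : ∃ k, k = p.im / (1 + p.re) := ⟨_, rfl⟩
  have hpos : 0 < 1 + p.re := by linarith
  have hk' : k * (1 + p.re) = p.im := by rw [hk, div_mul_cancel₀ _ hpos.ne']
  refine ⟨k, ?_, ?_⟩
  · rw [hk, div_pow, div_lt_one (by positivity)]; nlinarith
  · have h1 : (1 - Complex.I * (k : ℂ)) ≠ 0 := fun h => by
      have := congrArg Complex.re h; simp at this
    rw [eq_div_iff h1]
    apply Complex.ext
    · have : (1 + p.re) * (p.re + p.im * k - 1) = 0 := by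
        linear_combination hsq + p.im * hk'
      rcases mul_eq_zero.1 this with h | h
      · exact absurd h hpos.ne'
      · simp; linarith
    · simp; linarith

/-- The radial comparison function, divided by the radius. -/
noncomputable def radialBound (k t ρ : ℝ) : ℝ :=
  ((1 - k ^ 2) * ((3 + ρ ^ 2) / (3 * (1 + ρ) ^ 3) - t ^ 2 / (1 + ρ)) + 4 * k * t / (1 + ρ) ^ 2) /
    ((1 + k ^ 2) * (1 + t ^ 2))

/-- This determines `radialBound`: the derivative is the bound of `re_rotated_lower_bound` at u = (1
- ρ)/(1 + ρ) times the weight required by the minimum principle. -/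
theorem hasDerivAt_radialBound (k t : ℝ) {ρ : ℝ} (h0 : 0 ≤ ρ) (h1 : ρ < 1) :
    HasDerivAt (fun s => s * radialBound k t s)
      (((1 - k ^ 2) * (((1 - ρ) / (1 + ρ)) ^ 2 - t ^ 2) + 4 * k * ((1 - ρ) / (1 + ρ)) * t) /
        ((1 + k ^ 2) * (1 + t ^ 2) * ((1 - ρ) / (1 + ρ))) * ((1 - ρ) / (1 + ρ) ^ 3)) ρ := by
  have hp : 1 + ρ ≠ 0 := by linarith
  have hm : 1 - ρ ≠ 0 := by linarith
  have d1 : HasDerivAt (fun s : ℝ => 1 + s) 1 ρ := by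
    simpa using (hasDerivAt_id' ρ).const_add 1
  have d3 : HasDerivAt (fun s : ℝ => (3 + s ^ 2) / (3 * (1 + s) ^ 3))
      ((2 * ρ * (3 * (1 + ρ) ^ 3) - (3 + ρ ^ 2) * (3 * (3 * (1 + ρ) ^ 2))) /
        (3 * (1 + ρ) ^ 3) ^ 2) ρ := by
    have a1 : HasDerivAt (fun s : ℝ => 3 + s ^ 2) (2 * ρ) ρ := by
      simpa using ((hasDerivAt_id' ρ).fun_pow 2).const_add 3
    have a2 : HasDerivAt (fun s : ℝ => 3 * (1 + s) ^ 3) (3 * (3 * (1 + ρ) ^ 2)) ρ := by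
      simpa using (d1.fun_pow 3).const_mul 3
    exact a1.fun_div a2 (by positivity)
  have d4 : HasDerivAt (fun s : ℝ => t ^ 2 / (1 + s)) ((0 * (1 + ρ) - t ^ 2 * 1) / (1 + ρ) ^ 2) ρ :=
    (hasDerivAt_const ρ (t ^ 2)).fun_div d1 hp
  have d5 : HasDerivAt (fun s : ℝ => 4 * k * t / (1 + s) ^ 2)
      ((0 * (1 + ρ) ^ 2 - 4 * k * t * (2 * (1 + ρ))) / ((1 + ρ) ^ 2) ^ 2) ρ := by
    have a2 : HasDerivAt (fun s : ℝ => (1 + s) ^ 2) (2 * (1 + ρ)) ρ := by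
      simpa using d1.fun_pow 2
    exact (hasDerivAt_const ρ (4 * k * t)).fun_div a2 (by positivity)
  have := (hasDerivAt_id' ρ).fun_mul
    ((((d3.fun_sub d4).const_mul (1 - k ^ 2)).fun_add d5).div_const ((1 + k ^ 2) * (1 + t ^ 2)))
  refine this.congr_deriv ?_
  have hk : (1 + k ^ 2) ≠ 0 := by positivity
  have ht : (1 + t ^ 2) ≠ 0 := by positivity
  field_simp
  ring

/-- Taking t proportional to k isolates the bound for p(0) = 1 (the case k = 0); everything else
carries a factor k². -/
theorem mul_radialBound_eq (k φ : ℝ) {ρ : ℝ} (h0 : 0 ≤ ρ) :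
    ρ * radialBound k (k * φ) ρ = ρ * (3 + ρ ^ 2) / (3 * (1 + ρ) ^ 3) +
      k ^ 2 / ((1 + k ^ 2) * (1 + k ^ 2 * φ ^ 2)) *
        ((4 * φ * (ρ / (1 + ρ) ^ 2) - 2 * (ρ * (3 + ρ ^ 2) / (3 * (1 + ρ) ^ 3)) -
          φ ^ 2 * (ρ * (6 + 6 * ρ + 4 * ρ ^ 2) / (3 * (1 + ρ) ^ 3))) +
        k ^ 2 * (φ ^ 2 * (ρ * (6 * ρ + 2 * ρ ^ 2) / (3 * (1 + ρ) ^ 3)))) := by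
  have hp : 1 + ρ ≠ 0 := by positivity
  have hD : (1 + k ^ 2) * (1 + k ^ 2 * φ ^ 2) ≠ 0 := by positivity
  obtain ⟨W, hW⟩ : ∃ W, W = 1 / (1 + ρ) ^ 3 := ⟨_, rfl⟩
  have e1 : ∀ x, x / (1 + ρ) = x * (1 + ρ) ^ 2 * W := fun x => by rw [hW]; field_simp
  have e2 : ∀ x, x / (1 + ρ) ^ 2 = x * (1 + ρ) * W := fun x => by rw [hW]; field_simp
  have e3 : ∀ x, x / (3 * (1 + ρ) ^ 3) = x / 3 * W := fun x => by rw [hW]; field_simp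
  unfold radialBound
  simp only [e1, e2, e3, mul_pow]
  generalize hDe : (1 + k ^ 2) * (1 + k ^ 2 * φ ^ 2) = D at *
  rw [mul_div_assoc', div_mul_eq_mul_div, ← sub_eq_iff_eq_add', div_sub' hD]
  rw [← hDe]
  ring

/-- The estimate behind the choice φ = 5(1 - ρ)/(1 + ρ) near the unit circle. -/
theorem outer_radius_ineq {ρ : ℝ} (h0 : 2 / 3 ≤ ρ) (h1 : ρ < 1) :
    2 / 9 * (ρ ^ 2 - 4 * ρ ^ 4) ≤
      2 * (4 * (5 * ((1 - ρ) / (1 + ρ))) * (ρ / (1 + ρ) ^ 2) -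
        2 * (ρ * (3 + ρ ^ 2) / (3 * (1 + ρ) ^ 3)) -
        (5 * ((1 - ρ) / (1 + ρ))) ^ 2 * (ρ * (6 + 6 * ρ + 4 * ρ ^ 2) / (3 * (1 + ρ) ^ 3))) := by
  have hp : 0 < 1 + ρ := by linarith
  have e : 2 * (4 * (5 * ((1 - ρ) / (1 + ρ))) * (ρ / (1 + ρ) ^ 2) -
        2 * (ρ * (3 + ρ ^ 2) / (3 * (1 + ρ) ^ 3)) -
        (5 * ((1 - ρ) / (1 + ρ))) ^ 2 * (ρ * (6 + 6 * ρ + 4 * ρ ^ 2) / (3 * (1 + ρ) ^ 3))) =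
      ρ * (120 * (1 - ρ) * (1 + ρ) ^ 2 - 4 * (3 + ρ ^ 2) * (1 + ρ) ^ 2 -
        50 * (1 - ρ) ^ 2 * (6 + 6 * ρ + 4 * ρ ^ 2)) / (3 * (1 + ρ) ^ 5) := by
    field_simp
    ring
  rw [e, le_div_iff₀ (by positivity)]
  -- In powers of d, grouped as in `h4`, the polynomial difference has nonnegative blocks for 0 ≤ d
  -- ≤ 1/3.
  obtain ⟨d, hd⟩ : ∃ d, d = 1 - ρ := ⟨_, rfl⟩
  have hd0 : 0 ≤ d := by linarith
  have hd3 : d ≤ 1 / 3 := by linarith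
  have hρd : ρ = 1 - d := by linarith
  have h1 : 0 ≤ 544 / 3 - 1024 / 3 * d - 548 * d ^ 2 := by nlinarith
  have h2 : 0 ≤ 2888 / 3 - 1826 / 3 * d := by linarith
  have h3 : 0 ≤ 194 - 104 / 3 * d := by linarith
  have h4 : 0 ≤ ρ * (d * (544 / 3 - 1024 / 3 * d - 548 * d ^ 2 +
      d ^ 3 * (2888 / 3 - 1826 / 3 * d + d ^ 2 * (194 - 104 / 3 * d) + 8 / 3 * d ^ 4))) := by
    have : 0 ≤ ρ := by linarith
    positivity
  rw [hρd] at h4 ⊢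
  linarith

/-- If E < 0, then 1 + y ≤ 2 gives (1 + y)E ≥ 2E ≥ P; this is the source of the factor 2 in
`outer_radius_ineq`. -/
theorem mul_one_add_le_of_nonpos {y P E S x : ℝ} (hy : 0 ≤ y) (hy1 : y ≤ 1) (hP : P ≤ 0)
    (hPE : P ≤ 2 * E) (hS : 0 ≤ S) (hx : 0 ≤ x) :
    P * (1 + y * x) ≤ (1 + y) * (E + y * S) := by
  have h1 : P * (1 + y * x) ≤ P := by nlinarith [mul_nonneg hy hx]
  have h2 : P ≤ (1 + y) * E := by
    rcases le_total 0 E with h | h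
    · exact hP.trans (mul_nonneg (by linarith) h)
    · nlinarith
  have h3 : 0 ≤ (1 + y) * (y * S) := by positivity
  linarith

section LowerBound

variable {f g : ℂ → ℂ} (hf : DifferentiableOn ℂ f (ball 0 1)) (hf1 : deriv f 0 = 1)
  (hg : DifferentiableOn ℂ g (ball 0 1)) (hinj : InjOn g (ball 0 1))
  (hconv : Convex ℝ (g '' ball 0 1)) (hg1 : ‖deriv g 0‖ = 1)
  (hre : ∀ z ∈ ball (0 : ℂ) 1, 0 < (deriv (zDeriv (zDeriv f)) z / deriv (zDeriv g) z).re)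

include hf hg hinj hconv

/-- With q = (zf')'/g' and G = zg' one has qG = z(zf')'; differentiate and divide by G'. -/
theorem deriv_zDeriv_div_add {z : ℂ} (hz : z ∈ ball (0 : ℂ) 1) :
    deriv (zDeriv f) z / deriv g z +
      deriv (fun w => deriv (zDeriv f) w / deriv g w) z * (zDeriv g z / deriv (zDeriv g) z) =
    deriv (zDeriv (zDeriv f)) z / deriv (zDeriv g) z := by
  have hg' := deriv_ne_zero_of_injOn isOpen_ball hg hinj hz
  have hG' := deriv_zDeriv_ne_zero_of_convex hg hinj hconv hz
  have h1 := (((differentiableOn_zDeriv hf).deriv isOpen_ball).differentiableAt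
    (isOpen_ball.mem_nhds hz)).hasDerivAt
  have h2 := ((hg.deriv isOpen_ball).differentiableAt (isOpen_ball.mem_nhds hz)).hasDerivAt
  rw [(h1.fun_div h2 hg').deriv, (hasDerivAt_zDeriv (differentiableOn_zDeriv hf) hz).deriv]
  have hG := (hasDerivAt_zDeriv hg hz).deriv
  rw [hG] at hG' ⊢
  simp only [zDeriv]
  generalize deriv (zDeriv f) z = A at *
  generalize deriv (deriv (zDeriv f)) z = B at *
  generalize deriv (deriv g) z = c at *
  generalize deriv g z = a at *
  have e : (B * a - A * c) / a ^ 2 * (z * a / (a + z * c)) =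
      (B * a - A * c) * z / (a * (a + z * c)) := by
    field_simp
  rw [e, div_add_div _ _ hg' (mul_ne_zero hg' hG'), div_eq_div_iff
    (mul_ne_zero hg' (mul_ne_zero hg' hG')) hG']
  ring

include hf1 hg1 hre

/-- The number k depends only on p(0), whereas the rotation m = exp(-iψ), t = tan(ψ/2), remains
free. The condition on `Ioc 0 R` is the sign hypothesis of the minimum principle. -/
theorem exists_half_angle_bound :
    ∃ k : ℝ, k ^ 2 < 1 ∧ ∀ t R : ℝ, R < 1 →
      (∀ ρ ∈ Ioc 0 R, 0 ≤ (1 - k ^ 2) * (((1 - ρ) / (1 + ρ)) ^ 2 - t ^ 2) +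
        4 * k * ((1 - ρ) / (1 + ρ)) * t) →
      ∀ z : ℂ, ‖z‖ ≤ R → ‖z‖ * radialBound k t ‖z‖ ≤
        ((((1 - t ^ 2) / (1 + t ^ 2) : ℝ) - (2 * t / (1 + t ^ 2) : ℝ) * Complex.I) *
          (deriv (zDeriv f) z / deriv g z)).re * ‖zDeriv g z‖ := by
  have h0m : (0 : ℂ) ∈ ball (0 : ℂ) 1 := mem_ball_self one_pos
  have hfd := differentiableOn_zDeriv hf
  have hffd := differentiableOn_zDeriv hfd
  have hF0 : deriv (zDeriv f) 0 = 1 := by rw [(hasDerivAt_zDeriv hf h0m).deriv, hf1]; simp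
  have hp0 : deriv (zDeriv (zDeriv f)) 0 / deriv (zDeriv g) 0 = 1 / deriv g 0 := by
    rw [(hasDerivAt_zDeriv hfd h0m).deriv, (hasDerivAt_zDeriv hg h0m).deriv, hF0]; simp
  have hpd : DifferentiableOn ℂ (fun z => deriv (zDeriv (zDeriv f)) z / deriv (zDeriv g) z)
      (ball 0 1) :=
    (hffd.deriv isOpen_ball).div ((differentiableOn_zDeriv hg).deriv isOpen_ball)
      fun z hz => deriv_zDeriv_ne_zero_of_convex hg hinj hconv hz
  have hp0n : ‖1 / deriv g 0‖ = 1 := by rw [norm_div, hg1]; simp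
  have hp0re : 0 < (1 / deriv g 0).re := hp0 ▸ hre 0 h0m
  obtain ⟨k, hk, hkp⟩ := exists_half_angle hp0n hp0re
  refine ⟨k, hk, fun t R hR hh z hz => ?_⟩
  have hre_m : ∀ x : ℂ, ((((1 - t ^ 2) / (1 + t ^ 2) : ℝ) -
      (2 * t / (1 + t ^ 2) : ℝ) * Complex.I) * x).re =
      (1 - t ^ 2) / (1 + t ^ 2) * x.re + 2 * t / (1 + t ^ 2) * x.im := fun x => by
    rw [Complex.mul_re, Complex.sub_re, Complex.sub_im, Complex.re_ofReal_mul,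
      Complex.im_ofReal_mul, Complex.ofReal_re, Complex.ofReal_im, Complex.I_re, Complex.I_im]
    ring
  have hbound : ∀ w ∈ ball (0 : ℂ) 1,
      ((1 - k ^ 2) * (((1 - ‖w‖) / (1 + ‖w‖)) ^ 2 - t ^ 2) + 4 * k * ((1 - ‖w‖) / (1 + ‖w‖)) * t) /
        ((1 + k ^ 2) * (1 + t ^ 2) * ((1 - ‖w‖) / (1 + ‖w‖))) ≤
      ((((1 - t ^ 2) / (1 + t ^ 2) : ℝ) - (2 * t / (1 + t ^ 2) : ℝ) * Complex.I) *
        (deriv (zDeriv (zDeriv f)) w / deriv (zDeriv g) w)).re := by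
    intro w hw
    have hw1 : ‖w‖ < 1 := mem_ball_zero_iff.1 hw
    have hw0 := norm_nonneg w
    rw [hre_m]
    refine re_rotated_lower_bound hk (div_pos (by linarith) (by linarith))
      (by rw [div_le_one (by linarith)]; linarith) ?_
    have e : (1 - (1 - ‖w‖) / (1 + ‖w‖)) / (1 + (1 - ‖w‖) / (1 + ‖w‖)) = ‖w‖ := by
      field_simp; ring
    rw [e, ← hkp, ← hp0]
    exact norm_sub_le_of_re_nonneg hpd (fun y hy => (hre y hy).le) (hre 0 h0m) hw
  refine le_re_mul_norm_zDeriv_of_le hg hinj hconv hg1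
    ((hfd.deriv isOpen_ball).div (hg.deriv isOpen_ball)
      fun z hz => deriv_ne_zero_of_injOn isOpen_ball hg hinj hz) hR (K := radialBound k t)
    (q := fun z => deriv (zDeriv f) z / deriv g z)
    (h := fun ρ => ((1 - k ^ 2) * (((1 - ρ) / (1 + ρ)) ^ 2 - t ^ 2) +
      4 * k * ((1 - ρ) / (1 + ρ)) * t) / ((1 + k ^ 2) * (1 + t ^ 2) * ((1 - ρ) / (1 + ρ))))
    ?_ ?_ ?_ ?_ ?_ hz
  · unfold radialBound
    refine ContinuousOn.div_const ?_ _
    have hne : ∀ x ∈ Icc 0 R, (1 + x) ≠ 0 := fun x hx => by linarith [hx.1]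
    refine ContinuousOn.add (continuousOn_const.mul (ContinuousOn.sub ?_ ?_)) ?_
    · exact ContinuousOn.div (by fun_prop) (by fun_prop) fun x hx => by have := hne x hx; positivity
    · exact ContinuousOn.div (by fun_prop) (by fun_prop) hne
    · exact ContinuousOn.div (by fun_prop) (by fun_prop) fun x hx => by have := hne x hx; positivity
  · exact fun ρ hρ => hasDerivAt_radialBound k t hρ.1.le (hρ.2.trans_lt hR)
  · intro ρ hρ
    have : 0 < (1 - ρ) / (1 + ρ) := div_pos (by linarith [hρ.2]) (by linarith [hρ.1])
    exact div_nonneg (hh ρ hρ) (by positivity)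
  · have := hbound 0 h0m
    rw [hp0] at this
    simp only [hF0]
    refine le_trans (le_of_eq ?_) this
    simp [radialBound]
  · intro w hw0 hw
    have hwm : w ∈ ball (0 : ℂ) 1 := mem_ball_zero_iff.2 (hw.trans_lt hR)
    have e := deriv_zDeriv_div_add hf hg hinj hconv hwm
    simp only [e]
    exact hbound w hwm

/-- Without rotation (t = 0) the sign condition is automatic and `radialBound` is positive because
k² < 1. -/
theorem re_deriv_zDeriv_div_pos {z : ℂ} (hz : z ∈ ball (0 : ℂ) 1) :
    0 < (deriv (zDeriv f) z / deriv g z).re := by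
  have h0m : (0 : ℂ) ∈ ball (0 : ℂ) 1 := mem_ball_self one_pos
  rcases eq_or_ne z 0 with rfl | hz0
  · have := hre 0 h0m
    rw [(hasDerivAt_zDeriv (differentiableOn_zDeriv hf) h0m).deriv,
      (hasDerivAt_zDeriv hg h0m).deriv] at this
    simpa using this
  obtain ⟨k, hk, hkt⟩ := exists_half_angle_bound hf hf1 hg hinj hconv hg1 hre
  have h := hkt 0 ‖z‖ (mem_ball_zero_iff.1 hz) (fun ρ _ => by
    have : 0 ≤ (1 - k ^ 2) * ((1 - ρ) / (1 + ρ)) ^ 2 := mul_nonneg (by linarith) (sq_nonneg _)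
    simpa using this) z le_rfl
  simp only [ne_eq, OfNat.ofNat_ne_zero, not_false_eq_true, zero_pow, sub_zero, add_zero, div_one,
    Complex.ofReal_one, mul_zero, Complex.ofReal_zero, zero_mul, one_mul] at h
  have hz' : 0 < ‖z‖ := norm_pos_iff.2 hz0
  have : 0 < ‖z‖ * radialBound k 0 ‖z‖ := by
    unfold radialBound
    have : 0 < 1 - k ^ 2 := by linarith
    simp only [ne_eq, OfNat.ofNat_ne_zero, not_false_eq_true, zero_pow, zero_div, sub_zero,
      mul_zero, add_zero]
    positivity
  exact pos_of_mul_pos_left (this.trans_le h) (norm_nonneg _)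

theorem radialBound_le_norm :
    ∃ k : ℝ, k ^ 2 < 1 ∧ ∀ t R : ℝ, R < 1 →
      (∀ ρ ∈ Ioc 0 R, 0 ≤ (1 - k ^ 2) * (((1 - ρ) / (1 + ρ)) ^ 2 - t ^ 2) +
        4 * k * ((1 - ρ) / (1 + ρ)) * t) →
      ∀ z : ℂ, ‖z‖ ≤ R → ‖z‖ * radialBound k t ‖z‖ ≤ ‖zDeriv (zDeriv f) z‖ := by
  obtain ⟨k, hk, hkt⟩ := exists_half_angle_bound hf hf1 hg hinj hconv hg1 hre
  refine ⟨k, hk, fun t R hR hh z hz => (hkt t R hR hh z hz).trans ?_⟩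
  have hzm : z ∈ ball (0 : ℂ) 1 := mem_ball_zero_iff.2 (hz.trans_lt hR)
  have hg' := deriv_ne_zero_of_injOn isOpen_ball hg hinj hzm
  set m : ℂ := (((1 - t ^ 2) / (1 + t ^ 2) : ℝ) - (2 * t / (1 + t ^ 2) : ℝ) * Complex.I) with hm
  have hmn : ‖m‖ = 1 := by
    rw [← sq_eq_sq₀ (norm_nonneg _) zero_le_one, Complex.sq_norm, Complex.normSq_apply]
    simp only [hm, Complex.sub_re, Complex.sub_im, Complex.re_ofReal_mul,
      Complex.im_ofReal_mul, Complex.ofReal_re, Complex.ofReal_im, Complex.I_re, Complex.I_im]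
    field_simp
    ring
  calc (m * (deriv (zDeriv f) z / deriv g z)).re * ‖zDeriv g z‖
      ≤ ‖m * (deriv (zDeriv f) z / deriv g z)‖ * ‖zDeriv g z‖ := by
        gcongr; exact Complex.re_le_norm _
    _ = ‖zDeriv (zDeriv f) z‖ := by
        rw [norm_mul, hmn, one_mul, ← norm_mul]
        congr 1
        simp only [zDeriv]
        field_simp

/-- The sharp lower bound for `|z (z f')'|`, up to a term whose contribution to the growth of `f`
is nonnegative. -/
theorem exists_norm_zDeriv_zDeriv_ge :
    ∃ κ : ℝ, 0 ≤ κ ∧ κ ≤ 1 / 4 ∧ ∀ z ∈ ball (0 : ℂ) 1,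
      ‖z‖ * (3 + ‖z‖ ^ 2) / (3 * (1 + ‖z‖) ^ 3) + κ * (2 / 9 * (‖z‖ ^ 2 - 4 * ‖z‖ ^ 4)) ≤
        ‖zDeriv (zDeriv f) z‖ := by
  obtain ⟨k, hk, hkt⟩ := radialBound_le_norm hf hf1 hg hinj hconv hg1 hre
  refine ⟨k ^ 2 / (1 + k ^ 2) ^ 2, by positivity, ?_, fun z hz => ?_⟩
  · rw [div_le_div_iff₀ (by positivity) (by norm_num)]
    nlinarith [sq_nonneg (1 - k ^ 2)]
  set ρ := ‖z‖ with hρ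
  have hρ0 : 0 ≤ ρ := norm_nonneg z
  have hρ1 : ρ < 1 := mem_ball_zero_iff.1 hz
  -- With y = k² the sign condition is (u - yφ)² + y(6uφ - u² - φ²) ≥ 0, which holds for u/5 ≤ φ ≤
  -- 5u; for φ ≤ u/5 the original form is visibly nonnegative.
  have key : ∀ φ : ℝ, 0 ≤ φ → φ ≤ 1 → φ ≤ 5 * ((1 - ρ) / (1 + ρ)) →
      ρ * radialBound k (k * φ) ρ ≤ ‖zDeriv (zDeriv f) z‖ := by
    intro φ h0 h1 h5
    refine hkt (k * φ) ρ hρ1 (fun s hs => ?_) z le_rfl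
    set u := (1 - s) / (1 + s) with hu
    have hu0 : 0 < u := div_pos (by linarith [hs.2]) (by linarith [hs.1])
    have hu1 : (1 - ρ) / (1 + ρ) ≤ u := by
      rw [hu, div_le_div_iff₀ (by linarith) (by linarith [hs.1])]
      nlinarith [hs.2]
    have hφu : φ ≤ 5 * u := h5.trans (by linarith)
    set y := k ^ 2 with hy
    have hy0 : 0 ≤ y := sq_nonneg k
    have e : (1 - y) * (u ^ 2 - (k * φ) ^ 2) + 4 * k * u * (k * φ) =
        (1 - y) * (u ^ 2 - y * φ ^ 2) + 4 * y * u * φ := by rw [hy]; ring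
    rw [e]
    rcases le_total φ (u / 5) with h | h
    · have : φ ^ 2 ≤ u ^ 2 / 25 := by nlinarith
      have h2 : y * φ ^ 2 ≤ u ^ 2 := by nlinarith
      have := mul_nonneg (by linarith : 0 ≤ 1 - y) (sub_nonneg.2 h2)
      have : 0 ≤ 4 * y * u * φ := by positivity
      linarith
    · have h2 : 0 ≤ (φ - u / 5) * (5 * u - φ) := mul_nonneg (by linarith) (by linarith)
      have h3 : 0 ≤ u * φ := by positivity
      nlinarith [mul_nonneg hy0 h2, mul_nonneg hy0 h3, sq_nonneg (u - y * φ)]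
  -- The choice φ = 1, that is m·p(0) = 1, is admissible while 5(1 - ρ)/(1 + ρ) ≥ 1, that is for ρ ≤
  -- 2/3. Beyond that the largest admissible φ is used.
  rcases le_total ρ (2 / 3) with h23 | h23
  · refine le_trans ?_ (key 1 zero_le_one le_rfl ?_)
    · have e : (4 * 1 * (ρ / (1 + ρ) ^ 2) - 2 * (ρ * (3 + ρ ^ 2) / (3 * (1 + ρ) ^ 3)) -
          1 ^ 2 * (ρ * (6 + 6 * ρ + 4 * ρ ^ 2) / (3 * (1 + ρ) ^ 3))) =
          2 * ρ ^ 2 * (1 - ρ) / (1 + ρ) ^ 3 := by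
        have : 1 + ρ ≠ 0 := by linarith
        field_simp
        ring
      rw [mul_radialBound_eq k 1 hρ0, e, one_pow, mul_one, one_mul, ← sq]
      gcongr
      have h1 : 2 / 9 * (ρ ^ 2 - 4 * ρ ^ 4) ≤ 2 * ρ ^ 2 * (1 - ρ) / (1 + ρ) ^ 3 := by
        rw [le_div_iff₀ (by positivity)]
        have : (1 - 4 * ρ ^ 2) * (1 + ρ) ^ 3 ≤ 9 * (1 - ρ) := by
          nlinarith [mul_nonneg hρ0 (by linarith : 0 ≤ 2 / 3 - ρ), pow_nonneg hρ0 3,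
            pow_nonneg hρ0 4, pow_nonneg hρ0 5]
        nlinarith [sq_nonneg ρ]
      have : 0 ≤ k ^ 2 * (ρ * (6 * ρ + 2 * ρ ^ 2) / (3 * (1 + ρ) ^ 3)) := by positivity
      linarith
    · rw [mul_div_assoc', le_div_iff₀ (by linarith)]; linarith
  · refine le_trans ?_ (key (5 * ((1 - ρ) / (1 + ρ))) ?_ ?_ le_rfl)
    · set φ := 5 * ((1 - ρ) / (1 + ρ)) with hφ
      set y := k ^ 2 with hy
      have hy0 : 0 ≤ y := sq_nonneg k
      set E := 4 * φ * (ρ / (1 + ρ) ^ 2) - 2 * (ρ * (3 + ρ ^ 2) / (3 * (1 + ρ) ^ 3)) -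
        φ ^ 2 * (ρ * (6 + 6 * ρ + 4 * ρ ^ 2) / (3 * (1 + ρ) ^ 3)) with hE
      set S := φ ^ 2 * (ρ * (6 * ρ + 2 * ρ ^ 2) / (3 * (1 + ρ) ^ 3)) with hS
      have hS0 : 0 ≤ S := by positivity
      have hp : 1 + ρ ≠ 0 := by linarith
      have e : ρ * radialBound k (k * φ) ρ = ρ * (3 + ρ ^ 2) / (3 * (1 + ρ) ^ 3) +
          y / ((1 + y) * (1 + y * φ ^ 2)) * (E + y * S) := by
        rw [mul_radialBound_eq k φ hρ0]
      rw [e]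
      set P := 2 / 9 * (ρ ^ 2 - 4 * ρ ^ 4) with hP
      have hPn : P ≤ 0 := by
        have : 0 ≤ ρ ^ 2 * (4 * ρ ^ 2 - 1) := mul_nonneg (sq_nonneg _) (by nlinarith)
        rw [hP]; nlinarith
      have hPE : P ≤ 2 * E := by
        exact outer_radius_ineq h23 hρ1
      have hmain : P * (1 + y * φ ^ 2) ≤ (1 + y) * (E + y * S) := 
        mul_one_add_le_of_nonpos hy0 hk.le hPn hPE hS0 (sq_nonneg φ)
      have : y / (1 + y) ^ 2 * P ≤ y / ((1 + y) * (1 + y * φ ^ 2)) * (E + y * S) := by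
        rw [div_mul_eq_mul_div, div_mul_eq_mul_div, div_le_div_iff₀ (by positivity) (by positivity)]
        calc y * P * ((1 + y) * (1 + y * φ ^ 2)) = y * (1 + y) * (P * (1 + y * φ ^ 2)) := by ring
          _ ≤ y * (1 + y) * ((1 + y) * (E + y * S)) := by gcongr
          _ = y * (E + y * S) * (1 + y) ^ 2 := by ring
      linarith
    · have : 0 ≤ (1 - ρ) / (1 + ρ) := div_nonneg (by linarith) (by linarith)
      linarith
    · rw [mul_div_assoc', div_le_one (by linarith)]; linarith

end LowerBound

/-! ### Univalence criteria and radial integration of lower bounds. -/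

/-- The segment from g(w) to g(z) lies in the convex image, and F ∘ g⁻¹ has derivative F'/g' along
it. -/
theorem re_slope_pos_of_re_deriv_div_pos {g F : ℂ → ℂ} (hg : DifferentiableOn ℂ g (ball 0 1))
    (hinj : InjOn g (ball 0 1)) (hconv : Convex ℝ (g '' ball 0 1))
    (hF : DifferentiableOn ℂ F (ball 0 1))
    (hre : ∀ z ∈ ball (0 : ℂ) 1, 0 < (deriv F z / deriv g z).re)
    {z w : ℂ} (hz : z ∈ ball (0 : ℂ) 1) (hw : w ∈ ball (0 : ℂ) 1) (hne : z ≠ w) :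
    0 < ((F z - F w) / (g z - g w)).re := by
  set Δ := g z - g w with hΔ
  have hΔ0 : Δ ≠ 0 := sub_ne_zero.2 fun h => hne (hinj hz hw h)
  set φ := Function.invFunOn g (ball 0 1) with hφ
  have hmem : ∀ t ∈ Icc (0 : ℝ) 1, ∃ y ∈ ball (0 : ℂ) 1, g y = g w + t * Δ := by
    intro t ht
    have := hconv (mem_image_of_mem g hw) (mem_image_of_mem g hz)
      (sub_nonneg.2 ht.2) ht.1 (by ring)
    obtain ⟨y, hy, hye⟩ := this
    refine ⟨y, hy, hye.trans ?_⟩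
    simp only [Complex.real_smul, hΔ]
    push_cast; ring
  have hd : ∀ t ∈ Icc (0 : ℝ) 1, ∃ y ∈ ball (0 : ℂ) 1, HasDerivAt
      (fun s : ℝ => (F (φ (g w + s * Δ)) / Δ).re) (deriv F y / deriv g y).re t := by
    intro t ht
    obtain ⟨y, hy, hye⟩ := hmem t ht
    refine ⟨y, hy, ?_⟩
    have h1 : HasDerivAt (fun s : ℝ => g w + s * Δ) Δ t := by
      simpa using ((Complex.ofRealCLM.hasDerivAt (x := t)).mul_const Δ).const_add (g w)
    have h2 : HasDerivAt φ (deriv g y)⁻¹ (g w + t * Δ) := by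
      rw [← hye]; exact hasDerivAt_invFunOn isOpen_ball hg hinj hy
    have hφy : φ (g w + t * Δ) = y := by rw [← hye]; exact hinj.leftInvOn_invFunOn hy
    have h3 : HasDerivAt F (deriv F y) (φ (g w + t * Δ)) := by
      rw [hφy]; exact (hF.differentiableAt (isOpen_ball.mem_nhds hy)).hasDerivAt
    have h4 := ((h3.comp t (h2.comp t h1)).div_const Δ)
    refine ((Complex.reCLM.hasFDerivAt).comp_hasDerivAt t h4).congr_deriv ?_
    rw [Complex.reCLM_apply]
    congr 1
    field_simp
  have hmono : StrictMonoOn (fun s : ℝ => (F (φ (g w + s * Δ)) / Δ).re) (Icc 0 1) := by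
    refine strictMonoOn_of_deriv_pos (convex_Icc 0 1) (fun t ht => ?_) fun t ht => ?_
    · obtain ⟨y, -, h⟩ := hd t ht
      exact h.continuousAt.continuousWithinAt
    · obtain ⟨y, hy, h⟩ := hd t (interior_subset ht)
      rw [h.deriv]; exact hre y hy
  have := hmono (left_mem_Icc.2 zero_le_one) (right_mem_Icc.2 zero_le_one) zero_lt_one
  have e1 : φ (g w + ((0 : ℝ) : ℂ) * Δ) = w := by
    simpa using hinj.leftInvOn_invFunOn hw
  have e2 : φ (g w + ((1 : ℝ) : ℂ) * Δ) = z := by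
    have : g w + ((1 : ℝ) : ℂ) * Δ = g z := by rw [hΔ]; simp
    rw [this]; exact hinj.leftInvOn_invFunOn hz
  simp only [e1, e2] at this
  rw [sub_div, Complex.sub_re]
  linarith

/-- The Noshiro–Warschawski–Kaplan criterion. -/
theorem injOn_of_re_deriv_div_pos {g F : ℂ → ℂ} (hg : DifferentiableOn ℂ g (ball 0 1))
    (hinj : InjOn g (ball 0 1)) (hconv : Convex ℝ (g '' ball 0 1))
    (hF : DifferentiableOn ℂ F (ball 0 1))
    (hre : ∀ z ∈ ball (0 : ℂ) 1, 0 < (deriv F z / deriv g z).re) : InjOn F (ball 0 1) := by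
  intro z hz w hw h
  by_contra hne
  have := re_slope_pos_of_re_deriv_div_pos hg hinj hconv hF hre hz hw hne
  simp [h] at this

/-- For an injective function, a radial lower bound for the derivative integrates to a lower
bound for the function. -/
theorem le_norm_of_le_norm_deriv {h : ℂ → ℂ} (hd : DifferentiableOn ℂ h (ball 0 1))
    (hinj : InjOn h (ball 0 1)) (h0 : h 0 = 0) {Λ ℓ : ℝ → ℝ} (hΛ0 : Λ 0 = 0)
    (hΛc : ContinuousOn Λ (Ico 0 1)) (hΛd : ∀ ρ ∈ Ioo (0 : ℝ) 1, HasDerivAt Λ (ℓ ρ) ρ)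
    (hℓ : ∀ ρ ∈ Ioo (0 : ℝ) 1, 0 ≤ ℓ ρ)
    (hle : ∀ z ∈ ball (0 : ℂ) 1, z ≠ 0 → ℓ ‖z‖ ≤ ‖deriv h z‖) {z : ℂ}
    (hz : z ∈ ball (0 : ℂ) 1) : Λ ‖z‖ ≤ ‖h z‖ := by
  rcases eq_or_ne z 0 with rfl | hz0
  · simp [h0, hΛ0]
  set r := ‖z‖ with hr
  have hr0 : 0 < r := norm_pos_iff.2 hz0
  have hr1 : r < 1 := mem_ball_zero_iff.1 hz
  have hsub : closedBall (0 : ℂ) r ⊆ ball 0 1 := closedBall_subset_ball hr1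
  have h0m : (0 : ℂ) ∈ ball (0 : ℂ) 1 := mem_ball_self one_pos
  have hhc : ContinuousOn h (closedBall 0 r) := hd.continuousOn.mono hsub
  obtain ⟨z1, hz1, hmin⟩ := (isCompact_sphere (0 : ℂ) r).exists_isMinOn ⟨z, by simp [hr]⟩
    (hhc.mono sphere_subset_closedBall).norm
  have hz1n : ‖z1‖ = r := mem_sphere_zero_iff_norm.1 hz1
  have hz1b : z1 ∈ ball (0 : ℂ) 1 := hsub (sphere_subset_closedBall hz1)
  have hmin' : ∀ y : ℂ, ‖y‖ = r → ‖h z1‖ ≤ ‖h y‖ := fun y hy =>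
    hmin (mem_sphere_zero_iff_norm.2 hy)
  set m := ‖h z1‖ with hm
  have hm0 : 0 < m := by
    rw [hm, norm_pos_iff]
    intro h'
    have := hinj hz1b h0m (h'.trans h0.symm)
    rw [this, norm_zero] at hz1n
    linarith
  -- The disc of radius m misses the image of the circle, so by connectedness it stays inside the
  -- image of the open disc. Thus the segment from 0 to h(z1) lifts to the closed disc of radius r.
  have hcover : ball (0 : ℂ) m ⊆ h '' ball 0 r := by
    refine (convex_ball (0 : ℂ) m).isPreconnected.subset_left_of_subset_union
      (v := (h '' closedBall 0 r)ᶜ)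
      (isOpen_image_of_injOn isOpen_ball (hd.mono (ball_subset_closedBall.trans hsub))
        (hinj.mono (ball_subset_closedBall.trans hsub)))
      ((isCompact_closedBall (0 : ℂ) r).image_of_continuousOn hhc).isClosed.isOpen_compl
      ?_ ?_ ⟨0, mem_ball_self hm0, 0, mem_ball_self hr0, h0⟩
    · exact disjoint_compl_right_iff_subset.2 (image_mono ball_subset_closedBall)
    · intro y hy
      by_cases hyc : y ∈ h '' closedBall 0 r
      · left
        obtain ⟨x, hx, rfl⟩ := hyc
        refine ⟨x, ?_, rfl⟩
        rw [mem_ball_zero_iff]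
        rw [mem_closedBall_zero_iff] at hx
        refine lt_of_le_of_ne hx fun he => ?_
        have := hmin' x he
        rw [mem_ball_zero_iff] at hy
        linarith
      · exact Or.inr hyc
  set φ := Function.invFunOn h (ball 0 1) with hφ
  have hpt : ∀ s ∈ Icc (0 : ℝ) 1, ∃ x : ℂ, ‖x‖ ≤ r ∧ x ∈ ball (0 : ℂ) 1 ∧ h x = s * h z1 ∧
      φ (s * h z1) = x := by
    intro s hs
    have : ∃ x : ℂ, ‖x‖ ≤ r ∧ h x = s * h z1 := by
      rcases eq_or_lt_of_le hs.2 with rfl | hs1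
      · exact ⟨z1, hz1n.le, by simp⟩
      · obtain ⟨x, hx, hxe⟩ := hcover (show (s : ℂ) * h z1 ∈ ball (0 : ℂ) m by
          rw [mem_ball_zero_iff, norm_mul, Complex.norm_real, Real.norm_of_nonneg hs.1]
          nlinarith)
        exact ⟨x, (mem_ball_zero_iff.1 hx).le, hxe⟩
    obtain ⟨x, hx, hxe⟩ := this
    have hxb : x ∈ ball (0 : ℂ) 1 := hsub (mem_closedBall_zero_iff.2 hx)
    exact ⟨x, hx, hxb, hxe, by rw [← hxe]; exact hinj.leftInvOn_invFunOn hxb⟩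
  have hline : ∀ s : ℝ, HasDerivAt (fun s : ℝ => (s : ℂ) * h z1) (h z1) s := fun s => by
    simpa using (Complex.ofRealCLM.hasDerivAt (x := s)).mul_const (h z1)
  have hφd : ∀ s ∈ Icc (0 : ℝ) 1, HasDerivAt (fun s : ℝ => φ (s * h z1))
      ((deriv h (φ (s * h z1)))⁻¹ * h z1) s := by
    intro s hs
    obtain ⟨x, -, hxb, hxe, hxφ⟩ := hpt s hs
    have h2 : HasDerivAt φ (deriv h x)⁻¹ (s * h z1) := by
      rw [← hxe]; exact hasDerivAt_invFunOn isOpen_ball hd hinj hxb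
    rw [hxφ]
    exact h2.comp s (hline s)
  -- Along the lifted segment |x| grows at rate at most m/|h'(x)|, so Λ(|x|) grows at rate at most
  -- ℓ(|x|)·m/|h'(x)| ≤ m.
  have hmono : MonotoneOn (fun s : ℝ => m * s - Λ ‖φ (s * h z1)‖) (Icc 0 1) := by
    have hder : ∀ s ∈ Ioo (0 : ℝ) 1, ∃ d, 0 ≤ d ∧
        HasDerivAt (fun s : ℝ => m * s - Λ ‖φ (s * h z1)‖) d s := by
      intro s hs
      have hs' : s ∈ Icc (0 : ℝ) 1 := ⟨hs.1.le, hs.2.le⟩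
      obtain ⟨x, hxr, hxb, hxe, hxφ⟩ := hpt s hs'
      have hx0 : x ≠ 0 := by
        rintro rfl
        rw [h0] at hxe
        have : (s : ℂ) * h z1 ≠ 0 :=
          mul_ne_zero (by exact_mod_cast hs.1.ne') (norm_pos_iff.1 hm0)
        exact this hxe.symm
      have h1 := hφd s hs'
      have h2 := hasDerivAt_norm_comp h1 (by rw [hxφ]; exact hx0)
      have hxI : ‖x‖ ∈ Ioo (0 : ℝ) 1 := ⟨norm_pos_iff.2 hx0, hxr.trans_lt hr1⟩
      have h3 : HasDerivAt Λ (ℓ ‖x‖) ‖φ (s * h z1)‖ := by rw [hxφ]; exact hΛd _ hxI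
      have h4 := ((hasDerivAt_id' s).const_mul m).sub (h3.comp s h2)
      refine ⟨_, ?_, h4⟩
      rw [hxφ, mul_one, sub_nonneg]
      have hh' := deriv_ne_zero_of_injOn isOpen_ball hd hinj hxb
      have b1 : ‖x‖ * ((deriv h x)⁻¹ * h z1 / x).re ≤ ‖deriv h x‖⁻¹ * m := by
        calc ‖x‖ * ((deriv h x)⁻¹ * h z1 / x).re ≤ ‖x‖ * ‖(deriv h x)⁻¹ * h z1 / x‖ := by
              gcongr; exact Complex.re_le_norm _
          _ = ‖deriv h x‖⁻¹ * m := by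
              rw [norm_div, norm_mul, norm_inv, hm]
              have := hxI.1.ne'
              field_simp
      have hpos : 0 < ‖deriv h x‖ := norm_pos_iff.2 hh'
      calc ℓ ‖x‖ * (‖x‖ * ((deriv h x)⁻¹ * h z1 / x).re)
          ≤ ℓ ‖x‖ * (‖deriv h x‖⁻¹ * m) := mul_le_mul_of_nonneg_left b1 (hℓ _ hxI)
        _ ≤ ‖deriv h x‖ * (‖deriv h x‖⁻¹ * m) :=
            mul_le_mul_of_nonneg_right (hle x hxb hx0) (by positivity)
        _ = m := by field_simp
    refine monotoneOn_of_deriv_nonneg (convex_Icc 0 1) ?_ ?_ ?_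
    · refine ContinuousOn.sub (by fun_prop) ?_
      refine hΛc.comp (t := Ico 0 1)
        (fun s hs => (hφd s hs).continuousAt.norm.continuousWithinAt) fun s hs => ?_
      obtain ⟨x, hxr, -, -, hxφ⟩ := hpt s hs
      exact ⟨norm_nonneg _, by rw [hxφ]; exact hxr.trans_lt hr1⟩
    · intro s hs
      rw [interior_Icc] at hs
      obtain ⟨d, -, h⟩ := hder s hs
      exact h.differentiableAt.differentiableWithinAt
    · intro s hs
      rw [interior_Icc] at hs
      obtain ⟨d, hd0, h⟩ := hder s hs
      rw [h.deriv]; exact hd0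
  have hfin := hmono (left_mem_Icc.2 zero_le_one) (right_mem_Icc.2 zero_le_one) zero_le_one
  have e0 : φ (((0 : ℝ) : ℂ) * h z1) = 0 := by
    simp only [Complex.ofReal_zero, zero_mul]
    have := hinj.leftInvOn_invFunOn h0m
    rwa [h0] at this
  have e1 : φ (((1 : ℝ) : ℂ) * h z1) = z1 := by
    simpa using hinj.leftInvOn_invFunOn hz1b
  simp only [e0, e1, norm_zero, hΛ0, hz1n] at hfin
  have := hmin' z rfl
  linarith

/-- On the diagonal, joint continuity of the difference quotient comes from strict differentiability
together with continuity of f'. -/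
theorem continuousAt_dslope_prod {U : Set ℂ} (hU : IsOpen U) {f : ℂ → ℂ}
    (hf : DifferentiableOn ℂ f U) {p : ℂ × ℂ} (h1 : p.1 ∈ U) (h2 : p.2 ∈ U) :
    ContinuousAt (fun q : ℂ × ℂ => dslope f q.1 q.2) p := by
  obtain ⟨a, b⟩ := p
  simp only at h1 h2
  rcases eq_or_ne b a with rfl | hne
  · have hs : HasStrictDerivAt f (deriv f b) b := (hf.analyticAt (hU.mem_nhds h1)).hasStrictDerivAt
    have hc : ContinuousAt (fun q : ℂ × ℂ => deriv f q.1) (b, b) := by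
      have : ContinuousAt (deriv f) b := (hf.analyticAt (hU.mem_nhds h1)).deriv.continuousAt
      exact ContinuousAt.comp (f := Prod.fst) (x := (b, b)) this continuousAt_fst
    rw [Metric.continuousAt_iff'] at hc ⊢
    intro ε hε
    have ho := hs.isLittleO.def (half_pos hε)
    filter_upwards [hc ε hε, ho] with q hq1 hq2
    obtain ⟨x, y⟩ := q
    simp only [dslope_same] at hq1 hq2 ⊢
    rcases eq_or_ne y x with rfl | hyx
    · simpa using hq1
    · rw [dslope_of_ne _ hyx, slope_def_field, dist_eq_norm]
      have hxy : y - x ≠ 0 := sub_ne_zero.2 hyx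
      have hpos : 0 < ‖y - x‖ := norm_pos_iff.2 hxy
      have e : (f y - f x) / (y - x) - deriv f b =
          -(f x - f y - deriv f b * (x - y)) / (y - x) := by
        field_simp; ring
      rw [e, norm_div, norm_neg, div_lt_iff₀ hpos]
      have : ‖f x - f y - deriv f b * (x - y)‖ ≤ ε / 2 * ‖x - y‖ := by
        simpa [mul_comm] using hq2
      rw [norm_sub_rev x y] at this
      nlinarith
  · have : (fun q : ℂ × ℂ => dslope f q.1 q.2) =ᶠ[𝓝 (a, b)]
        fun q => (f q.2 - f q.1) / (q.2 - q.1) := by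
      have : ∀ᶠ q : ℂ × ℂ in 𝓝 (a, b), q.2 ≠ q.1 :=
        (isOpen_ne_fun continuous_snd continuous_fst).mem_nhds hne
      filter_upwards [this] with q hq
      rw [dslope_of_ne _ hq, slope_def_field]
    rw [continuousAt_congr this]
    have c1 : ContinuousAt (fun q : ℂ × ℂ => f q.1) (a, b) :=
      ContinuousAt.comp (f := Prod.fst) (x := (a, b))
        (hf.differentiableAt (hU.mem_nhds h1)).continuousAt continuousAt_fst
    have c2 : ContinuousAt (fun q : ℂ × ℂ => f q.2) (a, b) :=
      ContinuousAt.comp (f := Prod.snd) (x := (a, b))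
        (hf.differentiableAt (hU.mem_nhds h2)).continuousAt continuousAt_snd
    exact (c2.sub c1).div (continuousAt_snd.sub continuousAt_fst) (sub_ne_zero.2 hne)

theorem eventually_norm_one_sub_mul_lt {c : ℝ → ℂ} {a : ℂ} (hc : HasDerivAt c 1 0) (hc0 : c 0 = 0)
    (ha : 0 < a.re) : ∀ᶠ ε in 𝓝[>] (0 : ℝ), ‖1 - c ε * a‖ < 1 := by
  have h1 : HasDerivAt (fun ε => 1 - c ε * a) (-(1 * a)) 0 := (hc.mul_const a).const_sub 1
  have h2 := hasDerivAt_norm_comp h1 (by simp [hc0])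
  have := eventually_le_of_hasDerivAt_neg h2 (by simp [hc0, ha])
  simpa [hc0] using this

/-- Kaplan's univalence criterion in the following form: if `g` is injective and starlike and
`Re (z f' / g) > 0`, then `f` is injective. -/
theorem injOn_of_re_mul_deriv_div_pos {f g : ℂ → ℂ} (hf : DifferentiableOn ℂ f (ball 0 1))
    (hg : DifferentiableOn ℂ g (ball 0 1)) (hinj : InjOn g (ball 0 1)) (hg0 : g 0 = 0)
    (hf0 : 0 < (deriv f 0 / deriv g 0).re)
    (hfre : ∀ z ∈ ball (0 : ℂ) 1, z ≠ 0 → 0 < (z * deriv f z / g z).re)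
    (hgre : ∀ z ∈ ball (0 : ℂ) 1, z ≠ 0 → 0 ≤ (z * deriv g z / g z).re) :
    InjOn f (ball 0 1) := by
  have hgne : ∀ z ∈ ball (0 : ℂ) 1, z ≠ 0 → g z ≠ 0 := fun z hz hz0 h =>
    hz0 (hinj hz (mem_ball_self one_pos) (h.trans hg0.symm))
  have hP : ∀ z ∈ ball (0 : ℂ) 1, z ≠ 0 → ∀ t : ℝ, 0 ≤ t →
      0 < (z * (deriv f z + t * deriv g z) / g z).re := by
    intro z hz hz0 t ht
    have e : z * (deriv f z + t * deriv g z) / g z =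
        z * deriv f z / g z + t * (z * deriv g z / g z) := by ring
    rw [e, Complex.add_re, Complex.re_ofReal_mul]
    have := mul_nonneg ht (hgre z hz hz0)
    linarith [hfre z hz hz0]
  -- Moving z with velocity -az changes f + tg at rate -g, and Re a > 0 makes |z| decrease unless z
  -- = 0.
  have hspeed : ∀ z ∈ ball (0 : ℂ) 1, ∀ t : ℝ, 0 ≤ t → ∃ a : ℂ, 0 < a.re ∧
      a * z * (deriv f z + t * deriv g z) = g z := by
    intro z hz t ht
    rcases eq_or_ne z 0 with rfl | hz0
    · exact ⟨1, by simp, by simp [hg0]⟩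
    · have h1 := hP z hz hz0 t ht
      refine ⟨(z * (deriv f z + t * deriv g z) / g z)⁻¹, ?_, ?_⟩
      · rw [Complex.inv_re]
        exact div_pos h1 (Complex.normSq_pos.2 fun h => by simp [h] at h1)
      · have hne : z * (deriv f z + t * deriv g z) ≠ 0 := fun h => by simp [h] at h1
        have := hgne z hz hz0
        rw [inv_div, mul_assoc, div_mul_cancel₀ _ hne]
  set T : ℂ × ℂ → ℂ := fun p => dslope f p.1 p.2 / dslope g p.1 p.2 with hT
  have hTne : ∀ p : ℂ × ℂ, p.2 ≠ p.1 → T p = (f p.2 - f p.1) / (g p.2 - g p.1) := fun p hp => by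
    simp only [hT]
    rw [dslope_of_ne _ hp, dslope_of_ne _ hp, slope_def_field, slope_def_field,
      div_div_div_cancel_right₀ (sub_ne_zero.2 hp)]
  have hTeq : ∀ z, T (z, z) = deriv f z / deriv g z := fun z => by simp [hT]
  have hgd : ∀ p : ℂ × ℂ, p.1 ∈ ball (0 : ℂ) 1 → p.2 ∈ ball (0 : ℂ) 1 →
      dslope g p.1 p.2 ≠ 0 := by
    intro p h1 h2
    rcases eq_or_ne p.2 p.1 with h | h
    · rw [h, dslope_same]; exact deriv_ne_zero_of_injOn isOpen_ball hg hinj h1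
    · rw [dslope_of_ne _ h, slope_def_field]
      exact div_ne_zero (sub_ne_zero.2 fun e => h (hinj h2 h1 e)) (sub_ne_zero.2 h)
  have hTc : ∀ p : ℂ × ℂ, p.1 ∈ ball (0 : ℂ) 1 → p.2 ∈ ball (0 : ℂ) 1 → ContinuousAt T p :=
    fun p h1 h2 => (continuousAt_dslope_prod isOpen_ball hf h1 h2).div
      (continuousAt_dslope_prod isOpen_ball hg h1 h2) (hgd p h1 h2)
  intro x hx y hy hxy
  by_contra hne
  set R := max ‖x‖ ‖y‖ with hR
  have hR1 : R < 1 := max_lt (mem_ball_zero_iff.1 hx) (mem_ball_zero_iff.1 hy)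
  -- Off the diagonal, T(z, w) = -t means that f + tg takes equal values at z and w. If f is not
  -- injective, some pair has T in (-∞, 0]; a pair with least max(|z|, |w|) will be moved inward
  -- without leaving this set.
  set N : Set ℂ := {w | w.im = 0 ∧ w.re ≤ 0} with hN
  have hNc : IsClosed N := (isClosed_eq Complex.continuous_im continuous_const).inter
    (isClosed_le Complex.continuous_re continuous_const)
  set C : Set (ℂ × ℂ) := (closedBall 0 R ×ˢ closedBall 0 R) ∩ T ⁻¹' N with hC
  have hsub : closedBall (0 : ℂ) R ⊆ ball 0 1 := closedBall_subset_ball hR1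
  have hKc : IsCompact (closedBall (0 : ℂ) R ×ˢ closedBall (0 : ℂ) R) :=
    (isCompact_closedBall _ _).prod (isCompact_closedBall _ _)
  have hCc : IsCompact C := by
    refine hKc.of_isClosed_subset ?_ inter_subset_left
    exact ContinuousOn.preimage_isClosed_of_isClosed
      (fun p hp => (hTc p (hsub hp.1) (hsub hp.2)).continuousWithinAt) hKc.isClosed hNc
  have hCne : C.Nonempty := by
    refine ⟨(x, y), ⟨by simp [hR], by simp [hR]⟩, ?_⟩
    rw [mem_preimage, hTne (x, y) (Ne.symm hne)]
    simp [hxy, hN]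
  obtain ⟨⟨z, w⟩, hzw, hmin⟩ := hCc.exists_isMinOn hCne
    (f := fun p : ℂ × ℂ => max ‖p.1‖ ‖p.2‖) (by fun_prop)
  obtain ⟨⟨hzR, hwR⟩, hTN⟩ := hzw
  simp only [mem_preimage, hN, mem_ofPred_eq] at hzR hwR hTN
  obtain ⟨t, ht⟩ : ∃ t : ℝ, t = -(T (z, w)).re := ⟨_, rfl⟩
  have ht0 : 0 ≤ t := by linarith [hTN.2]
  have hTt : T (z, w) = -(t : ℂ) := by
    apply Complex.ext
    · simp [ht]
    · simp [hTN.1]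
  have hzb := hsub hzR
  have hwb := hsub hwR
  rcases eq_or_ne w z with rfl | hwz
  · rw [hTeq] at hTt
    rcases eq_or_ne w 0 with rfl | hw0
    · rw [hTt] at hf0
      simp at hf0
      linarith
    · have h1 := hP w hzb hw0 t ht0
      have hg' := deriv_ne_zero_of_injOn isOpen_ball hg hinj hzb
      rw [div_eq_iff hg'] at hTt
      rw [hTt] at h1
      simp at h1
  obtain ⟨a, ha, hza⟩ := hspeed z hzb t ht0
  obtain ⟨b, hb, hwb'⟩ := hspeed w hwb t ht0
  have hD0 : g w - g z ≠ 0 := sub_ne_zero.2 fun e => hwz (hinj hwb hzb e)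
  have hN0 : f w - f z = -t * (g w - g z) := by
    rw [hTne (z, w) hwz, div_eq_iff hD0] at hTt
    exact hTt
  set Ψ : ℂ → ℂ := fun l => (f (w * (1 - l * b)) - f (z * (1 - l * a))) /
    (g (w * (1 - l * b)) - g (z * (1 - l * a))) with hΨ
  have hcz : HasDerivAt (fun l : ℂ => z * (1 - l * a)) (z * -(1 * a)) 0 :=
    (((hasDerivAt_id' (0 : ℂ)).mul_const a).const_sub 1).const_mul z
  have hcw : HasDerivAt (fun l : ℂ => w * (1 - l * b)) (w * -(1 * b)) 0 :=
    (((hasDerivAt_id' (0 : ℂ)).mul_const b).const_sub 1).const_mul w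
  have hcomp : ∀ {u : ℂ → ℂ}, DifferentiableOn ℂ u (ball 0 1) →
      HasDerivAt (fun l => u (w * (1 - l * b)) - u (z * (1 - l * a)))
        (deriv u w * (w * -(1 * b)) - deriv u z * (z * -(1 * a))) 0 := by
    intro u hu
    have h1 : HasDerivAt u (deriv u w) (w * (1 - 0 * b)) := by
      simpa using (hu.differentiableAt (isOpen_ball.mem_nhds hwb)).hasDerivAt
    have h2 : HasDerivAt u (deriv u z) (z * (1 - 0 * a)) := by
      simpa using (hu.differentiableAt (isOpen_ball.mem_nhds hzb)).hasDerivAt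
    exact (h1.comp (0 : ℂ) hcw).sub (h2.comp (0 : ℂ) hcz)
  -- Both points flow so that the difference of f + tg changes at rate -(g(w) - g(z)); hence T,
  -- which starts at -t, has derivative -1.
  have hΨd : HasDerivAt Ψ (-1) 0 := by
    have hD0' : (g (w * (1 - 0 * b)) - g (z * (1 - 0 * a))) ≠ 0 := by simpa using hD0
    refine ((hcomp hf).fun_div (hcomp hg) hD0').congr_deriv ?_
    simp only [zero_mul, sub_zero, mul_one]
    rw [hN0, div_eq_iff (pow_ne_zero 2 hD0)]
    linear_combination (g w - g z) * (hza - hwb')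
  have hΨa : AnalyticAt ℂ Ψ 0 := by
    have hu : ∀ {u : ℂ → ℂ}, DifferentiableOn ℂ u (ball 0 1) →
        AnalyticAt ℂ (fun l => u (w * (1 - l * b)) - u (z * (1 - l * a))) 0 := by
      intro u hu
      refine AnalyticAt.sub ?_ ?_
      · refine AnalyticAt.fun_comp (g := u) ?_ (by fun_prop)
        simpa using hu.analyticAt (isOpen_ball.mem_nhds hwb)
      · refine AnalyticAt.fun_comp (g := u) ?_ (by fun_prop)
        simpa using hu.analyticAt (isOpen_ball.mem_nhds hzb)
    exact (hu hf).fun_div (hu hg) (by simpa using hD0)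
  have hstrict : HasStrictDerivAt Ψ (-1) 0 := by
    have := hΨa.hasStrictDerivAt
    rwa [hΨd.deriv] at this
  have hΨ0 : Ψ 0 = -t := by
    simp only [hΨ, zero_mul, sub_zero, mul_one]
    rw [hN0, mul_div_cancel_right₀ _ hD0]
  have hne1 : (-1 : ℂ) ≠ 0 := by norm_num
  set L := hstrict.localInverse Ψ (-1) 0 hne1 with hL
  have hLd : HasDerivAt L (-1)⁻¹ (Ψ 0) := (hstrict.to_localInverse hne1).hasDerivAt
  have hL0 : L (Ψ 0) = 0 := by
    exact (hstrict.hasStrictFDerivAt_equiv hne1).localInverse_apply_image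
  have hLr : ∀ᶠ y in 𝓝 (Ψ 0), Ψ (L y) = y :=
    (hstrict.hasStrictFDerivAt_equiv hne1).eventually_right_inverse
  -- A complex time, tangent to the real axis, at which T equals -t - ε exactly and not just to
  -- first order.
  set c : ℝ → ℂ := fun ε => L (Ψ 0 - ε) with hc
  have hline : HasDerivAt (fun ε : ℝ => Ψ 0 - (ε : ℂ)) (-1) 0 := by
    simpa using (Complex.ofRealCLM.hasDerivAt (x := 0)).const_sub (Ψ 0)
  have hcd : HasDerivAt c 1 0 := by
    have h1 : HasDerivAt L (-1)⁻¹ (Ψ 0 - ((0 : ℝ) : ℂ)) := by simpa using hLd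
    exact (h1.comp (0 : ℝ) hline).congr_deriv (by norm_num)
  have hc0 : c 0 = 0 := by simp [hc, hL0]
  have hev1 := eventually_norm_one_sub_mul_lt hcd hc0 ha
  have hev2 := eventually_norm_one_sub_mul_lt hcd hc0 hb
  have hev3 : ∀ᶠ ε in 𝓝[>] (0 : ℝ), Ψ (c ε) = Ψ 0 - ε := by
    have : Tendsto (fun ε : ℝ => Ψ 0 - (ε : ℂ)) (𝓝[>] 0) (𝓝 (Ψ 0)) := by
      have := hline.continuousAt.tendsto
      simp only [Complex.ofReal_zero, sub_zero] at this
      exact this.mono_left nhdsWithin_le_nhds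
    exact this.eventually hLr
  have hev4 : ∀ᶠ ε in 𝓝[>] (0 : ℝ), w * (1 - c ε * b) ≠ z * (1 - c ε * a) := by
    have : ContinuousAt (fun ε : ℝ => w * (1 - c ε * b) - z * (1 - c ε * a)) 0 := by
      have := hcd.continuousAt
      fun_prop
    have h2 := this.eventually_ne (y := 0) (by simpa [hc0] using sub_ne_zero.2 hwz)
    exact (h2.mono fun ε h => sub_ne_zero.1 h).filter_mono nhdsWithin_le_nhds
  obtain ⟨ε, h1, h2, h3, h4, h5⟩ := (hev1.and (hev2.and (hev3.and (hev4.and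
    self_mem_nhdsWithin)))).exists
  have hε : 0 < ε := h5
  set M := max ‖z‖ ‖w‖ with hM
  have hMpos : 0 < M := by
    rcases eq_or_ne z 0 with rfl | hz0
    · exact lt_max_of_lt_right (norm_pos_iff.2 hwz)
    · exact lt_max_of_lt_left (norm_pos_iff.2 hz0)
  have hlt : ∀ v d : ℂ, ‖v‖ ≤ M → ‖1 - c ε * d‖ < 1 → ‖v * (1 - c ε * d)‖ < M := by
    intro v d hv hd
    rw [norm_mul]
    rcases eq_or_ne v 0 with rfl | hv0
    · simpa using hMpos
    · have := norm_pos_iff.2 hv0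
      nlinarith
  have hz' := hlt z a (le_max_left _ _) h1
  have hw' := hlt w b (le_max_right _ _) h2
  have hMR : M ≤ R := max_le (mem_closedBall_zero_iff.1 hzR) (mem_closedBall_zero_iff.1 hwR)
  have hmem : ((z * (1 - c ε * a), w * (1 - c ε * b)) : ℂ × ℂ) ∈ C := by
    refine ⟨⟨mem_closedBall_zero_iff.2 (hz'.le.trans hMR),
      mem_closedBall_zero_iff.2 (hw'.le.trans hMR)⟩, ?_⟩
    rw [mem_preimage, hTne _ h4]
    have : Ψ (c ε) = -(t : ℂ) - ε := by rw [h3, hΨ0]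
    simp only [hΨ] at this
    simp only [this, hN, mem_ofPred_eq]
    simp
    linarith
  have := hmin hmem
  simp only [mem_ofPred_eq] at this
  exact absurd (max_lt hz' hw') (not_lt.2 this)

/-- Otherwise the inverse would be a bounded entire function, contrary to Liouville. This is what
makes the boundary of the image nonempty. -/
theorem image_ball_ne_univ_of_injOn {f : ℂ → ℂ} (hf : DifferentiableOn ℂ f (ball 0 1))
    (hinj : InjOn f (ball 0 1)) : f '' ball 0 1 ≠ univ := by
  intro h
  have hmem : ∀ w : ℂ, ∃ z ∈ ball (0 : ℂ) 1, f z = w := fun w => by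
    have : w ∈ f '' ball 0 1 := h ▸ mem_univ w
    exact this
  have hd : Differentiable ℂ (Function.invFunOn f (ball 0 1)) := fun w => by
    obtain ⟨z, hz, rfl⟩ := hmem w
    exact (hasDerivAt_invFunOn isOpen_ball hf hinj hz).differentiableAt
  have hb : Bornology.IsBounded (range (Function.invFunOn f (ball 0 1))) := by
    refine (isBounded_ball (x := (0 : ℂ)) (r := 1)).subset ?_
    rintro _ ⟨w, rfl⟩
    exact Function.invFunOn_mem (hmem w)
  have h1 : (1 / 2 : ℂ) ∈ ball (0 : ℂ) 1 := by
    rw [mem_ball_zero_iff]; norm_num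
  have h2 := hd.apply_eq_apply_of_bounded hb (f 0) (f (1 / 2))
  rw [hinj.leftInvOn_invFunOn (mem_ball_self one_pos), hinj.leftInvOn_invFunOn h1] at h2
  norm_num at h2

/-! ### The dilogarithm and the radius equation. -/

/-- The dilogarithm `∑ xⁿ / n²`. -/
noncomputable def dilog {𝕜 : Type*} [RCLike 𝕜] (x : 𝕜) : 𝕜 :=
  ∑' n : ℕ, x ^ (n + 1) / ((n : 𝕜) + 1) ^ 2

theorem norm_natCast_add_one {𝕜 : Type*} [RCLike 𝕜] (n : ℕ) : ‖(n : 𝕜) + 1‖ = (n : ℝ) + 1 := by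
  rw [← Nat.cast_succ, RCLike.norm_natCast, Nat.cast_succ]

theorem norm_dilog_term_le {𝕜 : Type*} [RCLike 𝕜] {x : 𝕜} (hx : ‖x‖ ≤ 1) (n : ℕ) :
    ‖x ^ (n + 1) / ((n : 𝕜) + 1) ^ 2‖ ≤ 1 / ((n : ℝ) + 1) ^ 2 := by
  rw [norm_div, norm_pow, norm_pow, norm_natCast_add_one]
  gcongr
  exact pow_le_one₀ (norm_nonneg _) hx

theorem hasSum_one_div_succ_sq :
    HasSum (fun n : ℕ => 1 / ((n : ℝ) + 1) ^ 2) (Real.pi ^ 2 / 6) := by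
  have h := (hasSum_nat_add_iff' (f := fun n : ℕ => (1 : ℝ) / (n : ℝ) ^ 2) 1).2 hasSum_zeta_two
  simpa using h

theorem hasSum_dilog {𝕜 : Type*} [RCLike 𝕜] {x : 𝕜} (hx : ‖x‖ ≤ 1) :
    HasSum (fun n : ℕ => x ^ (n + 1) / ((n : 𝕜) + 1) ^ 2) (dilog x) :=
  (Summable.of_norm_bounded hasSum_one_div_succ_sq.summable (norm_dilog_term_le hx)).hasSum

theorem continuousOn_dilog {𝕜 : Type*} [RCLike 𝕜] :
    ContinuousOn (dilog : 𝕜 → 𝕜) (closedBall 0 1) :=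
  continuousOn_tsum (fun n => by fun_prop) hasSum_one_div_succ_sq.summable
    fun n _ hx => norm_dilog_term_le (mem_closedBall_zero_iff.1 hx) n

@[simp] theorem dilog_zero {𝕜 : Type*} [RCLike 𝕜] : dilog (0 : 𝕜) = 0 := by
  simp [dilog]

theorem hasDerivAt_dilog {𝕜 : Type*} [RCLike 𝕜] {x : 𝕜} (hx : ‖x‖ < 1) :
    HasDerivAt (dilog : 𝕜 → 𝕜) (∑' n : ℕ, x ^ n / ((n : 𝕜) + 1)) x := by
  obtain ⟨r, hxr, hr⟩ := exists_between hx
  have hr0 : 0 < r := (norm_nonneg x).trans_lt hxr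
  refine hasDerivAt_tsum_of_isPreconnected
    (g := fun (n : ℕ) (y : 𝕜) => y ^ (n + 1) / ((n : 𝕜) + 1) ^ 2)
    (g' := fun (n : ℕ) (y : 𝕜) => y ^ n / ((n : 𝕜) + 1)) (t := ball (0 : 𝕜) r) (y₀ := 0)
    (summable_geometric_of_lt_one hr0.le hr) isOpen_ball
    (convex_ball (0 : 𝕜) r).isPreconnected (fun n y _ => ?_) (fun n y hy => ?_)
    (mem_ball_self hr0) ?_ (mem_ball_zero_iff.2 hxr)
  · have hn : (n : 𝕜) + 1 ≠ 0 := Nat.cast_add_one_ne_zero n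
    convert! (hasDerivAt_pow (n + 1) y).div_const (((n : 𝕜) + 1) ^ 2) using 1
    push_cast
    field_simp
  · rw [norm_div, norm_pow, norm_natCast_add_one]
    refine (div_le_self (by positivity) (by linarith [n.cast_nonneg (α := ℝ)])).trans ?_
    exact pow_le_pow_left₀ (norm_nonneg _) (mem_ball_zero_iff.1 hy).le n
  · simp

theorem mul_tsum_pow_div_succ_real {x : ℝ} (hx : |x| < 1) :
    x * ∑' n : ℕ, x ^ n / ((n : ℝ) + 1) = -Real.log (1 - x) := by
  rw [← tsum_mul_left, ← (Real.hasSum_pow_div_log_of_abs_lt_one hx).tsum_eq]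
  exact tsum_congr fun n => by rw [pow_succ]; ring

theorem mul_tsum_pow_div_succ_complex {x : ℂ} (hx : ‖x‖ < 1) :
    x * ∑' n : ℕ, x ^ n / ((n : ℂ) + 1) = -Complex.log (1 - x) := by
  have h := (hasSum_nat_add_iff' 1).2 (Complex.hasSum_taylorSeries_neg_log hx)
  simp only [Finset.sum_range_one, pow_zero, Nat.cast_zero, div_zero, sub_zero] at h
  rw [← tsum_mul_left, ← h.tsum_eq]
  exact tsum_congr fun n => by push_cast; rw [pow_succ]; ring

theorem dilog_neg_one : dilog (-1 : ℝ) = -(Real.pi ^ 2 / 12) := by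
  have h1 := hasSum_one_div_succ_sq
  have h2 := hasSum_dilog (x := (-1 : ℝ)) (by simp)
  have hodd : Summable fun k : ℕ => 1 / (((2 * k + 1 : ℕ) : ℝ) + 1) ^ 2 :=
    h1.summable.comp_injective (i := fun k : ℕ => 2 * k + 1) fun a b h => by simpa using h
  have hoddv : ∑' k : ℕ, 1 / (((2 * k + 1 : ℕ) : ℝ) + 1) ^ 2 = Real.pi ^ 2 / 24 := by
    have := (h1.mul_left (1 / 4)).tsum_eq
    rw [show Real.pi ^ 2 / 24 = 1 / 4 * (Real.pi ^ 2 / 6) by ring, ← this]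
    refine tsum_congr fun k => ?_
    push_cast
    have : (k : ℝ) + 1 ≠ 0 := Nat.cast_add_one_ne_zero k
    field_simp
    ring
  have heven : Summable fun k : ℕ => 1 / (((2 * k : ℕ) : ℝ) + 1) ^ 2 :=
    h1.summable.comp_injective (i := fun k : ℕ => 2 * k) fun a b h => by simpa using h
  have hsum := tsum_even_add_odd (f := fun n : ℕ => 1 / ((n : ℝ) + 1) ^ 2) heven hodd
  rw [h1.tsum_eq, hoddv] at hsum
  have e2 : ∀ k : ℕ, (-1 : ℝ) ^ (2 * k + 1) / (((2 * k : ℕ) : ℝ) + 1) ^ 2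
      = -(1 / (((2 * k : ℕ) : ℝ) + 1) ^ 2) := fun k => by
    rw [pow_succ, pow_mul]; norm_num; ring
  have o2 : ∀ k : ℕ, (-1 : ℝ) ^ (2 * k + 1 + 1) / (((2 * k + 1 : ℕ) : ℝ) + 1) ^ 2
      = 1 / (((2 * k + 1 : ℕ) : ℝ) + 1) ^ 2 := fun k => by
    rw [show 2 * k + 1 + 1 = 2 * (k + 1) by ring, pow_mul]; norm_num
  have h3 := tsum_even_add_odd (f := fun n : ℕ => (-1 : ℝ) ^ (n + 1) / ((n : ℝ) + 1) ^ 2)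
    (by simpa only [e2] using heven.neg) (by simpa only [o2] using hodd)
  simp only [e2, o2] at h3
  rw [tsum_neg, hoddv, h2.tsum_eq] at h3
  linarith

theorem hasDerivAt_dilog_real {x : ℝ} (hx : |x| < 1) (hx0 : x ≠ 0) :
    HasDerivAt (dilog : ℝ → ℝ) (-Real.log (1 - x) / x) x := by
  convert! hasDerivAt_dilog (𝕜 := ℝ) hx using 1
  rw [← mul_tsum_pow_div_succ_real hx, mul_div_cancel_left₀ _ hx0]

theorem hasDerivAt_dilog_complex {x : ℂ} (hx : ‖x‖ < 1) :
    ∃ d : ℂ, x * d = -Complex.log (1 - x) ∧ HasDerivAt (dilog : ℂ → ℂ) d x :=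
  ⟨_, mul_tsum_pow_div_succ_complex hx, hasDerivAt_dilog hx⟩

theorem integral_log_one_sub_div {r : ℝ} (hr0 : 0 ≤ r) (hr : r < 1) :
    ∫ t in (0 : ℝ)..r, Real.log (1 - t) / t = -dilog r := by
  have hc : ContinuousOn (dilog : ℝ → ℝ) (Icc 0 r) :=
    continuousOn_dilog.mono fun t ht =>
      mem_closedBall_zero_iff.2 (by rw [Real.norm_eq_abs, abs_le]; constructor <;>
        linarith [ht.1, ht.2])
  have hd : ∀ t ∈ Ioo 0 r, HasDerivAt (dilog : ℝ → ℝ) (-Real.log (1 - t) / t) t := fun t ht =>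
    hasDerivAt_dilog_real (by rw [abs_of_pos ht.1]; linarith [ht.2]) ht.1.ne'
  have hp : ∀ t ∈ Ioo 0 r, 0 ≤ -Real.log (1 - t) / t := fun t ht => by
    have := Real.log_nonpos (x := 1 - t) (by linarith [ht.2]) (by linarith [ht.1])
    exact div_nonneg (by linarith) ht.1.le
  have hi := (intervalIntegrable_iff_integrableOn_Ioc_of_le hr0).2
    (intervalIntegral.integrableOn_deriv_of_nonneg hc hd hp)
  have h := intervalIntegral.integral_eq_sub_of_hasDerivAt_of_le hr0 hc hd hi
  rw [dilog_zero, sub_zero] at h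
  rw [← h, ← intervalIntegral.integral_neg]
  exact intervalIntegral.integral_congr fun t _ => by
    show Real.log (1 - t) / t = -(-Real.log (1 - t) / t)
    ring

theorem hasSum_pow_div_sq_tail {r : ℝ} (hr : |r| ≤ 1) :
    HasSum (fun n : ℕ => r ^ (n + 2) / (3 * ((n : ℝ) + 2) ^ 2)) ((dilog r - r) / 3) := by
  have h := ((hasSum_nat_add_iff' 1).2 (hasSum_dilog (𝕜 := ℝ) hr)).div_const 3
  simp only [Finset.sum_range_one] at h
  convert! h using 1
  · ext n
    push_cast
    rw [div_div, mul_comm]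
    ring_nf
  · simp

/-- The integral and the series both become dilogarithms, and the rational part is split so that
every nonconstant summand is visibly increasing on [0, 1). -/
theorem radiusFun_eq {r : ℝ} (hr0 : 0 ≤ r) (hr : r < 1) :
    radiusFun r = r * (1 + r) / (3 * (1 - r)) + 2 / 3 * (r / (1 - r) ^ 2)
      + 2 / 3 * (r ^ 2 / (1 - r)) + 2 / 3 * dilog r - 1 / 3 * Real.log (1 - r)
      - (1 / 3 + Real.pi ^ 2 / 36) := by
  rw [radiusFun, integral_log_one_sub_div hr0 hr,
    (hasSum_pow_div_sq_tail (abs_le.2 ⟨by linarith, hr.le⟩)).tsum_eq]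
  have : 1 - r ≠ 0 := by linarith
  field_simp
  ring

theorem dilog_le_dilog {x y : ℝ} (hx : 0 ≤ x) (hxy : x ≤ y) (hy : y ≤ 1) : dilog x ≤ dilog y := by
  refine hasSum_le (fun n => ?_) (hasSum_dilog (𝕜 := ℝ) (x := x) ?_)
    (hasSum_dilog (𝕜 := ℝ) (x := y) ?_)
  · gcongr
  · rw [Real.norm_eq_abs, abs_of_nonneg hx]; exact hxy.trans hy
  · rw [Real.norm_eq_abs, abs_of_nonneg (hx.trans hxy)]; exact hy

theorem strictMonoOn_radiusFun : StrictMonoOn radiusFun (Ico 0 1) := by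
  intro x hx y hy hxy
  rw [radiusFun_eq hx.1 hx.2, radiusFun_eq hy.1 hy.2]
  have hx0 := hx.1
  have h1 : 0 < 1 - y := by linarith [hy.2]
  have h2 : 1 - y < 1 - x := by linarith
  have hy0 : 0 ≤ y := hy.1
  have hyy : 0 ≤ y * (1 + y) := by positivity
  have e1 : x * (1 + x) / (3 * (1 - x)) ≤ y * (1 + y) / (3 * (1 - y)) := by
    gcongr
  have e2 : x / (1 - x) ^ 2 < y / (1 - y) ^ 2 := by gcongr
  have e3 : x ^ 2 / (1 - x) ≤ y ^ 2 / (1 - y) := by gcongr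
  have e4 := dilog_le_dilog hx0 hxy.le hy.2.le
  have e5 := Real.log_le_log h1 h2.le
  linarith

theorem continuousOn_radiusFun : ContinuousOn radiusFun (Ico 0 1) := by
  have hd : ContinuousOn (dilog : ℝ → ℝ) (Ico 0 1) :=
    continuousOn_dilog.mono fun t ht =>
      mem_closedBall_zero_iff.2 (by rw [Real.norm_eq_abs, abs_le]; constructor <;>
        linarith [ht.1, ht.2])
  have hl : ContinuousOn (fun r : ℝ => Real.log (1 - r)) (Ico 0 1) :=
    ContinuousOn.log (by fun_prop) fun r hr => by linarith [hr.2]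
  refine ContinuousOn.congr (f := fun r : ℝ => r * (1 + r) / (3 * (1 - r))
      + 2 / 3 * (r / (1 - r) ^ 2) + 2 / 3 * (r ^ 2 / (1 - r)) + 2 / 3 * dilog r
      - 1 / 3 * Real.log (1 - r) - (1 / 3 + Real.pi ^ 2 / 36)) ?_
    fun r hr => radiusFun_eq hr.1 hr.2
  have hne : ∀ r ∈ Ico (0 : ℝ) 1, 1 - r ≠ 0 := fun r hr => by linarith [hr.2]
  have h1 : ContinuousOn (fun r : ℝ => r * (1 + r) / (3 * (1 - r))) (Ico 0 1) :=
    ContinuousOn.div (by fun_prop) (by fun_prop) fun r hr => mul_ne_zero three_ne_zero (hne r hr)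
  have h2 : ContinuousOn (fun r : ℝ => r / (1 - r) ^ 2) (Ico 0 1) :=
    ContinuousOn.div (by fun_prop) (by fun_prop) fun r hr => pow_ne_zero 2 (hne r hr)
  have h3 : ContinuousOn (fun r : ℝ => r ^ 2 / (1 - r)) (Ico 0 1) :=
    ContinuousOn.div (by fun_prop) (by fun_prop) hne
  fun_prop

theorem exists_radiusFun_eq_zero : ∃ r ∈ Ioo (0 : ℝ) 1, radiusFun r = 0 := by
  have h0 : radiusFun 0 < 0 := by
    rw [radiusFun_eq le_rfl one_pos]
    have := sq_nonneg Real.pi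
    simp
    linarith
  have h1 : 0 < radiusFun (1 / 2) := by
    rw [radiusFun_eq (by norm_num) (by norm_num)]
    have e4 := dilog_le_dilog le_rfl (show (0 : ℝ) ≤ 1 / 2 by norm_num) (by norm_num)
    have e5 := Real.log_nonpos (x := 1 - 1 / 2) (by norm_num) (by norm_num)
    have := Real.pi_lt_four
    rw [dilog_zero] at e4
    nlinarith [Real.pi_pos]
  obtain ⟨r, hr, hr'⟩ := intermediate_value_Ioo (show (0 : ℝ) ≤ 1 / 2 by norm_num)
    (continuousOn_radiusFun.mono fun r hr => ⟨hr.1, by linarith [hr.2]⟩) ⟨h0, h1⟩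
  exact ⟨r, ⟨hr.1, by linarith [hr.2]⟩, hr'⟩

/-! ### Normalization and univalence in the class. -/

theorem IsConvexFunction.real_smul {g : ℂ → ℂ} (hg : IsConvexFunction g) {c : ℝ} (hc : 0 < c) :
    IsConvexFunction fun z => (c : ℂ) * g z where
  differentiableOn := hg.differentiableOn.const_mul _
  injOn := fun x hx y hy h =>
    hg.injOn hx hy (mul_left_cancel₀ (Complex.ofReal_ne_zero.2 hc.ne') h)
  convex_image := by
    have h := hg.convex_image.linear_image (c • LinearMap.id)
    rwa [image_image] at h
  map_zero := by simp [hg.map_zero]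
  re_deriv_pos := by
    rw [deriv_const_mul_field, Complex.re_ofReal_mul]
    exact mul_pos hc hg.re_deriv_pos

theorem zDeriv_const_mul (c : ℂ) (g : ℂ → ℂ) :
    zDeriv (fun z => c * g z) = fun z => c * zDeriv g z := by
  ext z
  rw [zDeriv, zDeriv, deriv_const_mul_field]
  ring

theorem MemC3.exists_convex_norm_deriv_eq_one {f : ℂ → ℂ} (hf : MemC3 f) :
    ∃ g : ℂ → ℂ, IsConvexFunction g ∧ ‖deriv g 0‖ = 1 ∧
      ∀ z ∈ ball (0 : ℂ) 1, 0 < (deriv (zDeriv (zDeriv f)) z / deriv (zDeriv g) z).re := by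
  obtain ⟨g, hg, hre⟩ := hf.exists_convex
  have hb : 0 < ‖deriv g 0‖ := norm_pos_iff.2 fun h => by
    have := hg.re_deriv_pos
    simp [h] at this
  refine ⟨_, hg.real_smul (inv_pos.2 hb), ?_, fun z hz => ?_⟩
  · rw [deriv_const_mul_field, norm_mul, Complex.norm_real, norm_inv, norm_norm,
      inv_mul_cancel₀ hb.ne']
  · rw [zDeriv_const_mul, deriv_const_mul_field, Complex.ofReal_inv, mul_comm, ← div_div,
      div_inv_eq_mul, Complex.re_mul_ofReal]
    exact mul_pos (hre z hz) hb

theorem MemC3.re_deriv_zDeriv_div_pos {f g : ℂ → ℂ} (hf : MemC3 f) (hg : IsConvexFunction g)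
    (hg1 : ‖deriv g 0‖ = 1)
    (hre : ∀ z ∈ ball (0 : ℂ) 1, 0 < (deriv (zDeriv (zDeriv f)) z / deriv (zDeriv g) z).re)
    {z : ℂ} (hz : z ∈ ball (0 : ℂ) 1) : 0 < (deriv (zDeriv f) z / deriv g z).re :=
  _root_.re_deriv_zDeriv_div_pos hf.differentiableOn hf.deriv_zero hg.differentiableOn hg.injOn
    hg.convex_image hg1 hre hz

theorem MemC3.injOn_zDeriv {f : ℂ → ℂ} (hf : MemC3 f) : InjOn (zDeriv f) (ball 0 1) := by
  obtain ⟨g, hg, hg1, hre⟩ := hf.exists_convex_norm_deriv_eq_one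
  exact injOn_of_re_deriv_div_pos hg.differentiableOn hg.injOn hg.convex_image
    (differentiableOn_zDeriv hf.differentiableOn)
    fun z hz => hf.re_deriv_zDeriv_div_pos hg hg1 hre hz

theorem re_inv_pos {z : ℂ} (hz : 0 < z.re) : 0 < (z⁻¹).re := by
  rw [Complex.inv_re]
  exact div_pos hz (Complex.normSq_pos.2 fun h => by simp [h] at hz)

theorem re_inv_nonneg {z : ℂ} (hz : 0 ≤ z.re) : 0 ≤ (z⁻¹).re := by
  rw [Complex.inv_re]
  exact div_nonneg hz (Complex.normSq_nonneg z)

/-- The slope estimate for zf' against g, with second point 0, says Re(zf'/g) > 0; starlikeness of g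
is the same kind of slope estimate for g itself. -/
theorem MemC3.injOn {f : ℂ → ℂ} (hf : MemC3 f) : InjOn f (ball 0 1) := by
  obtain ⟨g, hg, hg1, hre⟩ := hf.exists_convex_norm_deriv_eq_one
  have h0 : (0 : ℂ) ∈ ball (0 : ℂ) 1 := mem_ball_self one_pos
  refine injOn_of_re_mul_deriv_div_pos hf.differentiableOn hg.differentiableOn hg.injOn hg.map_zero
    ?_ (fun z hz hz0 => ?_) fun z hz _ => ?_
  · rw [hf.deriv_zero, one_div]
    exact re_inv_pos hg.re_deriv_pos
  · have := re_slope_pos_of_re_deriv_div_pos hg.differentiableOn hg.injOn hg.convex_image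
      (differentiableOn_zDeriv hf.differentiableOn)
      (fun z hz => hf.re_deriv_zDeriv_div_pos hg hg1 hre hz) hz h0 hz0
    simpa [hg.map_zero, zDeriv] using this
  · have := re_slope_nonneg_of_convex hg.differentiableOn hg.injOn hg.convex_image hz (w := 0)
      (by simp)
    simpa [hg.map_zero] using re_inv_nonneg this

theorem abs_neg_lt_one_of_mem_Ioo {ρ : ℝ} (hρ : ρ ∈ Ioo (0 : ℝ) 1) : |-ρ| < 1 := by
  rw [abs_neg, abs_of_pos hρ.1]
  exact hρ.2

/-! ### Growth and the distance to the boundary. -/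

/-- The sharp lower bound for `|f|` on the circle of radius `ρ`, for `f` in the class `𝒞₃`. -/
noncomputable def growthBound (ρ : ℝ) : ℝ := 2 / 3 * (ρ / (1 + ρ)) - 1 / 3 * dilog (-ρ)

theorem hasDerivAt_growthBound {ρ : ℝ} (hρ : ρ ∈ Ioo (0 : ℝ) 1) :
    HasDerivAt growthBound (2 / 3 * (1 / (1 + ρ) ^ 2) + 1 / 3 * (Real.log (1 + ρ) / ρ)) ρ := by
  have h1 : (1 : ℝ) + ρ ≠ 0 := by linarith [hρ.1]
  have h0 : ρ ≠ 0 := hρ.1.ne'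
  have ha := ((hasDerivAt_id ρ).div ((hasDerivAt_id ρ).const_add 1) h1).const_mul (2 / 3)
  have hb := ((hasDerivAt_dilog_real (abs_neg_lt_one_of_mem_Ioo hρ)
    (neg_ne_zero.2 h0)).comp ρ (hasDerivAt_neg ρ)).const_mul (1 / 3)
  convert! ha.sub hb using 1
  simp only [id_eq, sub_neg_eq_add]
  field_simp
  ring

theorem continuousOn_growthBound : ContinuousOn growthBound (Icc 0 1) := by
  have h1 : ContinuousOn (fun ρ : ℝ => dilog (-ρ)) (Icc 0 1) :=
    continuousOn_dilog.comp continuousOn_neg fun t ht =>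
      mem_closedBall_zero_iff.2 (by rw [norm_neg, Real.norm_eq_abs, abs_of_nonneg ht.1]; exact ht.2)
  have h2 : ContinuousOn (fun ρ : ℝ => ρ / (1 + ρ)) (Icc 0 1) :=
    ContinuousOn.div (by fun_prop) (by fun_prop) fun t ht => by linarith [ht.1]
  unfold growthBound
  fun_prop

theorem growthBound_zero : growthBound 0 = 0 := by simp [growthBound]

theorem growthBound_one : growthBound 1 = 1 / 3 + Real.pi ^ 2 / 36 := by
  rw [growthBound, dilog_neg_one]
  ring

theorem monotoneOn_growthBound : MonotoneOn growthBound (Icc 0 1) := by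
  refine monotoneOn_of_deriv_nonneg (convex_Icc 0 1) continuousOn_growthBound ?_ ?_
  · rw [interior_Icc]
    exact fun ρ hρ => (hasDerivAt_growthBound hρ).differentiableAt.differentiableWithinAt
  · rw [interior_Icc]
    intro ρ hρ
    rw [(hasDerivAt_growthBound hρ).deriv]
    have := Real.log_nonneg (x := 1 + ρ) (by linarith [hρ.1])
    have := hρ.1
    positivity

theorem tendsto_growthBound_nhdsLT_one :
    Tendsto growthBound (𝓝[<] 1) (𝓝 (1 / 3 + Real.pi ^ 2 / 36)) := by
  have h1 : Tendsto growthBound (𝓝[Icc 0 1] 1) (𝓝 (growthBound 1)) :=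
    continuousOn_growthBound 1 (right_mem_Icc.2 zero_le_one)
  rw [growthBound_one] at h1
  refine h1.mono_left ?_
  rw [← nhdsWithin_Ioo_eq_nhdsLT (zero_lt_one' ℝ)]
  exact nhdsWithin_mono _ Ioo_subset_Icc_self

theorem MemC3.exists_zDeriv_growth {f : ℂ → ℂ} (hf : MemC3 f) :
    ∃ κ : ℝ, 0 ≤ κ ∧ κ ≤ 1 / 4 ∧ ∀ z ∈ ball (0 : ℂ) 1,
      2 / 3 * (‖z‖ / (1 + ‖z‖) ^ 2) + 1 / 3 * Real.log (1 + ‖z‖)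
        + κ * (2 / 9 * (‖z‖ ^ 2 / 2 - ‖z‖ ^ 4)) ≤ ‖zDeriv f z‖ := by
  obtain ⟨g, hg, hg1, hre⟩ := hf.exists_convex_norm_deriv_eq_one
  obtain ⟨κ, hκ0, hκ1, hκ⟩ := exists_norm_zDeriv_zDeriv_ge hf.differentiableOn hf.deriv_zero
    hg.differentiableOn hg.injOn hg.convex_image hg1 hre
  refine ⟨κ, hκ0, hκ1, fun z hz => ?_⟩
  refine le_norm_of_le_norm_deriv
    (Λ := fun ρ : ℝ => 2 / 3 * (ρ / (1 + ρ) ^ 2) + 1 / 3 * Real.log (1 + ρ)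
        + κ * (2 / 9 * (ρ ^ 2 / 2 - ρ ^ 4)))
    (ℓ := fun ρ : ℝ => (3 + ρ ^ 2) / (3 * (1 + ρ) ^ 3) + κ * (2 / 9 * (ρ - 4 * ρ ^ 3)))
    (differentiableOn_zDeriv hf.differentiableOn) hf.injOn_zDeriv (by simp [zDeriv]) (by simp)
    ?_ (fun ρ hρ => ?_) (fun ρ hρ => ?_) (fun w hw hw0 => ?_) hz
  · have h1 : ContinuousOn (fun ρ : ℝ => ρ / (1 + ρ) ^ 2) (Ico 0 1) :=
      ContinuousOn.div (by fun_prop) (by fun_prop) fun t ht =>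
        pow_ne_zero 2 (by linarith [ht.1])
    have h2 : ContinuousOn (fun ρ : ℝ => Real.log (1 + ρ)) (Ico 0 1) :=
      ContinuousOn.log (by fun_prop) fun t ht => by linarith [ht.1]
    fun_prop
  · have h1 : (1 : ℝ) + ρ ≠ 0 := by linarith [hρ.1]
    have ha := ((hasDerivAt_id ρ).div (((hasDerivAt_id ρ).const_add 1).pow 2)
      (pow_ne_zero 2 h1)).const_mul (2 / 3)
    have hb := (((hasDerivAt_id ρ).const_add 1).log h1).const_mul (1 / 3)
    have hc := ((((hasDerivAt_pow 2 ρ).div_const 2).sub (hasDerivAt_pow 4 ρ)).const_mul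
      (2 / 9)).const_mul κ
    convert! (ha.add hb).add hc using 1
    simp only [id_eq, Pi.pow_apply]
    push_cast
    field_simp
    ring
  · obtain ⟨h0, h1⟩ := hρ
    -- The constant is 1/4 · 2/9, the worst case κ = 1/4 of the correction.
    have h2 : 1 / 18 * (4 * ρ ^ 3 - ρ) ≤ (3 + ρ ^ 2) / (3 * (1 + ρ) ^ 3) := by
      rw [le_div_iff₀ (by positivity)]
      rcases le_total (4 * ρ ^ 3 - ρ) 0 with h | h
      · have : 1 / 18 * (4 * ρ ^ 3 - ρ) * (3 * (1 + ρ) ^ 3) ≤ 0 :=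
          mul_nonpos_of_nonpos_of_nonneg (by linarith) (by positivity)
        nlinarith
      · have h8 : (1 + ρ) ^ 3 ≤ 2 ^ 3 := by gcongr; linarith
        have := mul_le_mul_of_nonneg_left h8 h
        nlinarith [mul_nonneg (sub_nonneg.2 h1.le) (show 0 ≤ 32 * ρ ^ 2 + 26 * ρ + 18 by positivity)]
    have h3 : 0 ≤ (3 + ρ ^ 2) / (3 * (1 + ρ) ^ 3) := by positivity
    rcases le_total (4 * ρ ^ 3 - ρ) 0 with h | h
    · nlinarith [mul_nonneg hκ0 (neg_nonneg.2 h)]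
    · nlinarith [mul_le_mul_of_nonneg_right hκ1 h]
  · have hw' : 0 < ‖w‖ := norm_pos_iff.2 hw0
    have := hκ w hw
    rw [zDeriv, norm_mul] at this
    refine le_of_mul_le_mul_left (le_trans (le_of_eq ?_) this) hw'
    ring

/-- After this second integration the correction is κ(ρ² - ρ⁴)/18, which is nonnegative and can be
dropped. -/
theorem MemC3.growthBound_le {f : ℂ → ℂ} (hf : MemC3 f) {z : ℂ} (hz : z ∈ ball (0 : ℂ) 1) :
    growthBound ‖z‖ ≤ ‖f z‖ := by
  obtain ⟨κ, hκ0, hκ1, hκ⟩ := hf.exists_zDeriv_growth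
  have hle := le_norm_of_le_norm_deriv
    (Λ := fun ρ : ℝ => growthBound ρ + κ * (1 / 18 * (ρ ^ 2 - ρ ^ 4)))
    (ℓ := fun ρ : ℝ => 2 / 3 * (1 / (1 + ρ) ^ 2) + 1 / 3 * (Real.log (1 + ρ) / ρ)
      + κ * (1 / 18 * (2 * ρ - 4 * ρ ^ 3)))
    hf.differentiableOn hf.injOn hf.map_zero (by simp [growthBound_zero])
    ((continuousOn_growthBound.mono Ico_subset_Icc_self).add (by fun_prop)) (fun ρ hρ => ?_)
    (fun ρ hρ => ?_) (fun w hw hw0 => ?_) hz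
  · refine le_trans ?_ hle
    have h1 : ‖z‖ ^ 4 ≤ ‖z‖ ^ 2 :=
      pow_le_pow_of_le_one (norm_nonneg z) (mem_ball_zero_iff.1 hz).le (by norm_num)
    have : 0 ≤ κ * (1 / 18 * (‖z‖ ^ 2 - ‖z‖ ^ 4)) := mul_nonneg hκ0 (by linarith)
    simpa using this
  · have hc := (((hasDerivAt_pow 2 ρ).sub (hasDerivAt_pow 4 ρ)).const_mul (1 / 18)).const_mul κ
    convert! (hasDerivAt_growthBound hρ).add hc using 1
    simp
  · obtain ⟨h0, h1⟩ := hρ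
    have hlog : 0 ≤ Real.log (1 + ρ) / ρ := div_nonneg (Real.log_nonneg (by linarith)) h0.le
    have h2 : 1 / 4 ≤ 1 / (1 + ρ) ^ 2 := by
      apply one_div_le_one_div_of_le (by positivity)
      nlinarith
    have h3 : ρ ^ 3 ≤ 1 := pow_le_one₀ h0.le h1.le
    have h4 : -4 ≤ 2 * ρ - 4 * ρ ^ 3 := by linarith
    nlinarith [mul_le_mul_of_nonneg_left h4 hκ0]
  · have hw' : 0 < ‖w‖ := norm_pos_iff.2 hw0
    have := hκ w hw
    rw [zDeriv, norm_mul] at this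
    refine le_of_mul_le_mul_left (le_trans (le_of_eq ?_) this) hw'
    field_simp
    ring

theorem MemC3.isOpen_image {f : ℂ → ℂ} (hf : MemC3 f) : IsOpen (f '' ball 0 1) :=
  isOpen_image_of_injOn isOpen_ball hf.differentiableOn hf.injOn

theorem MemC3.frontier_image_nonempty {f : ℂ → ℂ} (hf : MemC3 f) :
    (frontier (f '' ball 0 1)).Nonempty := by
  rw [nonempty_iff_ne_empty]
  intro h
  have hc : IsClopen (f '' ball 0 1) := isClopen_iff_frontier_eq_empty.2 h
  rcases isClopen_iff.1 hc with h1 | h1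
  · exact (nonempty_ball.2 one_pos).image f |>.ne_empty h1
  · exact image_ball_ne_univ_of_injOn hf.differentiableOn hf.injOn h1

/-- A boundary point of modulus below `growthBound` ρ would be a limit of image points of such
modulus. Those come from the closed disc of radius ρ, whose image is compact, so the limit would lie
in the open image. -/
theorem MemC3.le_boundaryDist {f : ℂ → ℂ} (hf : MemC3 f) :
    1 / 3 + Real.pi ^ 2 / 36 ≤ boundaryDist f := by
  rw [boundaryDist, le_infDist hf.frontier_image_nonempty, hf.map_zero]
  intro w hw
  rw [dist_zero_left]
  by_contra! hlt
  rw [hf.isOpen_image.frontier_eq] at hw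
  have hev := tendsto_growthBound_nhdsLT_one.eventually (eventually_gt_nhds hlt)
  have hev2 : ∀ᶠ ρ in 𝓝[<] (1 : ℝ), ρ ∈ Ioo (0 : ℝ) 1 := Ioo_mem_nhdsLT zero_lt_one
  obtain ⟨ρ, hρw, hρ0, hρ1⟩ := (hev.and hev2).exists
  have hsub : ball 0 (growthBound ρ) ∩ f '' ball 0 1 ⊆ f '' closedBall 0 ρ := by
    rintro _ ⟨hv, z, hz, rfl⟩
    refine ⟨z, ?_, rfl⟩
    rw [mem_closedBall_zero_iff]
    by_contra! h
    have hz1 := mem_ball_zero_iff.1 hz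
    have h1 := monotoneOn_growthBound ⟨hρ0.le, hρ1.le⟩ ⟨norm_nonneg z, hz1.le⟩ h.le
    have h2 := hf.growthBound_le hz
    have h3 := mem_ball_zero_iff.1 hv
    linarith
  have hcl : IsClosed (f '' closedBall 0 ρ) :=
    ((isCompact_closedBall (0 : ℂ) ρ).image_of_continuousOn
      (hf.differentiableOn.continuousOn.mono (closedBall_subset_ball hρ1))).isClosed
  have hmem : w ∈ closure (ball 0 (growthBound ρ) ∩ f '' ball 0 1) :=
    isOpen_ball.inter_closure ⟨mem_ball_zero_iff.2 hρw, hw.1⟩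
  exact hw.2 (image_mono (closedBall_subset_ball hρ1) (closure_minimal hsub hcl hmem))

/-! ### Taylor coefficients and their bounds. -/

theorem hasSum_taylorCoeff {f : ℂ → ℂ} (hf : DifferentiableOn ℂ f (ball 0 1)) {z : ℂ}
    (hz : z ∈ ball (0 : ℂ) 1) : HasSum (fun n => taylorCoeff f n * z ^ n) (f z) := by
  have := Complex.hasSum_taylorSeries_on_ball hf hz
  convert! this using 1
  ext n
  rw [taylorCoeff, sub_zero, smul_eq_mul, smul_eq_mul]
  ring

theorem taylorCoeff_eq_of_hasSum {f : ℂ → ℂ} {a : ℕ → ℂ}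
    (h : ∀ z ∈ ball (0 : ℂ) 1, HasSum (fun n => a n * z ^ n) (f z)) (n : ℕ) :
    taylorCoeff f n = a n := by
  have h1 : HasFPowerSeriesAt f (FormalMultilinearSeries.ofScalars ℂ a) 0 := by
    rw [hasFPowerSeriesAt_iff]
    filter_upwards [ball_mem_nhds (0 : ℂ) one_pos] with z hz
    simpa [FormalMultilinearSeries.coeff_ofScalars, mul_comm] using h z hz
  have h2 := h1.eq_formalMultilinearSeries h1.analyticAt.hasFPowerSeriesAt
  have h3 := congrFun (FormalMultilinearSeries.ofScalars_series_injective ℂ ℂ h2) n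
  rw [h3, taylorCoeff]

theorem summable_norm_taylorCoeff {f : ℂ → ℂ} (hf : DifferentiableOn ℂ f (ball 0 1)) {z : ℂ}
    (hz : z ∈ ball (0 : ℂ) 1) : Summable fun n => ‖taylorCoeff f n * z ^ n‖ :=
  (hasSum_taylorCoeff hf hz).summable.norm

theorem taylorCoeff_zero (f : ℂ → ℂ) : taylorCoeff f 0 = f 0 := by
  simp [taylorCoeff]

theorem taylorCoeff_deriv (f : ℂ → ℂ) (n : ℕ) :
    taylorCoeff (deriv f) n = (n + 1) * taylorCoeff f (n + 1) := by
  have h1 : (n.factorial : ℂ) ≠ 0 := by exact_mod_cast n.factorial_ne_zero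
  have h2 : (n : ℂ) + 1 ≠ 0 := Nat.cast_add_one_ne_zero n
  rw [taylorCoeff, taylorCoeff, iteratedDeriv_succ', Nat.factorial_succ]
  push_cast
  field_simp

theorem taylorCoeff_zDeriv {f : ℂ → ℂ} (hf : DifferentiableOn ℂ f (ball 0 1)) (n : ℕ) :
    taylorCoeff (zDeriv f) n = n * taylorCoeff f n := by
  refine taylorCoeff_eq_of_hasSum (a := fun n => n * taylorCoeff f n) (fun z hz => ?_) n
  have h := (hasSum_taylorCoeff (hf.deriv isOpen_ball) hz).mul_left z
  rw [← hasSum_nat_add_iff' 1]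
  simp only [Finset.sum_range_one, Nat.cast_zero, zero_mul, sub_zero]
  convert! h using 1
  ext n
  rw [taylorCoeff_deriv, pow_succ]
  push_cast
  ring

theorem taylorCoeff_mul {f g : ℂ → ℂ} (hf : DifferentiableOn ℂ f (ball 0 1))
    (hg : DifferentiableOn ℂ g (ball 0 1)) (n : ℕ) :
    taylorCoeff (fun z => f z * g z) n =
      ∑ k ∈ Finset.range (n + 1), taylorCoeff f k * taylorCoeff g (n - k) := by
  refine taylorCoeff_eq_of_hasSum
    (a := fun n => ∑ k ∈ Finset.range (n + 1), taylorCoeff f k * taylorCoeff g (n - k))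
    (fun z hz => ?_) n
  have h := hasSum_sum_range_mul_of_summable_norm (summable_norm_taylorCoeff hf hz)
    (summable_norm_taylorCoeff hg hz)
  rw [(hasSum_taylorCoeff hf hz).tsum_eq, (hasSum_taylorCoeff hg hz).tsum_eq] at h
  convert! h using 1
  ext n
  rw [Finset.sum_mul]
  refine Finset.sum_congr rfl fun k hk => ?_
  have : n = k + (n - k) := by have := Finset.mem_range.1 hk; omega
  conv_lhs => rw [this, pow_add]
  simp only [add_tsub_cancel_left]
  ring

theorem taylorCoeff_congr {f g : ℂ → ℂ} (h : EqOn f g (ball 0 1)) (n : ℕ) :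
    taylorCoeff f n = taylorCoeff g n := by
  rw [taylorCoeff, taylorCoeff,
    (h.eventuallyEq_of_mem (ball_mem_nhds (0 : ℂ) one_pos)).iteratedDeriv_eq]

theorem norm_taylorCoeff_le_of_convex {g : ℂ → ℂ}
    (hg : DifferentiableOn ℂ g (ball 0 1)) (hinj : InjOn g (ball 0 1))
    (hconv : Convex ℝ (g '' ball 0 1)) {n : ℕ} (hn : 0 < n) :
    ‖taylorCoeff g n‖ ≤ ‖deriv g 0‖ :=
  norm_taylorCoeff_le_of_subordinate_convex hg hinj hconv hg (mapsTo_image _ _) rfl hn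

theorem one_sub_ne_zero_of_mem_ball {z : ℂ} (hz : z ∈ ball (0 : ℂ) 1) : 1 - z ≠ 0 := by
  intro h
  rw [mem_ball_zero_iff, ← sub_eq_zero.1 h, norm_one] at hz
  exact lt_irrefl _ hz

theorem image_inv_one_sub_ball :
    (fun z : ℂ => (1 - z)⁻¹) '' ball 0 1 = {w : ℂ | 1 / 2 < w.re} := by
  have key : ∀ w : ℂ, ‖w - 1‖ < ‖w‖ ↔ 1 / 2 < w.re := fun w => by
    rw [← sq_lt_sq₀ (norm_nonneg _) (norm_nonneg _), ← Complex.normSq_eq_norm_sq,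
      ← Complex.normSq_eq_norm_sq, Complex.normSq_apply, Complex.normSq_apply]
    simp only [Complex.sub_re, Complex.one_re, Complex.sub_im, Complex.one_im]
    constructor <;> intro h <;> nlinarith
  ext w
  simp only [mem_image, mem_ball_zero_iff, mem_ofPred_eq]
  rw [← key]
  constructor
  · rintro ⟨z, hz, rfl⟩
    have h0 := one_sub_ne_zero_of_mem_ball (mem_ball_zero_iff.2 hz)
    have : (1 - z)⁻¹ - 1 = z * (1 - z)⁻¹ := by field_simp; ring
    rw [this, norm_mul]
    have := norm_pos_iff.2 (inv_ne_zero h0)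
    nlinarith
  · intro h
    have hw : w ≠ 0 := fun h0 => by simp [h0] at h; linarith
    refine ⟨1 - w⁻¹, ?_, by simp⟩
    have : 1 - w⁻¹ = (w - 1) / w := by field_simp
    rw [this, norm_div, div_lt_one (norm_pos_iff.2 hw)]
    exact h

theorem injOn_inv_one_sub : InjOn (fun z : ℂ => (1 - z)⁻¹) (ball 0 1) := fun x _ y _ h => by
  have := inv_injective h
  linear_combination -this

theorem hasDerivAt_inv_one_sub {z : ℂ} (hz : z ∈ ball (0 : ℂ) 1) :
    HasDerivAt (fun z : ℂ => (1 - z)⁻¹) (1 / (1 - z) ^ 2) z := by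
  convert! ((hasDerivAt_id z).const_sub 1).inv (one_sub_ne_zero_of_mem_ball hz) using 1
  simp

/-- Here p is subordinate to c/(1 - z) - conj p(0), c = 2 Re p(0), which maps the disc onto the
right half-plane and has derivative c at 0. -/
theorem norm_taylorCoeff_le_of_re_pos {p : ℂ → ℂ} (hp : DifferentiableOn ℂ p (ball 0 1))
    (hre : ∀ z ∈ ball (0 : ℂ) 1, 0 < (p z).re) {n : ℕ} (hn : 0 < n) :
    ‖taylorCoeff p n‖ ≤ 2 * (p 0).re := by
  set c : ℝ := 2 * (p 0).re with hc
  have h0 : (0 : ℂ) ∈ ball (0 : ℂ) 1 := mem_ball_self one_pos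
  have hc0 : 0 < c := by linarith [hre 0 h0]
  set d : ℂ := (starRingEnd ℂ) (p 0)
  have hcd : (c : ℂ) = p 0 + d := by
    rw [Complex.add_conj, hc]
  have hd : ∀ z ∈ ball (0 : ℂ) 1,
      HasDerivAt (fun z : ℂ => (c : ℂ) * (1 - z)⁻¹ - d) (c * (1 / (1 - z) ^ 2)) z :=
    fun z hz => ((hasDerivAt_inv_one_sub hz).const_mul _).sub_const _
  have him : (fun z : ℂ => (c : ℂ) * (1 - z)⁻¹ - d) '' ball 0 1 = {w : ℂ | 0 < w.re} := by
    have := image_image (fun w : ℂ => (c : ℂ) * w - d) (fun z : ℂ => (1 - z)⁻¹) (ball 0 1)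
    rw [← this, image_inv_one_sub_ball]
    have hdre : d.re = c / 2 := by rw [hc, Complex.conj_re]; ring
    ext w
    simp only [mem_image, mem_ofPred_eq]
    constructor
    · rintro ⟨v, hv, rfl⟩
      rw [Complex.sub_re, Complex.re_ofReal_mul, hdre]
      nlinarith
    · intro hw
      refine ⟨((c⁻¹ : ℝ) : ℂ) * (w + d), ?_, ?_⟩
      · rw [Complex.re_ofReal_mul, Complex.add_re, hdre, inv_mul_eq_div, lt_div_iff₀ hc0]
        linarith
      · have : (c : ℂ) ≠ 0 := Complex.ofReal_ne_zero.2 hc0.ne'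
        push_cast
        field_simp
        ring
  have h := norm_taylorCoeff_le_of_subordinate_convex
    (g := fun z : ℂ => (c : ℂ) * (1 - z)⁻¹ - d) (h := p) (n := n)
    (fun z hz => (hd z hz).differentiableAt.differentiableWithinAt)
    (fun x hx y hy h => injOn_inv_one_sub hx hy
      (mul_left_cancel₀ (Complex.ofReal_ne_zero.2 hc0.ne') (sub_left_inj.1 h)))
    (him ▸ convex_halfSpace_re_gt 0) hp (fun z hz => him ▸ hre z hz)
    (by simp only [sub_zero, inv_one, mul_one, hcd]; ring) hn
  rw [(hd 0 h0).deriv, sub_zero, one_pow, div_one, mul_one, Complex.norm_real, Real.norm_eq_abs,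
    abs_of_pos hc0] at h
  exact h

theorem sum_range_sq_succ (n : ℕ) :
    ∑ k ∈ Finset.range (n + 1), ((k : ℝ) + 1) ^ 2
      = ((n : ℝ) + 1) * (n + 2) * (2 * n + 3) / 6 := by
  induction n with
  | zero => norm_num
  | succ n ih =>
    rw [Finset.sum_range_succ, ih]
    push_cast
    ring

theorem MemC3.norm_taylorCoeff_le {f : ℂ → ℂ} (hf : MemC3 f) (n : ℕ) :
    ‖taylorCoeff f (n + 1)‖ ≤ 2 / 3 + 1 / (3 * ((n : ℝ) + 1) ^ 2) := by
  obtain ⟨g, hg, hg1, hre⟩ := hf.exists_convex_norm_deriv_eq_one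
  have h0 : (0 : ℂ) ∈ ball (0 : ℂ) 1 := mem_ball_self one_pos
  have hF1 := differentiableOn_zDeriv hf.differentiableOn
  have hF2 := differentiableOn_zDeriv hF1
  have hG := differentiableOn_zDeriv hg.differentiableOn
  have hG0 : ∀ z ∈ ball (0 : ℂ) 1, deriv (zDeriv g) z ≠ 0 := fun z hz h => by
    have := hre z hz
    simp [h] at this
  set p : ℂ → ℂ := fun z => deriv (zDeriv (zDeriv f)) z / deriv (zDeriv g) z with hp
  have hpd : DifferentiableOn ℂ p (ball 0 1) :=
    (hF2.deriv isOpen_ball).div (hG.deriv isOpen_ball) hG0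
  have ha : ∀ m, taylorCoeff (deriv (zDeriv (zDeriv f))) m
      = ((m : ℂ) + 1) ^ 3 * taylorCoeff f (m + 1) := fun m => by
    rw [taylorCoeff_deriv, taylorCoeff_zDeriv hF1, taylorCoeff_zDeriv hf.differentiableOn]
    push_cast
    ring
  have hb : ∀ m, taylorCoeff (deriv (zDeriv g)) m
      = ((m : ℂ) + 1) ^ 2 * taylorCoeff g (m + 1) := fun m => by
    rw [taylorCoeff_deriv, taylorCoeff_zDeriv hg.differentiableOn]
    push_cast
    ring
  have hbn : ∀ m, ‖taylorCoeff (deriv (zDeriv g)) m‖ ≤ ((m : ℝ) + 1) ^ 2 := fun m => by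
    have := norm_taylorCoeff_le_of_convex hg.differentiableOn hg.injOn hg.convex_image
      (Nat.succ_pos m)
    rw [hg1] at this
    rw [hb, norm_mul, norm_pow, norm_natCast_add_one]
    exact mul_le_of_le_one_right (by positivity) this
  have hp0 : ‖p 0‖ = 1 := by
    have h1 := ha 0
    have h2 := hb 0
    rw [taylorCoeff_zero] at h1 h2
    have h3 : taylorCoeff f 1 = 1 := by simp [taylorCoeff, iteratedDeriv_one, hf.deriv_zero]
    have h4 : taylorCoeff g 1 = deriv g 0 := by simp [taylorCoeff, iteratedDeriv_one]
    rw [hp]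
    simp only [h1, h2, zero_add, h3, h4]
    simp [hg1]
  have hpn : ∀ m, 0 < m → ‖taylorCoeff p m‖ ≤ 2 := fun m hm => by
    have h1 := norm_taylorCoeff_le_of_re_pos hpd hre hm
    have h2 := (p 0).re_le_norm
    linarith
  have hprod : taylorCoeff (deriv (zDeriv (zDeriv f))) n
      = ∑ k ∈ Finset.range (n + 1),
        taylorCoeff (deriv (zDeriv g)) k * taylorCoeff p (n - k) := by
    rw [← taylorCoeff_mul (hG.deriv isOpen_ball) hpd]
    exact taylorCoeff_congr (fun z hz => (mul_div_cancel₀ _ (hG0 z hz)).symm) n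
  -- The last term of the convolution contains p(0), of modulus 1 and not 2, which saves (n + 1)².
  have hle : ‖taylorCoeff (deriv (zDeriv (zDeriv f))) n‖
      ≤ 2 * (((n : ℝ) + 1) * (n + 2) * (2 * n + 3) / 6) - ((n : ℝ) + 1) ^ 2 := by
    rw [hprod, ← sum_range_sq_succ, Finset.sum_range_succ, Finset.sum_range_succ]
    refine (norm_add_le _ _).trans ?_
    have h1 : ‖∑ k ∈ Finset.range n, taylorCoeff (deriv (zDeriv g)) k * taylorCoeff p (n - k)‖
        ≤ 2 * ∑ k ∈ Finset.range n, ((k : ℝ) + 1) ^ 2 := by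
      rw [Finset.mul_sum]
      refine norm_sum_le_of_le _ fun k hk => ?_
      rw [norm_mul, mul_comm]
      exact mul_le_mul (hpn _ (Nat.sub_pos_of_lt (Finset.mem_range.1 hk))) (hbn k)
        (norm_nonneg _) zero_le_two
    have h2 : ‖taylorCoeff (deriv (zDeriv g)) n * taylorCoeff p (n - n)‖
        ≤ ((n : ℝ) + 1) ^ 2 := by
      rw [Nat.sub_self, taylorCoeff_zero, norm_mul, hp0, mul_one]
      exact hbn n
    linarith
  rw [ha, norm_mul, norm_pow, norm_natCast_add_one] at hle
  have hn : (0 : ℝ) < (n : ℝ) + 1 := Nat.cast_add_one_pos n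
  refine le_of_mul_le_mul_left (hle.trans (le_of_eq ?_)) (pow_pos hn 3)
  field_simp
  ring

/-! ### Bounding and evaluating the Bohr sum. -/

theorem hasSum_coeffBound {r : ℝ} (hr0 : 0 ≤ r) (hr : r < 1) :
    HasSum (fun n : ℕ => (2 / 3 + 1 / (3 * ((n : ℝ) + 1) ^ 2)) * r ^ (n + 1))
      (2 / 3 * (r / (1 - r)) + 1 / 3 * dilog r) := by
  have h1 := ((hasSum_geometric_of_lt_one hr0 hr).mul_left r).mul_left (2 / 3)
  have h2 := (hasSum_dilog (𝕜 := ℝ) (x := r) (by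
    rw [Real.norm_eq_abs, abs_of_nonneg hr0]; exact hr.le)).mul_left (1 / 3)
  convert! h1.add h2 using 1
  ext n
  have : (n : ℝ) + 1 ≠ 0 := Nat.cast_add_one_ne_zero n
  field_simp
  ring

theorem hasSum_succ_mul_coeffBound {r : ℝ} (hr0 : 0 ≤ r) (hr : r < 1) :
    HasSum (fun n : ℕ => ((n : ℝ) + 1) * ((2 / 3 + 1 / (3 * ((n : ℝ) + 1) ^ 2)) * r ^ (n + 1)))
      (2 / 3 * (r / (1 - r) ^ 2) - 1 / 3 * Real.log (1 - r)) := by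
  have hr' : ‖r‖ < 1 := by rwa [Real.norm_eq_abs, abs_of_nonneg hr0]
  have h0 := (hasSum_nat_add_iff' (f := fun n : ℕ => (n : ℝ) * r ^ n) 1).2
    (hasSum_coe_mul_geometric_of_norm_lt_one hr')
  have h1 := h0.mul_left (2 / 3)
  have h2 := (Real.hasSum_pow_div_log_of_abs_lt_one (x := r) hr').mul_left (1 / 3)
  convert! h1.add h2 using 1
  · ext n
    have : (n : ℝ) + 1 ≠ 0 := Nat.cast_add_one_ne_zero n
    push_cast
    field_simp
  · simp
    ring

theorem hasSum_coeffBound_tail {r : ℝ} (hr0 : 0 ≤ r) (hr : r < 1) :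
    HasSum (fun n : ℕ => (2 / 3 + 1 / (3 * ((n : ℝ) + 2) ^ 2)) * r ^ (n + 2))
      (2 / 3 * (r / (1 - r)) + 1 / 3 * dilog r - r) := by
  have h := (hasSum_nat_add_iff' 1).2 (hasSum_coeffBound hr0 hr)
  convert! h using 1
  · ext n
    push_cast
    ring_nf
  · norm_num

/-- The three brackets are the majorants of |f|, of |zf'| and of the tail of absolute values. -/
theorem radiusFun_add_eq {r : ℝ} (hr0 : 0 ≤ r) (hr : r < 1) :
    (2 / 3 * (r / (1 - r)) + 1 / 3 * dilog r)
      + (2 / 3 * (r / (1 - r) ^ 2) - 1 / 3 * Real.log (1 - r))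
      + (2 / 3 * (r / (1 - r)) + 1 / 3 * dilog r - r)
      = radiusFun r + (1 / 3 + Real.pi ^ 2 / 36) := by
  rw [radiusFun_eq hr0 hr]
  have : 1 - r ≠ 0 := by linarith
  field_simp
  ring

theorem norm_mul_norm_deriv (f : ℂ → ℂ) (z : ℂ) : ‖deriv f z‖ * ‖z‖ = ‖zDeriv f z‖ := by
  rw [zDeriv, norm_mul, mul_comm]

theorem norm_le_of_norm_taylorCoeff_le {f : ℂ → ℂ} (hf : DifferentiableOn ℂ f (ball 0 1))
    (h0 : f 0 = 0) {z : ℂ} (hz : z ∈ ball (0 : ℂ) 1) {b : ℕ → ℝ} {s : ℝ}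
    (hb : ∀ n, ‖taylorCoeff f (n + 1) * z ^ (n + 1)‖ ≤ b n) (hs : HasSum b s) : ‖f z‖ ≤ s := by
  have h := (hasSum_nat_add_iff' 1).2 (hasSum_taylorCoeff hf hz)
  simp only [Finset.sum_range_one, pow_zero, mul_one, taylorCoeff_zero, h0, sub_zero] at h
  rw [← h.tsum_eq, ← hs.tsum_eq]
  exact tsum_of_norm_bounded hs hb |>.trans_eq hs.tsum_eq.symm

theorem MemC3.norm_taylorCoeff_mul_pow_le {f : ℂ → ℂ} (hf : MemC3 f) (z : ℂ) (n : ℕ) :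
    ‖taylorCoeff f (n + 1) * z ^ (n + 1)‖
      ≤ (2 / 3 + 1 / (3 * ((n : ℝ) + 1) ^ 2)) * ‖z‖ ^ (n + 1) := by
  rw [norm_mul, norm_pow]
  exact mul_le_mul_of_nonneg_right (hf.norm_taylorCoeff_le n) (by positivity)

theorem MemC3.bohrSum_le {f : ℂ → ℂ} (hf : MemC3 f) {z : ℂ} (hz : z ∈ ball (0 : ℂ) 1) :
    bohrSum f z ≤ radiusFun ‖z‖ + (1 / 3 + Real.pi ^ 2 / 36) := by
  have hz1 := mem_ball_zero_iff.1 hz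
  rw [bohrSum, norm_mul_norm_deriv, ← radiusFun_add_eq (norm_nonneg z) hz1]
  have h1 := norm_le_of_norm_taylorCoeff_le hf.differentiableOn hf.map_zero hz
    (hf.norm_taylorCoeff_mul_pow_le z) (hasSum_coeffBound (norm_nonneg z) hz1)
  have h2 := norm_le_of_norm_taylorCoeff_le (differentiableOn_zDeriv hf.differentiableOn)
    (by simp [zDeriv]) hz (fun n => ?_) (hasSum_succ_mul_coeffBound (norm_nonneg z) hz1)
  · have h3 : ∑' n : ℕ, ‖taylorCoeff f (n + 2) * z ^ (n + 2)‖
        ≤ 2 / 3 * (‖z‖ / (1 - ‖z‖)) + 1 / 3 * dilog ‖z‖ - ‖z‖ := by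
      have hs := hasSum_coeffBound_tail (norm_nonneg z) hz1
      have ht := (summable_nat_add_iff 2).2 (summable_norm_taylorCoeff hf.differentiableOn hz)
      refine hasSum_le (fun n => ?_) ht.hasSum hs
      refine (hf.norm_taylorCoeff_mul_pow_le z (n + 1)).trans_eq ?_
      push_cast
      ring_nf
    linarith
  · rw [taylorCoeff_zDeriv hf.differentiableOn, mul_assoc, norm_mul, RCLike.norm_natCast,
      Nat.cast_succ]
    exact mul_le_mul_of_nonneg_left (hf.norm_taylorCoeff_mul_pow_le z n) (by positivity)

theorem bohrSum_eq_of_taylorCoeff {f : ℂ → ℂ} (hf : DifferentiableOn ℂ f (ball 0 1))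
    (h0 : f 0 = 0)
    (hc : ∀ n : ℕ, taylorCoeff f (n + 1) = ((2 / 3 + 1 / (3 * ((n : ℝ) + 1) ^ 2) : ℝ) : ℂ))
    {r : ℝ} (hr : r ∈ Ioo (0 : ℝ) 1) :
    bohrSum f r = radiusFun r + (1 / 3 + Real.pi ^ 2 / 36) := by
  obtain ⟨hr0, hr1⟩ := hr
  have hz : (r : ℂ) ∈ ball (0 : ℂ) 1 := by
    rw [mem_ball_zero_iff, Complex.norm_real, Real.norm_eq_abs, abs_of_pos hr0]; exact hr1
  have norm_eq : ∀ {h : ℂ → ℂ} {b : ℕ → ℝ} {s : ℝ}, DifferentiableOn ℂ h (ball 0 1) → h 0 = 0 →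
      (∀ n, taylorCoeff h (n + 1) * (r : ℂ) ^ (n + 1) = ((b n : ℝ) : ℂ)) → (∀ n, 0 ≤ b n) →
      HasSum b s → ‖h r‖ = s := by
    intro h b s hh hh0 hb hb0 hs
    have h1 := (hasSum_nat_add_iff' 1).2 (hasSum_taylorCoeff hh hz)
    simp only [Finset.sum_range_one, pow_zero, mul_one, taylorCoeff_zero, hh0, sub_zero, hb] at h1
    have h2 := h1.unique (Complex.hasSum_ofReal.2 hs)
    rw [h2, Complex.norm_real, Real.norm_eq_abs, abs_of_nonneg (hs.nonneg hb0)]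
  rw [bohrSum, norm_mul_norm_deriv, ← radiusFun_add_eq hr0.le hr1]
  congr 1
  · congr 1
    · refine norm_eq hf h0 (fun n => ?_) (fun n => ?_) (hasSum_coeffBound hr0.le hr1)
      · rw [hc]
        push_cast
        ring
      · positivity
    · refine norm_eq (differentiableOn_zDeriv hf) (by simp [zDeriv]) (fun n => ?_) (fun n => ?_)
        (hasSum_succ_mul_coeffBound hr0.le hr1)
      · rw [taylorCoeff_zDeriv hf, hc]
        push_cast
        ring
      · positivity
  · rw [← (hasSum_coeffBound_tail hr0.le hr1).tsum_eq]
    refine tsum_congr fun n => ?_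
    rw [show n + 2 = (n + 1) + 1 from rfl, hc, ← Complex.ofReal_pow, ← Complex.ofReal_mul,
      Complex.norm_real, Real.norm_eq_abs, abs_of_nonneg (by positivity)]
    push_cast
    ring_nf

/-! ### The extremal function. -/

/-- The extremal function `∑ (2/3 + 1/(3n²)) zⁿ`. -/
noncomputable def extremalFun (z : ℂ) : ℂ := 2 / 3 * (z / (1 - z)) + 1 / 3 * dilog z

theorem hasDerivAt_div_one_sub {z : ℂ} (hz : z ∈ ball (0 : ℂ) 1) :
    HasDerivAt (fun z : ℂ => z / (1 - z)) (1 / (1 - z) ^ 2) z := by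
  have h := one_sub_ne_zero_of_mem_ball hz
  convert! (hasDerivAt_id z).div ((hasDerivAt_id z).const_sub 1) h using 1
  simp

theorem isConvexFunction_div_one_sub : IsConvexFunction fun z : ℂ => z / (1 - z) where
  differentiableOn := fun z hz =>
    (hasDerivAt_div_one_sub hz).differentiableAt.differentiableWithinAt
  injOn := fun x hx y hy h => by
    have h1 := one_sub_ne_zero_of_mem_ball hx
    have h2 := one_sub_ne_zero_of_mem_ball hy
    simp only at h
    rw [div_eq_div_iff h1 h2] at h
    linear_combination h
  convex_image := by
    have h : (fun z : ℂ => z / (1 - z)) '' ball 0 1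
        = (fun w : ℂ => -1 + w) '' ((fun z : ℂ => (1 - z)⁻¹) '' ball 0 1) := by
      rw [image_image]
      refine image_congr fun z hz => ?_
      have := one_sub_ne_zero_of_mem_ball hz
      field_simp
      ring
    rw [h, image_inv_one_sub_ball]
    exact (convex_halfSpace_re_gt _).translate (-1)
  map_zero := by simp
  re_deriv_pos := by
    rw [(hasDerivAt_div_one_sub (mem_ball_self one_pos)).deriv]
    simp

theorem deriv_zDeriv_div_one_sub {z : ℂ} (hz : z ∈ ball (0 : ℂ) 1) :
    deriv (zDeriv fun z : ℂ => z / (1 - z)) z = (1 + z) / (1 - z) ^ 3 := by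
  have heq : zDeriv (fun z : ℂ => z / (1 - z)) =ᶠ[𝓝 z] fun z => z * (1 / (1 - z) ^ 2) := by
    filter_upwards [isOpen_ball.mem_nhds hz] with w hw
    rw [zDeriv, (hasDerivAt_div_one_sub hw).deriv]
  have h := one_sub_ne_zero_of_mem_ball hz
  have hd := (hasDerivAt_id z).mul ((hasDerivAt_const z (1 : ℂ)).div
    (((hasDerivAt_id z).const_sub 1).pow 2) (pow_ne_zero 2 h))
  rw [heq.deriv_eq]
  refine HasDerivAt.deriv ?_
  convert! hd using 1
  simp only [id_eq, Pi.pow_apply, Pi.div_apply]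
  field_simp
  ring

theorem hasSum_extremalFun {z : ℂ} (hz : z ∈ ball (0 : ℂ) 1) :
    HasSum (fun n : ℕ => (2 / 3 + 1 / (3 * ((n : ℂ) + 1) ^ 2)) * z ^ (n + 1)) (extremalFun z) := by
  have hz1 := mem_ball_zero_iff.1 hz
  have h1 := ((hasSum_geometric_of_norm_lt_one hz1).mul_left z).mul_left (2 / 3)
  have h2 := (hasSum_dilog hz1.le).mul_left (1 / 3)
  convert! h1.add h2 using 1
  ext n
  have : (n : ℂ) + 1 ≠ 0 := Nat.cast_add_one_ne_zero n
  field_simp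
  ring

theorem taylorCoeff_extremalFun (n : ℕ) :
    taylorCoeff extremalFun (n + 1) = ((2 / 3 + 1 / (3 * ((n : ℝ) + 1) ^ 2) : ℝ) : ℂ) := by
  rw [taylorCoeff_eq_of_hasSum
    -- The case n = 0 is separate because division by zero would make the formula give 2/3 there.
    (a := fun n : ℕ => if n = 0 then 0 else (2 / 3 + 1 / (3 * (n : ℂ) ^ 2)))]
  · simp
  · intro z hz
    rw [← hasSum_nat_add_iff' 1]
    simpa using hasSum_extremalFun hz

theorem extremalFun_zero : extremalFun 0 = 0 := by simp [extremalFun]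

theorem exists_hasDerivAt_extremalFun {z : ℂ} (hz : z ∈ ball (0 : ℂ) 1) :
    ∃ d : ℂ, z * d = 2 / 3 * (z / (1 - z) ^ 2) - 1 / 3 * Complex.log (1 - z) ∧
      HasDerivAt extremalFun d z := by
  obtain ⟨d, hd, hd'⟩ := hasDerivAt_dilog_complex (mem_ball_zero_iff.1 hz)
  refine ⟨_, ?_, ((hasDerivAt_div_one_sub hz).const_mul (2 / 3)).add (hd'.const_mul (1 / 3))⟩
  linear_combination (1 / 3) * hd

theorem differentiableOn_extremalFun : DifferentiableOn ℂ extremalFun (ball 0 1) := fun _ hz =>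
  let ⟨_, _, h⟩ := exists_hasDerivAt_extremalFun hz
  h.differentiableAt.differentiableWithinAt

theorem zDeriv_extremalFun {z : ℂ} (hz : z ∈ ball (0 : ℂ) 1) :
    zDeriv extremalFun z = 2 / 3 * (z / (1 - z) ^ 2) - 1 / 3 * Complex.log (1 - z) := by
  obtain ⟨d, hd, h⟩ := exists_hasDerivAt_extremalFun hz
  rw [zDeriv, h.deriv, hd]

theorem one_sub_mem_slitPlane {z : ℂ} (hz : z ∈ ball (0 : ℂ) 1) : 1 - z ∈ Complex.slitPlane := by
  left
  have h1 := z.re_le_norm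
  have h2 := mem_ball_zero_iff.1 hz
  rw [Complex.sub_re, Complex.one_re]
  linarith

theorem zDeriv_zDeriv_extremalFun {z : ℂ} (hz : z ∈ ball (0 : ℂ) 1) :
    zDeriv (zDeriv extremalFun) z
      = 2 / 3 * (z * (1 + z) / (1 - z) ^ 3) + 1 / 3 * (z / (1 - z)) := by
  have h := one_sub_ne_zero_of_mem_ball hz
  have heq : zDeriv extremalFun =ᶠ[𝓝 z]
      fun z => 2 / 3 * (z / (1 - z) ^ 2) - 1 / 3 * Complex.log (1 - z) := by
    filter_upwards [isOpen_ball.mem_nhds hz] with w hw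
    exact zDeriv_extremalFun hw
  have ha := ((hasDerivAt_id z).div (((hasDerivAt_id z).const_sub 1).pow 2)
    (pow_ne_zero 2 h)).const_mul (2 / 3)
  have hb := (((hasDerivAt_id z).const_sub 1).clog (one_sub_mem_slitPlane hz)).const_mul (1 / 3)
  have hd : HasDerivAt (fun z => 2 / 3 * (z / (1 - z) ^ 2) - 1 / 3 * Complex.log (1 - z)) _ z :=
    ha.sub hb
  rw [zDeriv, heq.deriv_eq, hd.deriv]
  simp only [id_eq, Pi.pow_apply]
  field_simp
  ring

theorem deriv_zDeriv_zDeriv_extremalFun {z : ℂ} (hz : z ∈ ball (0 : ℂ) 1) :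
    deriv (zDeriv (zDeriv extremalFun)) z = (1 + z) ^ 2 / (1 - z) ^ 4 := by
  have h := one_sub_ne_zero_of_mem_ball hz
  have heq : zDeriv (zDeriv extremalFun) =ᶠ[𝓝 z]
      fun z => 2 / 3 * (z * (1 + z) / (1 - z) ^ 3) + 1 / 3 * (z / (1 - z)) := by
    filter_upwards [isOpen_ball.mem_nhds hz] with w hw
    exact zDeriv_zDeriv_extremalFun hw
  have ha := (((hasDerivAt_id z).mul ((hasDerivAt_id z).const_add 1)).div
    (((hasDerivAt_id z).const_sub 1).pow 3) (pow_ne_zero 3 h)).const_mul (2 / 3)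
  have hb := (hasDerivAt_div_one_sub hz).const_mul (1 / 3)
  rw [heq.deriv_eq]
  refine HasDerivAt.deriv ?_
  convert! ha.add hb using 1
  simp only [id_eq, Pi.pow_apply, Pi.mul_apply]
  field_simp
  ring

theorem memC3_extremalFun : MemC3 extremalFun where
  differentiableOn := differentiableOn_extremalFun
  map_zero := extremalFun_zero
  deriv_zero := by
    have h := taylorCoeff_extremalFun 0
    simp [taylorCoeff, iteratedDeriv_one] at h
    rw [h]
    norm_num
  exists_convex := by
    refine ⟨_, isConvexFunction_div_one_sub, fun z hz => ?_⟩
    have h := one_sub_ne_zero_of_mem_ball hz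
    have h1 : 1 + z ≠ 0 := by
      have := one_sub_ne_zero_of_mem_ball (z := -z)
        (by rwa [mem_ball_zero_iff, norm_neg, ← mem_ball_zero_iff])
      rwa [sub_neg_eq_add] at this
    rw [deriv_zDeriv_zDeriv_extremalFun hz, deriv_zDeriv_div_one_sub hz]
    -- The quotient is (1 + z)/(1 - z), the half-plane map itself.
    have heq : (1 + z) ^ 2 / (1 - z) ^ 4 / ((1 + z) / (1 - z) ^ 3)
        = ((2 : ℝ) : ℂ) * (1 - z)⁻¹ - 1 := by
      push_cast
      field_simp
      ring
    have hmem : (1 - z)⁻¹ ∈ {w : ℂ | 1 / 2 < w.re} :=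
      image_inv_one_sub_ball ▸ mem_image_of_mem _ hz
    have hmem' : 1 / 2 < ((1 - z)⁻¹).re := hmem
    rw [heq, Complex.sub_re, Complex.re_ofReal_mul, Complex.one_re]
    linarith

theorem dilog_ofReal (x : ℝ) : dilog (x : ℂ) = ((dilog x : ℝ) : ℂ) := by
  rw [dilog, dilog, Complex.ofReal_tsum]
  push_cast
  rfl

theorem extremalFun_neg_ofReal (r : ℝ) : extremalFun (-(r : ℂ)) = ((-growthBound r : ℝ) : ℂ) := by
  rw [extremalFun, growthBound, ← Complex.ofReal_neg, dilog_ofReal]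
  push_cast
  ring

theorem boundaryDist_extremalFun :
    boundaryDist extremalFun = 1 / 3 + Real.pi ^ 2 / 36 := by
  refine le_antisymm ?_ memC3_extremalFun.le_boundaryDist
  set D : ℝ := 1 / 3 + Real.pi ^ 2 / 36 with hD
  have hD0 : 0 < D := by positivity
  have hev : ∀ ρ < 1, ∀ᶠ r in 𝓝[<] (1 : ℝ), r ∈ Ioo (max ρ 0) 1 := fun ρ hρ =>
    Ioo_mem_nhdsLT (max_lt hρ zero_lt_one)
  have hball : ∀ r ∈ Ioo (0 : ℝ) 1, -(r : ℂ) ∈ ball (0 : ℂ) 1 := fun r hr => by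
    rw [mem_ball_zero_iff, norm_neg, Complex.norm_real, Real.norm_eq_abs, abs_of_pos hr.1]
    exact hr.2
  have ht : Tendsto (fun r : ℝ => extremalFun (-(r : ℂ))) (𝓝[<] 1) (𝓝 (-(D : ℂ))) := by
    simp_rw [extremalFun_neg_ofReal]
    have := (Complex.continuous_ofReal.tendsto (-D)).comp tendsto_growthBound_nhdsLT_one.neg
    rw [← Complex.ofReal_neg]
    exact this
  have hfr : -(D : ℂ) ∈ frontier (extremalFun '' ball 0 1) := by
    rw [memC3_extremalFun.isOpen_image.frontier_eq]
    refine ⟨mem_closure_of_tendsto ht ?_, ?_⟩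
    · filter_upwards [hev 0 zero_lt_one] with r hr
      exact mem_image_of_mem _ (hball r (by simpa using hr))
    -- If -D were a value at some |z| < ρ, openness would make F(-r), for r near 1, a value on the
    -- disc of radius ρ as well, contradicting injectivity.
    · rintro ⟨z, hz, hzD⟩
      obtain ⟨ρ, hzρ, hρ⟩ := exists_between (mem_ball_zero_iff.1 hz)
      have hsub : ball (0 : ℂ) ρ ⊆ ball 0 1 := ball_subset_ball hρ.le
      have hop : IsOpen (extremalFun '' ball 0 ρ) :=
        isOpen_image_of_injOn isOpen_ball (differentiableOn_extremalFun.mono hsub)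
          (memC3_extremalFun.injOn.mono hsub)
      have hmem : -(D : ℂ) ∈ extremalFun '' ball 0 ρ := ⟨z, mem_ball_zero_iff.2 hzρ, hzD⟩
      obtain ⟨r, ⟨v, hv, hvr⟩, hr⟩ :=
        ((ht.eventually (hop.mem_nhds hmem)).and (hev ρ hρ)).exists
      have hr0 : r ∈ Ioo (0 : ℝ) 1 := ⟨(le_max_right _ _).trans_lt hr.1, hr.2⟩
      have := memC3_extremalFun.injOn (hsub hv) (hball r hr0) hvr
      rw [this, mem_ball_zero_iff, norm_neg, Complex.norm_real, Real.norm_eq_abs,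
        abs_of_pos hr0.1] at hv
      exact absurd hv (not_lt.2 ((le_max_left _ _).trans hr.1.le))
  have h := infDist_le_dist_of_mem (x := extremalFun 0) hfr
  rw [extremalFun_zero, dist_zero_left, norm_neg, Complex.norm_real, Real.norm_eq_abs,
    abs_of_pos hD0] at h
  rw [boundaryDist, extremalFun_zero]
  exact h

/-! ### The Bohr radius and its sharpness. -/

theorem mainTheorem9 :
    ∃ r₃₁ ∈ Ioo (0 : ℝ) 1,
      -- `r₃₁` is the unique solution of the equation in `(0, 1)`
      (radiusFun r₃₁ = 0 ∧ ∀ r ∈ Ioo (0 : ℝ) 1, radiusFun r = 0 → r = r₃₁) ∧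
      -- the inequality holds on `|z| ≤ r₃₁` for the whole class
      (∀ f : ℂ → ℂ, MemC3 f → ∀ z : ℂ, ‖z‖ ≤ r₃₁ →
        Summable (fun n : ℕ => ‖taylorCoeff f (n + 2) * z ^ (n + 2)‖) ∧
        bohrSum f z ≤ boundaryDist f) ∧
      -- sharpness: some function of the class attains equality at `z = r₃₁` and violates the
      -- inequality at every larger radius
      (∃ f : ℂ → ℂ, MemC3 f ∧ bohrSum f (r₃₁ : ℂ) = boundaryDist f ∧
        ∀ r ∈ Ioo r₃₁ 1, boundaryDist f < bohrSum f (r : ℂ)) := by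

  obtain ⟨r₃₁, hr, hr0⟩ := exists_radiusFun_eq_zero
  have hIco : r₃₁ ∈ Ico (0 : ℝ) 1 := ⟨hr.1.le, hr.2⟩
  refine ⟨r₃₁, hr, ⟨hr0, fun r hr' h => ?_⟩, fun f hf z hz => ⟨?_, ?_⟩,
    extremalFun, memC3_extremalFun, ?_, fun r hr' => ?_⟩
  · exact strictMonoOn_radiusFun.injOn ⟨hr'.1.le, hr'.2⟩ hIco (h.trans hr0.symm)
  · exact (summable_nat_add_iff 2).2 (summable_norm_taylorCoeff hf.differentiableOn
      (mem_ball_zero_iff.2 (hz.trans_lt hr.2)))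
  · have h1 := hf.bohrSum_le (mem_ball_zero_iff.2 (hz.trans_lt hr.2))
    have h2 := strictMonoOn_radiusFun.monotoneOn ⟨norm_nonneg z, hz.trans_lt hr.2⟩ hIco hz
    have h3 := hf.le_boundaryDist
    linarith
  · rw [bohrSum_eq_of_taylorCoeff differentiableOn_extremalFun extremalFun_zero
      taylorCoeff_extremalFun hr, boundaryDist_extremalFun, hr0, zero_add]
  · have hr1 : r ∈ Ioo (0 : ℝ) 1 := ⟨hr.1.trans hr'.1, hr'.2⟩
    rw [bohrSum_eq_of_taylorCoeff differentiableOn_extremalFun extremalFun_zero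
      taylorCoeff_extremalFun hr1, boundaryDist_extremalFun]
    have := strictMonoOn_radiusFun hIco ⟨hr1.1.le, hr1.2⟩ hr'.1
    linarith
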